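/- Let $N\ge 1$ be an integer, $0<\alpha<N$ and $p>0$ be real numbers with $$\frac{N-2}{N+\alpha}\le \frac1p<\frac12 .$$ Let $H^1(\mathbb R^N)$ be the Sobolev space of real-valued functions with norm $\|u\|^2=\int_{\mathbb R^N}|\nabla u|^2+|u|^2$, and for $x\neq 0$ let $$I_\alpha(x)=\frac{A_\alpha}{|x|^{N-\alpha}},\qquad A_\alpha=\frac{\Gamma(\frac{N-\alpha}{2})}{\Gamma(\frac{\alpha}{2})\pi^{N/2}2^{\alpha}} .$$ For $u\in H^1(\mathbb R^N)$ put $u^+=\max(u,0)$, $u^-=\min(u,0)$ and $$\mathcal A(u)=\frac12\int_{\mathbb R^N}|\nabla u|^2+|u|^2-\frac1{2p}\int_{\mathbb R^N}(I_\alpha*|u|^p)|u|^p .$$ The functional $\mathcal A$ is differentiable on $H^1(\mathbb R^N)$. Let $$\mathcal N_0=\{u\in H^1(\mathbb R^N)\setminus\{0\}:\langle\mathcal A'(u),u\rangle=0\},\qquad c_0=\inf_{\mathcal N_0}\mathcal A,$$ $$\mathcal N_{\mathrm{nod}}=\{u\in H^1(\mathbb R^N):u^+\ne0\ne u^-,\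 \langle\mathcal A'(u),u^+\rangle=0=\langle\mathcal A'(u),u^-\rangle\},\qquad c_{\mathrm{nod}}=\inf_{\mathcal N_{\mathrm{nod}}}\mathcal A .$$ Both sets are nonempty and both infima are finite. Define $\xi=(\xi_+,\xi_-):H^1(\mathbb R^N)\to\mathbb R^2$ by $$\xi_\pm(u)=\frac{\int_{\mathbb R^N}(I_\alpha*|u|^p)|u^\pm|^p}{\int_{\mathbb R^N}|\nabla u^\pm|^2+|u^\pm|^2}-1\ \text{ if }u^\pm\neq0,\qquad \xi_\pm(u)=-1\ \text{ if }u^\pm=0 .$$ The map $\xi$ is continuous. Let $\mathbb B^2$ be the closed unit disc of $\mathbb R^2$ and, for $\varepsilon>0$, let $\Gamma=\Gamma_\varepsilon$ be the set of all $\gamma\in C(\mathbb B^2;H^1(\mathbb R^N))$ such that $0\notin\xi(\gamma(\partial\mathbb B^2))$, such that $\deg(\xi\circ\gamma)=1$, where $\deg$ is the Brouwer degree with respect to $0$, that is, the winding number around $0$ of $\xi\circ\gamma$ along the counterclockwise boundary circle, and such that, on $\partial\mathbb B^2$, $$\bigl(\max(\mathcal A\circ\gamma,0)\bigr)^{\frac{p-1}{p-2}}\le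 c_{\mathrm{nod}}^{\frac{p-1}{p-2}}+\varepsilon-c_0^{\frac{p-1}{p-2}} .$$ Then for every $\varepsilon>0$ $$c_{\mathrm{nod}}=\inf_{\gamma\in\Gamma_\varepsilon}\ \sup_{\mathbb B^2}\mathcal A\circ\gamma ,$$ and for every $\gamma\in\Gamma_\varepsilon$ one has $\mathcal N_{\mathrm{nod}}\cap\gamma(\mathbb B^2)\neq\emptyset$. -/

import Mathlib

open MeasureTheory
open scoped ContDiff ENNReal

noncomputable section

namespace Choquard

/-- The Euclidean space `ℝ^N`. -/
abbrev Space (N : ℕ) : Type := EuclideanSpace ℝ (Fin N)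

/-- `g` is the weak gradient of `u` on `ℝ^N`: for every test function `φ ∈ C_c^∞(ℝ^N)` and every
direction `v`, `∫ u ∂_v φ = - ∫ ⟨g, v⟩ φ`. -/
def IsWeakGradient {N : ℕ} (u : Space N → ℝ) (g : Space N → Space N) : Prop :=
  ∀ φ : Space N → ℝ, ContDiff ℝ ∞ φ → HasCompactSupport φ → ∀ v : Space N,
    ∫ x, u x * fderiv ℝ φ x v = - ∫ x, inner ℝ (g x) v * φ x

lemma integrable_left {N : ℕ} (u : Lp ℝ 2 (volume : Measure (Space N)))
    {φ : Space N → ℝ} (h : ContDiff ℝ ∞ φ) (hc : HasCompactSupport φ) (v : Space N) :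
    Integrable (fun x => u x * fderiv ℝ φ x v) := by
  have hcont : Continuous (fun x => fderiv ℝ φ x v) :=
    (h.continuous_fderiv (by simp)).clm_apply continuous_const
  have hm : MemLp (fun x => fderiv ℝ φ x v) 2 (volume : Measure (Space N)) :=
    hcont.memLp_of_hasCompactSupport (hc.fderiv_apply ℝ v)
  exact (Lp.memLp u).integrable_mul hm

lemma integrable_right {N : ℕ} (g : Lp (Space N) 2 (volume : Measure (Space N)))
    {φ : Space N → ℝ} (h : ContDiff ℝ ∞ φ) (hc : HasCompactSupport φ) (v : Space N) :
    Integrable (fun x => inner ℝ (g x) v * φ x) := by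
  have hm : MemLp φ 2 (volume : Measure (Space N)) :=
    h.continuous.memLp_of_hasCompactSupport hc
  exact ((Lp.memLp g).inner_const v).integrable_mul hm

/-- The Sobolev space `H¹(ℝ^N)` of real-valued functions, realized as the space of pairs `(u, ∇u)`
in the Hilbert space `L²(ℝ^N; ℝ) × L²(ℝ^N; ℝ^N)`, where `∇u` is the weak gradient of `u`. -/
def sobolevSubmodule (N : ℕ) : Submodule ℝ
    (WithLp 2 (Lp ℝ 2 (volume : Measure (Space N)) × Lp (Space N) 2 (volume : Measure (Space N))))
    where
  carrier := {w | IsWeakGradient (w.fst : Space N → ℝ) (w.snd : Space N → Space N)}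
  zero_mem' := by
    intro φ h hc v
    have h1 : ∫ x, (0 : Lp ℝ 2 (volume : Measure (Space N))) x * fderiv ℝ φ x v = 0 := by
      refine integral_eq_zero_of_ae ?_
      filter_upwards [Lp.coeFn_zero ℝ 2 (volume : Measure (Space N))] with x hx
      rw [hx, Pi.zero_apply, zero_mul]
    have h2 : ∫ x, inner ℝ ((0 : Lp (Space N) 2 (volume : Measure (Space N))) x) v * φ x = 0 := by
      refine integral_eq_zero_of_ae ?_
      filter_upwards [Lp.coeFn_zero (Space N) 2 (volume : Measure (Space N))] with x hx
      rw [hx, Pi.zero_apply, inner_zero_left, zero_mul, Pi.zero_apply]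
    change ∫ x, (0 : Lp ℝ 2 (volume : Measure (Space N))) x * fderiv ℝ φ x v
      = - ∫ x, inner ℝ ((0 : Lp (Space N) 2 (volume : Measure (Space N))) x) v * φ x
    rw [h1, h2, neg_zero]
  add_mem' := by
    intro a b ha hb φ h hc v
    have h1 : ∫ x, (a.fst + b.fst) x * fderiv ℝ φ x v
        = (∫ x, a.fst x * fderiv ℝ φ x v) + ∫ x, b.fst x * fderiv ℝ φ x v := by
      rw [← integral_add (integrable_left _ h hc v) (integrable_left _ h hc v)]
      refine integral_congr_ae ?_
      filter_upwards [Lp.coeFn_add a.fst b.fst] with x hx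
      rw [hx, Pi.add_apply, add_mul]
    have h2 : ∫ x, inner ℝ ((a.snd + b.snd) x) v * φ x
        = (∫ x, inner ℝ (a.snd x) v * φ x) + ∫ x, inner ℝ (b.snd x) v * φ x := by
      rw [← integral_add (integrable_right _ h hc v) (integrable_right _ h hc v)]
      refine integral_congr_ae ?_
      filter_upwards [Lp.coeFn_add a.snd b.snd] with x hx
      rw [hx, Pi.add_apply, inner_add_left, add_mul]
    have ha' := ha φ h hc v
    have hb' := hb φ h hc v
    change ∫ x, (a.fst + b.fst) x * fderiv ℝ φ x v = - ∫ x, inner ℝ ((a.snd + b.snd) x) v * φ x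
    rw [h1, h2, ha', hb']
    ring
  smul_mem' := by
    intro c a ha φ h hc v
    have h1 : ∫ x, (c • a.fst) x * fderiv ℝ φ x v = c * ∫ x, a.fst x * fderiv ℝ φ x v := by
      rw [← integral_const_mul]
      refine integral_congr_ae ?_
      filter_upwards [Lp.coeFn_smul c a.fst] with x hx
      simp [hx, mul_assoc]
    have h2 : ∫ x, inner ℝ ((c • a.snd) x) v * φ x = c * ∫ x, inner ℝ (a.snd x) v * φ x := by
      rw [← integral_const_mul]
      refine integral_congr_ae ?_
      filter_upwards [Lp.coeFn_smul c a.snd] with x hx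
      simp [hx, inner_smul_left, mul_assoc]
    have ha' := ha φ h hc v
    change ∫ x, (c • a.fst) x * fderiv ℝ φ x v = - ∫ x, inner ℝ ((c • a.snd) x) v * φ x
    rw [h1, h2, ha']
    ring

/-- `H¹(ℝ^N)` with its Hilbert norm `‖u‖² = ∫ |∇u|² + |u|²`. -/
abbrev H1 (N : ℕ) : Type := ↥(sobolevSubmodule N)

/-- The function underlying an element of `H¹(ℝ^N)`. -/
def H1.toFun {N : ℕ} (u : H1 N) : Space N → ℝ := u.1.fst

/-- The weak gradient of an element of `H¹(ℝ^N)`. -/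
def H1.grad {N : ℕ} (u : H1 N) : Space N → Space N := u.1.snd

open Classical in
/-- The element of `H¹(ℝ^N)` that is almost everywhere equal to `f`, for `f` in `H¹(ℝ^N)`.
(It is unique, because a weak gradient is; the value is `0` when `f` is not in `H¹(ℝ^N)`.) -/
def H1.ofFun {N : ℕ} (f : Space N → ℝ) : H1 N :=
  if h : ∃ w : H1 N, w.toFun =ᵐ[volume] f then h.choose else 0

/-- The positive part `u⁺ = max (u, 0)`, which belongs to `H¹(ℝ^N)` whenever `u` does. -/
def H1.pos {N : ℕ} (u : H1 N) : H1 N := H1.ofFun fun x => max (u.toFun x) 0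

/-- The negative part `u⁻ = min (u, 0) ≤ 0`, which belongs to `H¹(ℝ^N)` whenever `u` does. -/
def H1.neg {N : ℕ} (u : H1 N) : H1 N := H1.ofFun fun x => min (u.toFun x) 0

/-- The Riesz kernel `I_α(x) = A_α / |x|^(N - α)` on `ℝ^N`. -/
def rieszKernel (N : ℕ) (α : ℝ) (x : Space N) : ℝ :=
  (Real.Gamma ((N - α) / 2) / (Real.Gamma (α / 2) * Real.pi ^ ((N : ℝ) / 2) * 2 ^ α))
    / ‖x‖ ^ ((N : ℝ) - α)

/-- The convolution `I_α ∗ f`. -/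
def rieszPotential {N : ℕ} (α : ℝ) (f : Space N → ℝ) (x : Space N) : ℝ :=
  ∫ y, rieszKernel N α (x - y) * f y

/-- `∫ |∇u|² + |u|²`. -/
def energy {N : ℕ} (u : H1 N) : ℝ := ∫ x, (‖u.grad x‖ ^ 2 + |u.toFun x| ^ 2)

/-- `∫ (I_α ∗ |u|^p) |w|^p`. -/
def interaction {N : ℕ} (α p : ℝ) (u w : H1 N) : ℝ :=
  ∫ x, rieszPotential α (fun y => |u.toFun y| ^ p) x * |w.toFun x| ^ p

/-- The action functional of the Choquard equation. -/
def action {N : ℕ} (α p : ℝ) (u : H1 N) : ℝ :=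
  1 / 2 * energy u - 1 / (2 * p) * interaction α p u u

/-- The Nehari manifold `𝒩₀`. -/
def nehari (N : ℕ) (α p : ℝ) : Set (H1 N) :=
  {u | u ≠ 0 ∧ fderiv ℝ (action α p) u u = 0}

/-- The nodal Nehari set `𝒩_nod`. -/
def nehariNod (N : ℕ) (α p : ℝ) : Set (H1 N) :=
  {u | u.pos ≠ 0 ∧ u.neg ≠ 0 ∧
    fderiv ℝ (action α p) u u.pos = 0 ∧ fderiv ℝ (action α p) u u.neg = 0}

/-- The level `c₀ = inf_{𝒩₀} 𝒜`. -/
def c0 (N : ℕ) (α p : ℝ) : ℝ := sInf (action α p '' nehari N α p)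

/-- The level `c_nod = inf_{𝒩_nod} 𝒜`. -/
def cNod (N : ℕ) (α p : ℝ) : ℝ := sInf (action α p '' nehariNod N α p)

open Classical in
/-- `∫ (I_α ∗ |u|^p) |w|^p / ∫ (|∇w|² + |w|²) - 1` if `w ≠ 0`, and `-1` if `w = 0`. -/
def xiPart {N : ℕ} (α p : ℝ) (u w : H1 N) : ℝ :=
  if w = 0 then -1 else interaction α p u w / energy w - 1

/-- The map `ξ = (ξ₊, ξ₋)`; the plane `ℝ²` is identified with `ℂ`. -/
def xi {N : ℕ} (α p : ℝ) (u : H1 N) : ℂ := ⟨xiPart α p u u.pos, xiPart α p u u.neg⟩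

/-- The closed unit disc `𝔹²` of the plane. -/
abbrev Disc : Type := ↥(Metric.closedBall (0 : ℂ) 1)

/-- The point `(cos s, sin s)` of `∂𝔹²`. -/
def circlePoint (s : ℝ) : Disc :=
  ⟨Complex.exp (s * Complex.I), by simp [Complex.norm_exp_ofReal_mul_I]⟩

/-- For `f` continuous on the disc and without zeros on its boundary: the degree of `f` on the disc
with respect to `0`, i.e. the winding number around `0` of the loop `s ↦ f (cos s, sin s)`,
is `n`: along a continuous choice of the argument `θ`, it increases by `2πn` over one turn. -/
def HasDegree (f : Disc → ℂ) (n : ℤ) : Prop :=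
  ∃ θ : ℝ → ℝ, Continuous θ ∧
    (∀ s, f (circlePoint s) = (‖f (circlePoint s)‖ : ℂ) * Complex.exp (θ s * Complex.I)) ∧
    θ (2 * Real.pi) - θ 0 = 2 * Real.pi * n

/-- The class `Γ` (depending on `ε`). The power `𝒜^((p-1)/(p-2))` is read as that of the
nonnegative part of `𝒜`, so that the last condition holds wherever `𝒜` is negative. -/
def minimaxClass (N : ℕ) (α p ε : ℝ) : Set C(Disc, H1 N) :=
  {γ | (∀ t : Disc, ‖(t : ℂ)‖ = 1 → xi α p (γ t) ≠ 0) ∧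
    HasDegree (fun t => xi α p (γ t)) 1 ∧
    ∀ t : Disc, ‖(t : ℂ)‖ = 1 →
      (max (action α p (γ t)) 0) ^ ((p - 1) / (p - 2)) ≤
        cNod N α p ^ ((p - 1) / (p - 2)) + ε - c0 N α p ^ ((p - 1) / (p - 2))}

end Choquard

end

/-! Write κ = (p-1)/(p-2). The lower bound `c_nod ≤ sup 𝒜 ∘ γ` is topological. The zeros of `ξ` are
exactly the points of the nodal Nehari set, since `ξ_±` takes the value -1 when the corresponding
part vanishes. A map of degree one on the disc has a zero, because a zero-free map lifts through the
complex exponential and so has winding number 0. Hence every admissible disc meets the nodal Nehari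
set, by `HasDegree.exists_eq_zero` and `exists_mem_nehariNod`.

The upper bound comes from one explicit disc for each w in the nodal Nehari set, lying in the family
σ^(1/p) w⁺ + τ^(1/p) w⁻ with σ, τ ≥ 0. In these parameters the nonlocal term is the quadratic form
aσ² + 2mστ + bτ², where a, b, m are the self and mutual interactions of w⁺ and w⁻, while the norm
term is concave because 2/p < 1. The Riesz kernel is positive definite, so m² ≤ ab. With Bernoulli's
inequality this gives a maximum of the action at (1, 1), that is at w (`action_nodalFamily_le`). The
disc is spread over the square [0, T]² with T large. On its boundary each point lies on one of the
two rays τ = 0, σ = 0, or has action at most 0, and a coordinate of `ξ` has the same sign as the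
coordinate of the disc, which forces degree one.

The boundary condition is an energy splitting. By m² ≤ ab and Young's inequality, the action along
the ray of w^± satisfies 𝒜^κ ≤ 𝒜(w)^κ ‖w^±‖²/‖w‖² (`max_action_rpow_le`). The two fractions add up
to 1. Each ray also meets the Nehari manifold, so each right-hand side is at least c₀^κ, and on
either ray 𝒜^κ ≤ 𝒜(w)^κ - c₀^κ. Taking 𝒜(w) close enough to `c_nod` absorbs ε.

The analytic input is as follows. The Hardy–Littlewood–Sobolev inequality is proved on the diagonal
(`rieszForm_self_le`) and extended by Cauchy–Schwarz, which follows from writing the kernel as a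
superposition of products of Gaussians (`rieszForm_sq_le`). The Sobolev embedding
(`exists_sobolev_embedding`) and the differentiability of u ↦ |u|^p between Lebesgue spaces
(`exists_hasFDerivAt_absPow`) make the action differentiable. The chain rule for weak gradients
gives u^± in H¹ with u⁺ orthogonal to u⁻, and `H1.continuous_abs` gives their continuous dependence
on u, hence continuity of `ξ`. -/

namespace Choquard

/-! ### The Riesz kernel and the Hardy–Littlewood–Sobolev inequality on the diagonal -/

/-- The kernel `|z| ^ (-lam)`, with values in `[0, ∞]` (and value `0` at the origin). -/
noncomputable def powKer {N : ℕ} (lam : ℝ) (z : Space N) : ℝ≥0∞ := ENNReal.ofReal (‖z‖ ^ (-lam))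

lemma measurable_powKer {N : ℕ} (lam : ℝ) : Measurable (powKer lam : Space N → ℝ≥0∞) := by
  unfold powKer; fun_prop

lemma powKer_neg {N : ℕ} (lam : ℝ) (z : Space N) : powKer lam (-z) = powKer lam z := by
  simp [powKer]

open scoped Pointwise in
lemma setIntegral_smul_norm_rpow {N : ℕ} (β : ℝ) {R : ℝ} (hR : 0 < R) (s : Set (Space N)) :
    ∫ z in R • s, ‖z‖ ^ (-β) = R ^ ((N : ℝ) - β) * ∫ z in s, ‖z‖ ^ (-β) := by
  have h := Measure.setIntegral_comp_smul_of_pos (volume : Measure (Space N))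
    (fun z => ‖z‖ ^ (-β)) s hR
  simp only [norm_smul, Real.norm_of_nonneg hR.le, finrank_euclideanSpace, Fintype.card_fin,
    smul_eq_mul] at h
  have h2 : ∫ z in s, (R * ‖z‖) ^ (-β) = R ^ (-β) * ∫ z in s, ‖z‖ ^ (-β) := by
    rw [← integral_const_mul]
    congr 1; ext z
    rw [Real.mul_rpow hR.le (norm_nonneg _)]
  rw [h2] at h
  rw [Real.rpow_sub hR, Real.rpow_natCast, div_eq_mul_inv, ← Real.rpow_neg hR.le, mul_assoc, h]
  field_simp

lemma integrableOn_ball_norm_rpow {N : ℕ} (hN : 1 ≤ N) {lam : ℝ} (hlam : lam < N) (R : ℝ) :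
    IntegrableOn (fun z : Space N => ‖z‖ ^ (-lam)) (Metric.ball 0 R) := by
  refine integrableOn_ball_of_norm_le_rpow (C := 1) (α := lam) (by simpa using hN)
    (by simpa using hlam) (Filter.Eventually.of_forall fun z => ?_) ?_
  · rw [Real.norm_of_nonneg (by positivity), one_mul]
  · exact (by fun_prop : Measurable fun z : Space N => ‖z‖ ^ (-lam)).aestronglyMeasurable

lemma integrableOn_compl_ball_norm_rpow {N : ℕ} {β : ℝ} (hβ : N < β) {R : ℝ} (hR : 0 < R) :
    IntegrableOn (fun z : Space N => ‖z‖ ^ (-β)) (Metric.ball 0 R)ᶜ := by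
  have hβ0 : 0 < β := lt_of_le_of_lt (Nat.cast_nonneg N) hβ
  have h := (integrable_one_add_norm (E := Space N) (μ := volume) (r := β)
    (by simpa using hβ)).const_mul (((1 + R) / R) ^ β)
  refine Integrable.mono' h.integrableOn
    (by fun_prop : Measurable fun z : Space N => ‖z‖ ^ (-β)).aestronglyMeasurable ?_
  refine (ae_restrict_iff' Metric.isOpen_ball.measurableSet.compl).2
    (Filter.Eventually.of_forall fun z hz => ?_)
  have hz' : R ≤ ‖z‖ := by simpa using hz
  have hz0 : 0 < ‖z‖ := hR.trans_le hz'
  rw [Real.norm_of_nonneg (by positivity), Real.rpow_neg (by positivity),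
    Real.rpow_neg (by positivity), ← div_eq_mul_inv, ← Real.div_rpow (by positivity) (by positivity),
    ← Real.inv_rpow (by positivity)]
  refine Real.rpow_le_rpow (by positivity) ?_ hβ0.le
  rw [inv_eq_one_div, div_div, div_le_div_iff₀ hz0 (by positivity)]
  nlinarith

-- The kernel is homogeneous, so the integral over a ball of radius R is the one over the unit ball
-- times a power of R. The constant K is the integral over the unit ball.
open scoped Pointwise in
lemma lintegral_ball_powKer_le {N : ℕ} (hN : 1 ≤ N) {lam : ℝ} (hlam : lam < N) :
    ∃ K : ℝ, 0 ≤ K ∧ ∀ R : ℝ, 0 < R → ∫⁻ z in Metric.ball (0 : Space N) R, powKer lam z ≤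
      ENNReal.ofReal (K * R ^ ((N : ℝ) - lam)) := by
  refine ⟨∫ z in Metric.ball (0 : Space N) 1, ‖z‖ ^ (-lam), by positivity, fun R hR => ?_⟩
  have h := setIntegral_smul_norm_rpow lam hR (Metric.ball (0 : Space N) 1)
  rw [smul_ball hR.ne', smul_zero, Real.norm_of_nonneg hR.le, mul_one] at h
  rw [mul_comm, ← h, ofReal_integral_eq_lintegral_ofReal (integrableOn_ball_norm_rpow hN hlam R)
    (Filter.Eventually.of_forall fun z => by positivity)]
  rfl

open scoped Pointwise in
lemma lintegral_compl_ball_powKer_le {N : ℕ} {β : ℝ} (hβ : N < β) :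
    ∃ K : ℝ, 0 ≤ K ∧ ∀ R : ℝ, 0 < R → ∫⁻ z in (Metric.ball (0 : Space N) R)ᶜ, powKer β z ≤
      ENNReal.ofReal (K * R ^ ((N : ℝ) - β)) := by
  refine ⟨∫ z in (Metric.ball (0 : Space N) 1)ᶜ, ‖z‖ ^ (-β), by positivity, fun R hR => ?_⟩
  have h := setIntegral_smul_norm_rpow β hR (Metric.ball (0 : Space N) 1)ᶜ
  have hs : R • (Metric.ball (0 : Space N) 1)ᶜ = (R • Metric.ball (0 : Space N) 1)ᶜ :=
    Set.smul_set_compl (a := Units.mk0 R hR.ne')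
  rw [hs, smul_ball hR.ne', smul_zero, Real.norm_of_nonneg hR.le,
    mul_one] at h
  rw [mul_comm, ← h, ofReal_integral_eq_lintegral_ofReal (integrableOn_compl_ball_norm_rpow hβ hR)
    (Filter.Eventually.of_forall fun z => by positivity)]
  rfl

/-- The potential of a function bounded by `t`. -/
lemma lintegral_powKer_mul_le {N : ℕ} (hN : 1 ≤ N) {lam : ℝ} (h0 : 0 < lam) (hlam : lam < N) :
    ∃ C : ℝ, 0 ≤ C ∧ ∀ (F t : ℝ), 0 < F → 0 < t → ∀ h : Space N → ℝ≥0∞, Measurable h →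
      (∀ y, h y ≤ ENNReal.ofReal t) →
      ∫⁻ y, h y ^ (2 * N / (2 * N - lam)) ≤ ENNReal.ofReal F →
      ∀ x, ∫⁻ y, powKer lam (x - y) * h y ≤
        ENNReal.ofReal (C * F ^ (1 - lam / N) * t ^ (2 * N / (2 * N - lam) - 1)) := by
  obtain ⟨K₁, hK₁, H₁⟩ := lintegral_ball_powKer_le hN hlam
  have hN0 : (0 : ℝ) < N := by exact_mod_cast hN
  obtain ⟨K₂, hK₂, H₂⟩ := lintegral_compl_ball_powKer_le (N := N) (β := 2 * N) (by linarith)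
  have hlam2 : 0 < 2 * N - lam := by linarith
  refine ⟨K₁ + K₂ ^ (lam / (2 * N)), by positivity, fun F t hF ht h hm hht hhF x => ?_⟩
  set r : ℝ := 2 * N / (2 * N - lam) with hr
  have hr0 : 0 < r := by positivity
  -- The radius balances the near part, of order t R^(N-lam), against the far part, of order
  -- R^(-lam/2) F^(1/r).
  set R : ℝ := (F ^ (1 / r) / t) ^ (2 / (2 * N - lam)) with hRdef
  have hR : 0 < R := by positivity
  -- near part
  have near : ∫⁻ y in Metric.ball x R, powKer lam (x - y) * h y ≤
      ENNReal.ofReal (K₁ * R ^ ((N : ℝ) - lam)) * ENNReal.ofReal t := by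
    calc _ ≤ ∫⁻ y in Metric.ball x R, powKer lam (x - y) * ENNReal.ofReal t :=
          lintegral_mono fun y => by gcongr; exact hht y
      _ = (∫⁻ y in Metric.ball x R, powKer lam (x - y)) * ENNReal.ofReal t := by
          rw [lintegral_mul_const]
          exact (measurable_powKer lam).comp (by fun_prop)
      _ ≤ _ := by
          gcongr
          refine le_trans (le_of_eq ?_) (H₁ R hR)
          rw [← lintegral_indicator Metric.isOpen_ball.measurableSet,
            ← lintegral_indicator Metric.isOpen_ball.measurableSet,
            ← lintegral_sub_left_eq_self _ x]
          refine lintegral_congr fun y => ?_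
          simp only [Set.indicator, Metric.mem_ball, dist_eq_norm]
          rw [sub_sub_self, sub_sub_cancel_left, norm_neg, sub_zero]
  have far : ∫⁻ y in (Metric.ball x R)ᶜ, powKer lam (x - y) * h y ≤
      ENNReal.ofReal (K₂ ^ (lam / (2 * N)) * R ^ (-(lam / 2)) * F ^ (1 / r)) := by
    -- Hölder with exponent 2N/lam turns the kernel into |z|^(-2N), which is integrable away from
    -- the origin.
    have hc : (2 * N / lam).HolderConjugate r := by
      rw [Real.holderConjugate_iff]
      refine ⟨by rw [lt_div_iff₀ h0]; linarith, ?_⟩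
      rw [hr]; field_simp; ring
    have e1 : (∫⁻ y in (Metric.ball x R)ᶜ, powKer lam (x - y) ^ (2 * N / lam)) ≤
        ENNReal.ofReal (K₂ * R ^ ((N : ℝ) - 2 * N)) := by
      refine le_trans (le_of_eq ?_) (H₂ R hR)
      rw [← lintegral_indicator Metric.isOpen_ball.measurableSet.compl,
            ← lintegral_indicator Metric.isOpen_ball.measurableSet.compl,
            ← lintegral_sub_left_eq_self _ x]
      refine lintegral_congr fun y => ?_
      simp only [Set.indicator, Set.mem_compl_iff, Metric.mem_ball, dist_eq_norm]
      rw [sub_sub_self, sub_sub_cancel_left, norm_neg, sub_zero]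
      congr 1
      rw [powKer, powKer, ENNReal.ofReal_rpow_of_nonneg (by positivity) (by positivity),
        ← Real.rpow_mul (by positivity)]
      congr 2
      field_simp
    calc _ ≤ (∫⁻ y in (Metric.ball x R)ᶜ, powKer lam (x - y) ^ (2 * N / lam)) ^ (1 / (2 * N / lam))
          * (∫⁻ y in (Metric.ball x R)ᶜ, h y ^ r) ^ (1 / r) :=
          ENNReal.lintegral_mul_le_Lp_mul_Lq _ hc
            ((measurable_powKer lam).comp (by fun_prop)).aemeasurable hm.aemeasurable
      _ ≤ ENNReal.ofReal (K₂ * R ^ ((N : ℝ) - 2 * N)) ^ (1 / (2 * N / lam))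
          * ENNReal.ofReal F ^ (1 / r) := by
          gcongr
          exact (setLIntegral_le_lintegral _ _).trans hhF
      _ = _ := by
          rw [ENNReal.ofReal_rpow_of_nonneg (by positivity) (by positivity),
            ENNReal.ofReal_rpow_of_nonneg (by positivity) (by positivity),
            ← ENNReal.ofReal_mul (by positivity), Real.mul_rpow (by positivity) (by positivity),
            ← Real.rpow_mul hR.le]
          congr 4
          · field_simp
          · field_simp; ring
  rw [← lintegral_add_compl _ (Metric.isOpen_ball (x := x) (ε := R)).measurableSet]
  refine (add_le_add near far).trans ?_
  rw [← ENNReal.ofReal_mul (by positivity), ← ENNReal.ofReal_add (by positivity) (by positivity)]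
  refine ENNReal.ofReal_le_ofReal (le_of_eq ?_)
  have a1 : R ^ ((N : ℝ) - lam) * t = F ^ (1 - lam / N) * t ^ (r - 1) := by
    rw [hRdef, ← Real.rpow_mul (by positivity), Real.div_rpow (by positivity) ht.le,
      ← Real.rpow_mul hF.le, div_mul_eq_mul_div, mul_div_assoc]
    congr 1
    · congr 1; rw [hr]; field_simp
    · rw [← Real.rpow_one_sub' ht.le]
      · congr 1; rw [hr]; field_simp; ring
      · have : 1 - 2 / (2 * N - lam) * (N - lam) = lam / (2 * N - lam) := by field_simp; ring
        rw [this]; positivity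
  have a2 : R ^ (-(lam / 2)) * F ^ (1 / r) = F ^ (1 - lam / N) * t ^ (r - 1) := by
    rw [hRdef, ← Real.rpow_mul (by positivity), Real.div_rpow (by positivity) ht.le,
      ← Real.rpow_mul hF.le, div_eq_mul_inv, ← Real.rpow_neg ht.le, mul_right_comm,
      ← Real.rpow_add hF]
    congr 2
    · rw [hr]; field_simp; ring
    · rw [hr]; field_simp; ring
  linear_combination K₁ * a1 + K₂ ^ (lam / (2 * N)) * a2

/-- The bilinear form `∬ |x - y| ^ (-lam) f(y) g(x) dy dx` on nonnegative functions. -/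
noncomputable def rieszForm {N : ℕ} (lam : ℝ) (f g : Space N → ℝ≥0∞) : ℝ≥0∞ :=
  ∫⁻ x, ∫⁻ y, powKer lam (x - y) * f y * g x

/-- By symmetry of the kernel the double integral is at most twice its part over {f(y) ≤ f(x)}. On
that part the inner density is bounded by f(x), which makes the estimate for bounded densities
applicable. -/
lemma rieszForm_self_le_two_mul {N : ℕ} (lam : ℝ) {f : Space N → ℝ≥0∞} (hf : Measurable f) :
    rieszForm lam f f ≤ 2 * ∫⁻ x, f x * ∫⁻ y, powKer lam (x - y) *
      ({y | f y ≤ f x}.indicator f y) := by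
  have hk := measurable_powKer (N := N) lam
  obtain ⟨G, hG⟩ : ∃ G : Space N → Space N → ℝ≥0∞, G = fun x y => powKer lam (x - y) *
      ({y | f y ≤ f x}.indicator f y) * f x := ⟨_, rfl⟩
  have hGm : Measurable (Function.uncurry G) := by
    rw [hG]
    refine Measurable.mul (Measurable.mul (hk.comp (by fun_prop)) ?_) (hf.comp measurable_fst)
    have : (fun z : Space N × Space N => {y | f y ≤ f z.1}.indicator f z.2) =
        {z : Space N × Space N | f z.2 ≤ f z.1}.indicator (fun z => f z.2) := by
      ext z; simp [Set.indicator]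
    change Measurable (fun z : Space N × Space N => {y | f y ≤ f z.1}.indicator f z.2)
    rw [this]
    exact (hf.comp measurable_snd).indicator
      (measurableSet_le (hf.comp measurable_snd) (hf.comp measurable_fst))
  have hGx : ∀ x, ∫⁻ y, G x y = f x * ∫⁻ y, powKer lam (x - y) *
      ({y | f y ≤ f x}.indicator f y) := fun x => by
    simp only [hG]
    rw [lintegral_mul_const, mul_comm]
    exact (hk.comp (by fun_prop)).mul (hf.indicator (measurableSet_le hf measurable_const))
  calc rieszForm lam f f ≤ ∫⁻ x, ∫⁻ y, (G x y + G y x) := by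
        refine lintegral_mono fun x => lintegral_mono fun y => ?_
        simp only [hG, Set.indicator, Set.mem_ofPred_eq]
        rw [← powKer_neg lam (y - x), neg_sub]
        rcases le_total (f y) (f x) with h | h
        · simp [h]
        · simp [h, mul_right_comm]
    _ = (∫⁻ x, ∫⁻ y, G x y) + ∫⁻ x, ∫⁻ y, G y x := by
        rw [← lintegral_add_left]
        · refine lintegral_congr fun x => lintegral_add_left ?_ _
          exact hGm.comp (measurable_prodMk_left)
        · exact hGm.lintegral_prod_right'
    _ = 2 * ∫⁻ x, ∫⁻ y, G x y := by
        rw [lintegral_lintegral_swap (f := fun x y => G y x), two_mul]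
        exact (hGm.comp measurable_swap).aemeasurable
    _ = _ := by simp_rw [hGx]

/-- The Hardy–Littlewood–Sobolev inequality on the diagonal. -/
theorem rieszForm_self_le {N : ℕ} (hN : 1 ≤ N) {lam : ℝ} (h0 : 0 < lam) (hlam : lam < N) :
    ∃ C : ℝ, 0 ≤ C ∧ ∀ f : Space N → ℝ≥0∞, Measurable f →
      rieszForm lam f f ≤ ENNReal.ofReal C *
        (∫⁻ y, f y ^ (2 * N / (2 * N - lam))) ^ (2 - lam / N) := by
  obtain ⟨C, hC, H⟩ := lintegral_powKer_mul_le hN h0 hlam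
  have hN0 : (0 : ℝ) < N := by exact_mod_cast hN
  have hlam2 : 0 < 2 * N - lam := by linarith
  have hlN : lam / N < 1 := by rw [div_lt_one hN0]; exact hlam
  -- The summand 1 keeps the constant positive, so that the right-hand side is infinite when ∫ f^r
  -- is.
  refine ⟨2 * C + 1, by positivity, fun f hf => ?_⟩
  set r : ℝ := 2 * N / (2 * N - lam) with hr
  have hr0 : 0 < r := by positivity
  set F : ℝ≥0∞ := ∫⁻ y, f y ^ r with hFdef
  rcases eq_or_ne F ⊤ with hF | hF
  · rw [hF, ENNReal.top_rpow_of_pos (by linarith), ENNReal.mul_top]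
    · exact le_top
    · simp; positivity
  rcases eq_or_ne F 0 with hF0 | hF0
  · have hf0 : ∀ᵐ y, f y = 0 := by
      rw [hFdef, lintegral_eq_zero_iff (by fun_prop)] at hF0
      filter_upwards [hF0] with y hy
      simpa [hr0, hr0.not_gt] using hy
    have : rieszForm lam f f = 0 := by
      unfold rieszForm
      refine (lintegral_congr_ae ?_).trans lintegral_zero
      filter_upwards [hf0] with x hx
      simp [hx]
    rw [this]; exact zero_le
  have hfin : ∀ᵐ x, f x ≠ ⊤ := by
    filter_upwards [ae_lt_top (by fun_prop) hF] with x hx hx'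
    rw [hx', ENNReal.top_rpow_of_pos hr0] at hx
    exact lt_irrefl _ hx
  have hFt : 0 < F.toReal := ENNReal.toReal_pos hF0 hF
  have hFof : ENNReal.ofReal F.toReal = F := ENNReal.ofReal_toReal hF
  -- For each x the potential bound is used with level t = f(x) on f restricted to {f ≤ f(x)};
  -- multiplying by f(x) turns f(x)^(r-1) into f(x)^r.
  have key : ∀ᵐ x, f x * ∫⁻ y, powKer lam (x - y) * ({y | f y ≤ f x}.indicator f y) ≤
      ENNReal.ofReal (C * F.toReal ^ (1 - lam / N)) * f x ^ r := by
    filter_upwards [hfin] with x hx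
    rcases eq_or_ne (f x) 0 with hx0 | hx0
    · simp [hx0]
    have hxt : 0 < (f x).toReal := ENNReal.toReal_pos hx0 hx
    have h1 := H F.toReal (f x).toReal hFt hxt ({y | f y ≤ f x}.indicator f)
      (hf.indicator (measurableSet_le hf measurable_const)) (fun y => ?_) ?_ x
    · calc _ ≤ ENNReal.ofReal (f x).toReal * ENNReal.ofReal
              (C * F.toReal ^ (1 - lam / N) * (f x).toReal ^ (r - 1)) := by
            rw [ENNReal.ofReal_toReal hx]; exact mul_le_mul_right h1 _
        _ = ENNReal.ofReal (C * F.toReal ^ (1 - lam / N)) * ENNReal.ofReal (f x).toReal ^ r := by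
            rw [← ENNReal.ofReal_mul hxt.le, ENNReal.ofReal_rpow_of_nonneg hxt.le hr0.le,
              ← ENNReal.ofReal_mul (by positivity), Real.rpow_sub hxt, Real.rpow_one]
            congr 1; field_simp
        _ = _ := by rw [ENNReal.ofReal_toReal hx]
    · rw [ENNReal.ofReal_toReal hx, Set.indicator]
      split_ifs with h
      · exact h
      · exact zero_le
    · rw [hFof]
      refine lintegral_mono fun y => ?_
      exact ENNReal.rpow_le_rpow (Set.indicator_le_self _ _ _) hr0.le
  calc rieszForm lam f f ≤ 2 * ∫⁻ x, f x * ∫⁻ y, powKer lam (x - y) *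
      ({y | f y ≤ f x}.indicator f y) := rieszForm_self_le_two_mul lam hf
    _ ≤ 2 * ∫⁻ x, ENNReal.ofReal (C * F.toReal ^ (1 - lam / N)) * f x ^ r := by
        gcongr 2 * ?_
        exact lintegral_mono_ae key
    _ = ENNReal.ofReal (2 * C * F.toReal ^ (2 - lam / N)) := by
        rw [lintegral_const_mul _ (by fun_prop), ← hFdef]
        conv_lhs => rw [← hFof]
        rw [← ENNReal.ofReal_mul (by positivity), ENNReal.toReal_ofReal hFt.le,
          show (2 : ℝ≥0∞) = ENNReal.ofReal 2 by simp,
          ← ENNReal.ofReal_mul (by positivity)]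
        congr 1
        rw [show 2 - lam / N = (1 - lam / N) + 1 by ring, Real.rpow_add hFt, Real.rpow_one]
        ring
    _ ≤ _ := by
        conv_rhs => rw [← hFof]
        rw [ENNReal.ofReal_rpow_of_nonneg hFt.le (by linarith),
          ← ENNReal.ofReal_mul (by positivity)]
        refine ENNReal.ofReal_le_ofReal ?_
        have : 0 ≤ F.toReal ^ (2 - lam / N) := by positivity
        nlinarith

/-! ### Positive definiteness of the Riesz kernel -/

/-- A kernel which is a superposition of rank-one kernels satisfies the Cauchy–Schwarz
inequality. -/
lemma sq_lintegral_kernel_le {X Ω : Type*} [MeasurableSpace X] [MeasurableSpace Ω]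
    {μ : Measure X} [SFinite μ] {ν : Measure Ω} [SFinite ν] {k : X → X → ℝ≥0∞}
    {h : Ω → X → ℝ≥0∞} (hh : Measurable (Function.uncurry h))
    (hk : ∀ x, ∀ᵐ y ∂μ, k x y = ∫⁻ w, h w x * h w y ∂ν)
    {f g : X → ℝ≥0∞} (hf : Measurable f) (hg : Measurable g) :
    (∫⁻ x, ∫⁻ y, k x y * f y * g x ∂μ ∂μ) ^ 2 ≤
      (∫⁻ x, ∫⁻ y, k x y * f y * f x ∂μ ∂μ) * ∫⁻ x, ∫⁻ y, k x y * g y * g x ∂μ ∂μ := by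
  -- Tonelli turns the form into the L²(ν) pairing of the transforms ∫ h(w, ·) f and ∫ h(w, ·) g, to
  -- which Cauchy–Schwarz in L²(ν) applies.
  have rep : ∀ f g : X → ℝ≥0∞, Measurable f → Measurable g →
      ∫⁻ x, ∫⁻ y, k x y * f y * g x ∂μ ∂μ =
        ∫⁻ w, (∫⁻ y, h w y * f y ∂μ) * ∫⁻ x, h w x * g x ∂μ ∂ν := by
    intro f g hf hg
    have hwm : ∀ w, Measurable (h w) := fun w => hh.comp measurable_prodMk_left
    have hm1 : Measurable fun z : Ω × X => ∫⁻ y, h z.1 y * f y ∂μ := by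
      have : Measurable fun w => ∫⁻ y, h w y * f y ∂μ :=
        Measurable.lintegral_prod_right' (f := fun z : Ω × X => h z.1 z.2 * f z.2)
          (hh.mul (hf.comp measurable_snd))
      exact this.comp measurable_fst
    calc _ = ∫⁻ x, ∫⁻ y, ∫⁻ w, h w x * h w y * f y * g x ∂ν ∂μ ∂μ := by
          refine lintegral_congr fun x => lintegral_congr_ae ?_
          filter_upwards [hk x] with y hy
          rw [hy, mul_assoc, ← lintegral_mul_const]
          · simp_rw [mul_assoc]
          · exact (hh.comp measurable_prodMk_right).mul (hh.comp measurable_prodMk_right)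
      _ = ∫⁻ x, ∫⁻ w, ∫⁻ y, h w x * h w y * f y * g x ∂μ ∂ν ∂μ := by
          refine lintegral_congr fun x => lintegral_lintegral_swap (Measurable.aemeasurable ?_)
          have h1 : Measurable fun z : X × Ω => h z.2 x :=
            hh.comp (measurable_snd.prodMk measurable_const)
          have h2 : Measurable fun z : X × Ω => h z.2 z.1 :=
            hh.comp (measurable_snd.prodMk measurable_fst)
          exact ((h1.mul h2).mul (hf.comp measurable_fst)).mul measurable_const
      _ = ∫⁻ x, ∫⁻ w, (∫⁻ y, h w y * f y ∂μ) * (h w x * g x) ∂ν ∂μ := by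
          refine lintegral_congr fun x => lintegral_congr fun w => ?_
          rw [← lintegral_mul_const _ (show Measurable fun y => h w y * f y from (hwm w).mul hf)]
          refine lintegral_congr fun y => ?_
          ring
      _ = ∫⁻ w, ∫⁻ x, (∫⁻ y, h w y * f y ∂μ) * (h w x * g x) ∂μ ∂ν := by
          refine (lintegral_lintegral_swap (Measurable.aemeasurable ?_)).symm
          exact hm1.mul (hh.mul (hg.comp measurable_snd))
      _ = _ := by
          refine lintegral_congr fun w => ?_
          rw [lintegral_const_mul _ (show Measurable fun y => h w y * g y from (hwm w).mul hg)]
  have hm : ∀ f : X → ℝ≥0∞, Measurable f → Measurable fun w => ∫⁻ y, h w y * f y ∂μ :=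
    fun f hf => Measurable.lintegral_prod_right' (f := fun z : Ω × X => h z.1 z.2 * f z.2)
          (hh.mul (hf.comp measurable_snd))
  rw [rep f g hf hg, rep f f hf hf, rep g g hg hg]
  have hcs := ENNReal.lintegral_mul_le_Lp_mul_Lq ν Real.HolderConjugate.two_two
    (hm f hf).aemeasurable (hm g hg).aemeasurable
  simp only [Pi.mul_apply] at hcs
  calc _ ≤ ((∫⁻ w, (∫⁻ y, h w y * f y ∂μ) ^ (2 : ℝ) ∂ν) ^ (1 / (2 : ℝ)) *
        (∫⁻ w, (∫⁻ y, h w y * g y ∂μ) ^ (2 : ℝ) ∂ν) ^ (1 / (2 : ℝ))) ^ 2 := by gcongr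
    _ = _ := by
        rw [mul_pow, ← ENNReal.rpow_natCast, ← ENNReal.rpow_natCast, ← ENNReal.rpow_mul,
          ← ENNReal.rpow_mul]
        simp [sq]

/-- By the parallelogram law the two exponents combine into a Gaussian centred at the midpoint of x
and y, times exp(-s|x-y|²). -/
lemma lintegral_gaussian_mul_gaussian {N : ℕ} {s : ℝ} (hs : 0 < s) (x y : Space N) :
    ∫⁻ z, ENNReal.ofReal (Real.exp (-2 * s * ‖x - z‖ ^ 2) * Real.exp (-2 * s * ‖y - z‖ ^ 2)) =
      ENNReal.ofReal (Real.exp (-(‖x - y‖ ^ 2 * s)) * (Real.pi / (4 * s)) ^ ((N : ℝ) / 2)) := by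
  have hG := GaussianFourier.integral_rexp_neg_mul_sq_norm (V := Space N) (b := 4 * s)
    (by positivity)
  rw [finrank_euclideanSpace, Fintype.card_fin] at hG
  have hpos : 0 < (Real.pi / (4 * s)) ^ ((N : ℝ) / 2) := by positivity
  have hint : Integrable fun z : Space N => Real.exp (-(4 * s) * ‖z‖ ^ 2) :=
    not_imp_comm.1 integral_undef (by rw [hG]; exact hpos.ne')
  set m : Space N := (2⁻¹ : ℝ) • (x + y) with hm
  have hpt : ∀ z, Real.exp (-2 * s * ‖x - z‖ ^ 2) * Real.exp (-2 * s * ‖y - z‖ ^ 2) =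
      Real.exp (-(‖x - y‖ ^ 2 * s)) * Real.exp (-(4 * s) * ‖z - m‖ ^ 2) := by
    intro z
    rw [← Real.exp_add, ← Real.exp_add]
    congr 1
    have h1 := parallelogram_law_with_norm ℝ (x - z) (y - z)
    have h2 : x - z + (y - z) = (-2 : ℝ) • (z - m) := by rw [hm]; module
    rw [h2, norm_smul, sub_sub_sub_cancel_right] at h1
    norm_num at h1
    nlinarith
  simp_rw [hpt]
  rw [← ofReal_integral_eq_lintegral_ofReal ((hint.comp_sub_right m).const_mul _)
    (Filter.Eventually.of_forall fun z => by positivity), integral_const_mul,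
    integral_sub_right_eq_self (fun z : Space N => Real.exp (-(4 * s) * ‖z‖ ^ 2)), hG]

/-- The kernel `|x - y| ^ (-lam)` is a superposition of products of Gaussians. -/
lemma powKer_eq_lintegral_gaussian {N : ℕ} {lam : ℝ} (h0 : 0 < lam) {x y : Space N}
    (hxy : x ≠ y) :
    powKer lam (x - y) = ∫⁻ w : ℝ × Space N,
      ENNReal.ofReal (√(w.1 ^ (lam / 2 - 1) / (Real.Gamma (lam / 2) *
        (Real.pi / (4 * w.1)) ^ ((N : ℝ) / 2))) * Real.exp (-2 * w.1 * ‖x - w.2‖ ^ 2)) *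
      ENNReal.ofReal (√(w.1 ^ (lam / 2 - 1) / (Real.Gamma (lam / 2) *
        (Real.pi / (4 * w.1)) ^ ((N : ℝ) / 2))) * Real.exp (-2 * w.1 * ‖y - w.2‖ ^ 2))
      ∂((volume.restrict (Set.Ioi 0)).prod volume) := by
  rw [lintegral_prod _ (Measurable.aemeasurable (by fun_prop))]
  have hΓ : 0 < Real.Gamma (lam / 2) := Real.Gamma_pos_of_pos (by positivity)
  have hr : 0 < ‖x - y‖ := norm_pos_iff.2 (sub_ne_zero.2 hxy)
  -- The weight under the square root cancels the Gaussian normalisation, leaving the integrand of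
  -- r^(-lam/2) Γ(lam/2) = ∫ s^(lam/2-1) e^(-rs) ds with r = |x-y|².
  have hin : ∀ s ∈ Set.Ioi (0 : ℝ), (∫⁻ z : Space N,
      ENNReal.ofReal (√(s ^ (lam / 2 - 1) / (Real.Gamma (lam / 2) *
        (Real.pi / (4 * s)) ^ ((N : ℝ) / 2))) * Real.exp (-2 * s * ‖x - z‖ ^ 2)) *
      ENNReal.ofReal (√(s ^ (lam / 2 - 1) / (Real.Gamma (lam / 2) *
        (Real.pi / (4 * s)) ^ ((N : ℝ) / 2))) * Real.exp (-2 * s * ‖y - z‖ ^ 2))) =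
      ENNReal.ofReal ((Real.Gamma (lam / 2))⁻¹ *
        (s ^ (lam / 2 - 1) * Real.exp (-(‖x - y‖ ^ 2 * s)))) := by
    intro s hs
    have hs : 0 < s := hs
    set c : ℝ := s ^ (lam / 2 - 1) / (Real.Gamma (lam / 2) *
        (Real.pi / (4 * s)) ^ ((N : ℝ) / 2)) with hc
    have hc0 : 0 ≤ c := by positivity
    have : ∀ z : Space N, ENNReal.ofReal (√c * Real.exp (-2 * s * ‖x - z‖ ^ 2)) *
        ENNReal.ofReal (√c * Real.exp (-2 * s * ‖y - z‖ ^ 2)) = ENNReal.ofReal c *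
        ENNReal.ofReal (Real.exp (-2 * s * ‖x - z‖ ^ 2) * Real.exp (-2 * s * ‖y - z‖ ^ 2)) := by
      intro z
      rw [← ENNReal.ofReal_mul (by positivity), ← ENNReal.ofReal_mul hc0]
      congr 1
      nth_rewrite 3 [← Real.mul_self_sqrt hc0]
      ring
    simp_rw [this]
    rw [lintegral_const_mul _ (by fun_prop), lintegral_gaussian_mul_gaussian hs,
      ← ENNReal.ofReal_mul hc0, hc]
    congr 1
    field_simp
  rw [setLIntegral_congr_fun measurableSet_Ioi hin]
  have hI := Real.integral_rpow_mul_exp_neg_mul_Ioi (a := lam / 2) (r := ‖x - y‖ ^ 2)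
    (by positivity) (by positivity)
  have hint : IntegrableOn (fun s : ℝ => s ^ (lam / 2 - 1) * Real.exp (-(‖x - y‖ ^ 2 * s)))
      (Set.Ioi 0) := not_imp_comm.1 integral_undef (by rw [hI]; positivity)
  rw [← ofReal_integral_eq_lintegral_ofReal (hint.const_mul _), integral_const_mul, hI, powKer]
  · congr 1
    rw [mul_comm, mul_assoc, mul_inv_cancel₀ hΓ.ne', mul_one, one_div, Real.inv_rpow (by positivity),
      ← Real.rpow_natCast, ← Real.rpow_mul hr.le, Real.rpow_neg hr.le]
    congr 2
    push_cast; ring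
  · refine (ae_restrict_iff' measurableSet_Ioi).2 (Filter.Eventually.of_forall fun s hs => ?_)
    have : (0 : ℝ) < s := hs
    positivity

/-- Cauchy–Schwarz holds because the kernel is a superposition of products of Gaussians. That
representation is only claimed for y ≠ x, which is enough since points are null sets when N ≥ 1. -/
theorem rieszForm_sq_le {N : ℕ} (hN : 1 ≤ N) {lam : ℝ} (h0 : 0 < lam) {f g : Space N → ℝ≥0∞}
    (hf : Measurable f) (hg : Measurable g) :
    rieszForm lam f g ^ 2 ≤ rieszForm lam f f * rieszForm lam g g := by
  have : NeZero N := ⟨by omega⟩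
  refine sq_lintegral_kernel_le (ν := (volume.restrict (Set.Ioi 0)).prod volume)
    (k := fun x y => powKer lam (x - y)) (h := fun w x => ENNReal.ofReal (√(w.1 ^ (lam / 2 - 1) /
      (Real.Gamma (lam / 2) * (Real.pi / (4 * w.1)) ^ ((N : ℝ) / 2))) *
      Real.exp (-2 * w.1 * ‖x - w.2‖ ^ 2))) ?_ (fun x => ?_) hf hg
  · unfold Function.uncurry; fun_prop
  · have hx : ∀ᵐ y : Space N, y ≠ x := by
      simp [ae_iff]
    filter_upwards [hx] with y hy
    exact powKer_eq_lintegral_gaussian h0 hy.symm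

/-! ### The Riesz form as a bounded bilinear form -/

/-- The exponent `2N / (2N - lam)` of the diagonal Hardy–Littlewood–Sobolev inequality. -/
noncomputable def hlsExp (N : ℕ) (lam : ℝ) : ℝ≥0∞ := ENNReal.ofReal (2 * N / (2 * N - lam))

/-- The diagonal inequality for f and for g, combined by Cauchy–Schwarz for the form. -/
lemma rieszForm_enorm_le {N : ℕ} (hN : 1 ≤ N) {lam : ℝ} (h0 : 0 < lam) (hlam : lam < N) :
    ∃ C : ℝ, 0 ≤ C ∧ ∀ f g : Space N → ℝ, Measurable f → Measurable g →
      rieszForm lam (fun x => ‖f x‖ₑ) (fun x => ‖g x‖ₑ) ≤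
        ENNReal.ofReal C * (eLpNorm f (hlsExp N lam) volume * eLpNorm g (hlsExp N lam) volume) := by
  obtain ⟨C, hC, H⟩ := rieszForm_self_le hN h0 hlam
  have hN0 : (0 : ℝ) < N := by exact_mod_cast hN
  have hlam2 : 0 < 2 * N - lam := by linarith
  have hr : (hlsExp N lam).toReal = 2 * N / (2 * N - lam) :=
    ENNReal.toReal_ofReal (by positivity)
  have key : ∀ f : Space N → ℝ, Measurable f → rieszForm lam (fun x => ‖f x‖ₑ) (fun x => ‖f x‖ₑ) ≤
      ENNReal.ofReal C * eLpNorm f (hlsExp N lam) volume ^ 2 := by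
    intro f hf
    refine (H _ hf.enorm).trans (le_of_eq ?_)
    have hne : hlsExp N lam ≠ 0 := by
      simp only [hlsExp, ne_eq, ENNReal.ofReal_eq_zero, not_le]; positivity
    rw [eLpNorm_eq_lintegral_rpow_enorm_toReal hne (by simp [hlsExp]), hr, ← ENNReal.rpow_natCast,
      ← ENNReal.rpow_mul]
    congr 2
    field_simp
    push_cast; ring
  refine ⟨C, hC, fun f g hf hg => ?_⟩
  have h := rieszForm_sq_le hN h0 hf.enorm hg.enorm
  refine (ENNReal.pow_le_pow_left_iff two_ne_zero).1 (h.trans ?_)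
  calc _ ≤ _ := mul_le_mul' (key f hf) (key g hg)
    _ = _ := by ring

/-- The form `∬ |x - y| ^ (-lam) f(y) g(x) dy dx` on real functions. -/
noncomputable def rieszPair {N : ℕ} (lam : ℝ) (f g : Space N → ℝ) : ℝ :=
  ∫ z : Space N × Space N, ‖z.1 - z.2‖ ^ (-lam) * f z.2 * g z.1

lemma enorm_norm_rpow {N : ℕ} (lam : ℝ) (z : Space N) : ‖‖z‖ ^ (-lam)‖ₑ = powKer lam z :=
  Real.enorm_of_nonneg (by positivity)

lemma lintegral_enorm_rieszPair {N : ℕ} (lam : ℝ) {f g : Space N → ℝ} (hf : Measurable f)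
    (hg : Measurable g) :
    ∫⁻ z : Space N × Space N, ‖‖z.1 - z.2‖ ^ (-lam) * f z.2 * g z.1‖ₑ =
      rieszForm lam (fun x => ‖f x‖ₑ) (fun x => ‖g x‖ₑ) := by
  have hm : Measurable fun z : Space N × Space N => ‖‖z.1 - z.2‖ ^ (-lam) * f z.2 * g z.1‖ₑ := by
    fun_prop
  rw [Measure.volume_eq_prod, lintegral_prod _ hm.aemeasurable]
  simp_rw [enorm_mul, enorm_norm_rpow]
  rfl

lemma integrable_rieszPair {N : ℕ} (hN : 1 ≤ N) {lam : ℝ} (h0 : 0 < lam) (hlam : lam < N)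
    {f g : Space N → ℝ} (hf : Measurable f) (hg : Measurable g)
    (hf' : MemLp f (hlsExp N lam)) (hg' : MemLp g (hlsExp N lam)) :
    Integrable fun z : Space N × Space N => ‖z.1 - z.2‖ ^ (-lam) * f z.2 * g z.1 := by
  obtain ⟨C, hC, H⟩ := rieszForm_enorm_le hN h0 hlam
  have hm : Measurable fun z : Space N × Space N => ‖z.1 - z.2‖ ^ (-lam) * f z.2 * g z.1 := by
    fun_prop
  refine ⟨hm.aestronglyMeasurable, ?_⟩
  rw [hasFiniteIntegral_iff_enorm, lintegral_enorm_rieszPair lam hf hg]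
  exact (H f g hf hg).trans_lt
    (ENNReal.mul_lt_top ENNReal.ofReal_lt_top (ENNReal.mul_lt_top hf'.2 hg'.2))

lemma rieszPair_congr {N : ℕ} (lam : ℝ) {f f' g g' : Space N → ℝ} (hf : f =ᵐ[volume] f')
    (hg : g =ᵐ[volume] g') : rieszPair lam f g = rieszPair lam f' g' := by
  refine integral_congr_ae ?_
  have h1 := (Measure.quasiMeasurePreserving_snd (μ := (volume : Measure (Space N)))
    (ν := (volume : Measure (Space N)))).ae_eq_comp hf
  have h2 := (Measure.quasiMeasurePreserving_fst (μ := (volume : Measure (Space N)))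
    (ν := (volume : Measure (Space N)))).ae_eq_comp hg
  filter_upwards [h1, h2] with z hz1 hz2
  simp only [Function.comp_apply] at hz1 hz2
  rw [hz1, hz2]

lemma rieszPair_nonneg {N : ℕ} (lam : ℝ) {f g : Space N → ℝ} (hf : 0 ≤ f) (hg : 0 ≤ g) :
    0 ≤ rieszPair lam f g :=
  integral_nonneg fun z => mul_nonneg (mul_nonneg (by positivity) (hf _)) (hg _)

lemma ofReal_rieszPair {N : ℕ} (hN : 1 ≤ N) {lam : ℝ} (h0 : 0 < lam) (hlam : lam < N)
    {f g : Space N → ℝ} (hf : Measurable f) (hg : Measurable g)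
    (hf' : MemLp f (hlsExp N lam)) (hg' : MemLp g (hlsExp N lam)) (hf0 : 0 ≤ f) (hg0 : 0 ≤ g) :
    ENNReal.ofReal (rieszPair lam f g) = rieszForm lam (fun x => ‖f x‖ₑ) (fun x => ‖g x‖ₑ) := by
  rw [rieszPair, ofReal_integral_eq_lintegral_ofReal
    (integrable_rieszPair hN h0 hlam hf hg hf' hg'), ← lintegral_enorm_rieszPair lam hf hg]
  · refine lintegral_congr fun z => (Real.enorm_of_nonneg ?_).symm
    exact mul_nonneg (mul_nonneg (by positivity) (hf0 _)) (hg0 _)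
  · exact Filter.Eventually.of_forall fun z =>
      mul_nonneg (mul_nonneg (by positivity) (hf0 _)) (hg0 _)

/-- The Cauchy–Schwarz inequality for the Riesz form. -/
lemma rieszPair_sq_le {N : ℕ} (hN : 1 ≤ N) {lam : ℝ} (h0 : 0 < lam) (hlam : lam < N)
    {f g : Space N → ℝ} (hf : Measurable f) (hg : Measurable g)
    (hf' : MemLp f (hlsExp N lam)) (hg' : MemLp g (hlsExp N lam)) (hf0 : 0 ≤ f) (hg0 : 0 ≤ g) :
    rieszPair lam f g ^ 2 ≤ rieszPair lam f f * rieszPair lam g g := by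
  have h := rieszForm_sq_le hN h0 hf.enorm hg.enorm
  rw [← ofReal_rieszPair hN h0 hlam hf hg hf' hg' hf0 hg0,
    ← ofReal_rieszPair hN h0 hlam hf hf hf' hf' hf0 hf0,
    ← ofReal_rieszPair hN h0 hlam hg hg hg' hg' hg0 hg0,
    ← ENNReal.ofReal_mul (rieszPair_nonneg lam hf0 hf0),
    ← ENNReal.ofReal_pow (rieszPair_nonneg lam hf0 hg0)] at h
  exact (ENNReal.ofReal_le_ofReal_iff
    (mul_nonneg (rieszPair_nonneg lam hf0 hf0) (rieszPair_nonneg lam hg0 hg0))).1 h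

lemma rieszPair_comm {N : ℕ} (lam : ℝ) (f g : Space N → ℝ) :
    rieszPair lam f g = rieszPair lam g f := by
  rw [rieszPair, Measure.volume_eq_prod,
    ← integral_prod_swap (fun z : Space N × Space N => ‖z.1 - z.2‖ ^ (-lam) * f z.2 * g z.1)]
  refine integral_congr_ae (Filter.Eventually.of_forall fun z => ?_)
  simp only [Prod.fst_swap, Prod.snd_swap]
  rw [norm_sub_rev]; ring

/-- If the form vanished, then for almost every x the function y ↦ |x-y|^(-lam) f(y) f(x) would
vanish almost everywhere. At one such x with f(x) ≠ 0, positivity of the kernel off the diagonal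
forces f = 0 almost everywhere. -/
lemma rieszPair_self_pos {N : ℕ} (hN : 1 ≤ N) {lam : ℝ} (h0 : 0 < lam) (hlam : lam < N)
    {f : Space N → ℝ} (hf : Measurable f) (hf' : MemLp f (hlsExp N lam)) (hf0 : 0 ≤ f)
    (hne : ¬ f =ᵐ[volume] 0) : 0 < rieszPair lam f f := by
  have : NeZero N := ⟨by omega⟩
  refine lt_of_le_of_ne (rieszPair_nonneg lam hf0 hf0) fun h => hne ?_
  have h1 := ofReal_rieszPair hN h0 hlam hf hf hf' hf' hf0 hf0
  rw [← h, ENNReal.ofReal_zero, eq_comm, rieszForm, lintegral_eq_zero_iff] at h1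
  swap
  · have hk := measurable_powKer (N := N) lam
    exact Measurable.lintegral_prod_right'
      (f := fun z : Space N × Space N => powKer lam (z.1 - z.2) * ‖f z.2‖ₑ * ‖f z.1‖ₑ)
      (((hk.comp (by fun_prop)).mul (by fun_prop)).mul (by fun_prop))
  by_contra hne'
  have h2 : ∃ᵐ x : Space N, f x ≠ 0 := fun h3 => hne' (by
    filter_upwards [h3] with x hx; simpa using hx)
  obtain ⟨x, hx, hx1⟩ := (h2.and_eventually h1).exists
  refine hne' ?_
  have hm : Measurable fun y : Space N => powKer lam (x - y) * ‖f y‖ₑ * ‖f x‖ₑ :=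
    (((measurable_powKer lam).comp (by fun_prop)).mul (by fun_prop)).mul (by fun_prop)
  rw [Pi.zero_apply, lintegral_eq_zero_iff hm] at hx1
  have hxy : ∀ᵐ y : Space N, y ≠ x := by simp [ae_iff]
  filter_upwards [hx1, hxy] with y hy hyx
  have hk : powKer lam (x - y) ≠ 0 := by
    have : 0 < ‖x - y‖ := norm_pos_iff.2 (sub_ne_zero.2 hyx.symm)
    simp only [powKer, ne_eq, ENNReal.ofReal_eq_zero, not_le]; positivity
  simpa [hk, hx] using hy

/-- The Riesz form is a bounded bilinear form on `L^(2N/(2N-lam))`. -/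
theorem exists_rieszPair_clm {N : ℕ} (hN : 1 ≤ N) {lam : ℝ} (h0 : 0 < lam) (hlam : lam < N)
    [Fact (1 ≤ hlsExp N lam)] :
    ∃ B : Lp ℝ (hlsExp N lam) (volume : Measure (Space N)) →L[ℝ]
      Lp ℝ (hlsExp N lam) (volume : Measure (Space N)) →L[ℝ] ℝ,
      ∀ f g, B f g = rieszPair lam f g := by
  obtain ⟨C, hC, H⟩ := rieszForm_enorm_le hN h0 hlam
  have hm : ∀ f : Lp ℝ (hlsExp N lam) (volume : Measure (Space N)), Measurable f :=
    fun f => (Lp.stronglyMeasurable f).measurable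
  have hint := fun f g : Lp ℝ (hlsExp N lam) (volume : Measure (Space N)) =>
    integrable_rieszPair hN h0 hlam (hm f) (hm g) (Lp.memLp f) (Lp.memLp g)
  let B₀ : Lp ℝ (hlsExp N lam) (volume : Measure (Space N)) →ₗ[ℝ]
      Lp ℝ (hlsExp N lam) (volume : Measure (Space N)) →ₗ[ℝ] ℝ :=
    LinearMap.mk₂ ℝ (fun f g => rieszPair lam f g)
      (fun f f' g => by
        rw [rieszPair_congr lam (Lp.coeFn_add f f') (Filter.EventuallyEq.refl _ _)]
        simp only [rieszPair]
        rw [← integral_add (hint f g) (hint f' g)]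
        congr 1; ext z; simp only [Pi.add_apply]; ring)
      (fun c f g => by
        rw [rieszPair_congr lam (Lp.coeFn_smul c f) (Filter.EventuallyEq.refl _ _)]
        simp only [rieszPair, smul_eq_mul]
        rw [← integral_const_mul]
        congr 1; ext z; simp only [Pi.smul_apply, smul_eq_mul]; ring)
      (fun f g g' => by
        rw [rieszPair_congr lam (Filter.EventuallyEq.refl _ _) (Lp.coeFn_add g g')]
        simp only [rieszPair]
        rw [← integral_add (hint f g) (hint f g')]
        congr 1; ext z; simp only [Pi.add_apply]; ring)
      (fun c f g => by
        rw [rieszPair_congr lam (Filter.EventuallyEq.refl _ _) (Lp.coeFn_smul c g)]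
        simp only [rieszPair, smul_eq_mul]
        rw [← integral_const_mul]
        congr 1; ext z; simp only [Pi.smul_apply, smul_eq_mul]; ring)
  refine ⟨B₀.mkContinuous₂ C fun f g => ?_, fun f g => rfl⟩
  change ‖rieszPair lam f g‖ ≤ _
  have h1 := H f g (hm f) (hm g)
  rw [← lintegral_enorm_rieszPair lam (hm f) (hm g)] at h1
  have h2 := (enorm_integral_le_lintegral_enorm _).trans h1
  rw [Lp.norm_def, Lp.norm_def, mul_assoc, ← ENNReal.toReal_mul, ← ENNReal.toReal_ofReal hC,
    ← ENNReal.toReal_mul, ← toReal_enorm]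
  refine ENNReal.toReal_mono ?_ h2
  exact ENNReal.mul_ne_top ENNReal.ofReal_ne_top
    (ENNReal.mul_ne_top (Lp.eLpNorm_ne_top f) (Lp.eLpNorm_ne_top g))

/-! ### Differentiability of the superposition operator |u|^p -/

lemma hasDerivAt_abs_rpow_mul_self {p : ℝ} (hp : 2 < p) (x : ℝ) :
    HasDerivAt (fun x : ℝ => |x| ^ (p - 2) * x) ((p - 1) * |x| ^ (p - 2)) x := by
  rcases eq_or_ne x 0 with rfl | hx
  · rw [abs_zero, Real.zero_rpow (by linarith), mul_zero, hasDerivAt_iff_tendsto_slope_zero]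
    have h : Filter.Tendsto (fun t : ℝ => |t| ^ (p - 2)) (nhds 0) (nhds (|(0 : ℝ)| ^ (p - 2))) :=
      (continuous_abs.rpow_const fun _ => Or.inr (by linarith)).tendsto 0
    rw [abs_zero, Real.zero_rpow (by linarith)] at h
    refine (h.mono_left nhdsWithin_le_nhds).congr' ?_
    filter_upwards [self_mem_nhdsWithin] with t ht
    have ht : t ≠ 0 := ht
    simp; field_simp
  · have h1 := ((hasDerivAt_abs hx).rpow_const (p := p - 2) (Or.inl (abs_ne_zero.2 hx))).mul
      (hasDerivAt_id x)
    refine h1.congr_deriv ?_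
    have hx' : 0 < |x| := abs_pos.2 hx
    have h2 : (SignType.sign x : ℝ) * x = |x| := sign_mul_self x
    rw [Real.rpow_sub_one hx'.ne']
    simp only [id, mul_one]
    field_simp
    linear_combination (p - 2) * h2

lemma abs_rpow_mul_self_sub_le {p : ℝ} (hp : 2 < p) {M x y : ℝ} (hx : |x| ≤ M) (hy : |y| ≤ M) :
    |(|y| ^ (p - 2) * y) - |x| ^ (p - 2) * x| ≤ (p - 1) * M ^ (p - 2) * |y - x| := by
  refine Convex.norm_image_sub_le_of_norm_hasDerivWithin_le (s := Set.Icc (-M) M)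
    (f := fun x : ℝ => |x| ^ (p - 2) * x) (f' := fun x => (p - 1) * |x| ^ (p - 2))
    (fun z _ => (hasDerivAt_abs_rpow_mul_self hp z).hasDerivWithinAt) (fun z hz => ?_)
    (convex_Icc _ _) (abs_le.1 hx) (abs_le.1 hy)
  have hz' : |z| ≤ M := abs_le.2 hz
  rw [Real.norm_of_nonneg (mul_nonneg (by linarith) (by positivity))]
  have := Real.rpow_le_rpow (abs_nonneg z) hz' (by linarith : 0 ≤ p - 2)
  exact mul_le_mul_of_nonneg_left this (by linarith)

/-- Mean value inequality for |x|^p minus its linear part at a: the derivative is Lipschitz on the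
ball of radius |h| about a, with constant governed by (|a|+|h|)^(p-2). Only p > 2 is used, so the
remainder is genuinely quadratic in h. -/
lemma abs_rpow_taylor {p : ℝ} (hp : 2 < p) (a h : ℝ) :
    |(|a + h| ^ p) - |a| ^ p - p * |a| ^ (p - 2) * a * h| ≤
      p * (p - 1) * (|a| + |h|) ^ (p - 2) * h ^ 2 := by
  set M := |a| + |h| with hM
  have key := Convex.norm_image_sub_le_of_norm_hasDerivWithin_le (s := Metric.closedBall a |h|)
    (f := fun x : ℝ => |x| ^ p - p * |a| ^ (p - 2) * a * x)
    (f' := fun x => p * |x| ^ (p - 2) * x - p * |a| ^ (p - 2) * a)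
    (C := p * ((p - 1) * M ^ (p - 2) * |h|)) (x := a) (y := a + h)
    (fun z _ => by
      have := (hasDerivAt_abs_rpow z (by linarith : 1 < p)).sub
        ((hasDerivAt_id z).const_mul (p * |a| ^ (p - 2) * a))
      rw [mul_one] at this
      exact this.hasDerivWithinAt) (fun z hz => ?_)
    (convex_closedBall _ _) (by simp) (by simp)
  · simp only [Real.norm_eq_abs] at key
    have e : |a + h| ^ p - |a| ^ p - p * |a| ^ (p - 2) * a * h =
      |a + h| ^ p - p * |a| ^ (p - 2) * a * (a + h) - (|a| ^ p - p * |a| ^ (p - 2) * a * a) := by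
      ring
    rw [e]
    refine key.trans (le_of_eq ?_)
    rw [add_sub_cancel_left, ← sq_abs h]; ring
  · rw [Metric.mem_closedBall, Real.dist_eq] at hz
    have hzM : |z| ≤ M := by
      have := abs_add_le a (z - a)
      rw [add_sub_cancel] at this
      linarith
    have haM : |a| ≤ M := by rw [hM]; linarith [abs_nonneg h]
    have := abs_rpow_mul_self_sub_le hp haM hzM
    have e : p * |z| ^ (p - 2) * z - p * |a| ^ (p - 2) * a =
      p * (|z| ^ (p - 2) * z - |a| ^ (p - 2) * a) := by ring
    rw [e, norm_mul, Real.norm_of_nonneg (by linarith), Real.norm_eq_abs]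
    gcongr
    refine this.trans ?_
    have : 0 ≤ (p - 1) * M ^ (p - 2) := mul_nonneg (by linarith) (by positivity)
    gcongr

section Nemytskii

variable {X : Type*} [MeasurableSpace X] {μ : Measure X}

lemma eLpNorm_abs_rpow (f : X → ℝ) (r : ℝ≥0∞) {p : ℝ} (hp : 0 < p) :
    eLpNorm (fun x => |f x| ^ p) r μ = eLpNorm f (r * ENNReal.ofReal p) μ ^ p :=
  eLpNorm_norm_rpow f hp

lemma memLp_abs_rpow {f : X → ℝ} {r : ℝ≥0∞} {p : ℝ} (hp : 0 < p)
    (hf : MemLp f (r * ENNReal.ofReal p) μ) : MemLp (fun x => |f x| ^ p) r μ := by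
  refine ⟨(hf.1.norm.aemeasurable.pow_const p).aestronglyMeasurable, ?_⟩
  rw [eLpNorm_abs_rpow f r hp]
  exact ENNReal.rpow_lt_top_of_nonneg hp.le hf.2.ne

/-- The superposition operator `u ↦ |u| ^ p`. -/
noncomputable def absPow (r : ℝ≥0∞) {p : ℝ} (hp : 0 < p) (u : Lp ℝ (r * ENNReal.ofReal p) μ) :
    Lp ℝ r μ := (memLp_abs_rpow hp (Lp.memLp u)).toLp _

lemma coeFn_absPow (r : ℝ≥0∞) {p : ℝ} (hp : 0 < p) (u : Lp ℝ (r * ENNReal.ofReal p) μ) :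
    absPow r hp u =ᵐ[μ] fun x => |u x| ^ p := MemLp.coeFn_toLp _

lemma norm_absPow (r : ℝ≥0∞) {p : ℝ} (hp : 0 < p) (u : Lp ℝ (r * ENNReal.ofReal p) μ) :
    ‖absPow r hp u‖ = ‖u‖ ^ p := by
  rw [absPow, Lp.norm_toLp, eLpNorm_abs_rpow _ _ hp, Lp.norm_def, ENNReal.toReal_rpow]

/-- Hölder exponents for the derivative: |u|^(p-1) lies in L^(rp/(p-1)), the increment h in L^(rp),
their product in L^r. -/
lemma holderTriple_rpow {r : ℝ≥0∞} (hr0 : r ≠ 0) (hr : r ≠ ⊤) {p : ℝ} (hp : 1 < p) :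
    ENNReal.HolderTriple (r * ENNReal.ofReal (p / (p - 1))) (r * ENNReal.ofReal p) r := by
  constructor
  have h0 : 0 < p := by linarith
  have h1 : 0 < p / (p - 1) := div_pos h0 (by linarith)
  rw [ENNReal.mul_inv (Or.inl hr0) (Or.inl hr), ENNReal.mul_inv (Or.inl hr0) (Or.inl hr), ← mul_add,
    ← ENNReal.ofReal_inv_of_pos h1, ← ENNReal.ofReal_inv_of_pos h0,
    ← ENNReal.ofReal_add (by positivity) (by positivity)]
  have : (p / (p - 1))⁻¹ + p⁻¹ = 1 := by
    have : p - 1 ≠ 0 := by linarith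
    field_simp; ring
  rw [this, ENNReal.ofReal_one, mul_one]

/-- The superposition operator `u ↦ |u| ^ p` is differentiable. -/
theorem exists_hasFDerivAt_absPow (r : ℝ≥0∞) [Fact (1 ≤ r)] (hr : r ≠ ⊤) {p : ℝ} (hp : 2 < p)
    [Fact (1 ≤ r * ENNReal.ofReal p)] (u : Lp ℝ (r * ENNReal.ofReal p) μ) :
    ∃ L : Lp ℝ (r * ENNReal.ofReal p) μ →L[ℝ] Lp ℝ r μ,
      (∀ h, L h =ᵐ[μ] fun x => p * |u x| ^ (p - 2) * u x * h x) ∧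
      HasFDerivAt (absPow r (by linarith : 0 < p)) L u := by
  have hp0 : 0 < p := by linarith
  have hr1 : 1 ≤ r := Fact.out
  have hr0 : r ≠ 0 := (zero_lt_one.trans_le hr1).ne'
  have := holderTriple_rpow hr0 hr (by linarith : 1 < p)
  have hexp : r * ENNReal.ofReal (p / (p - 1)) * ENNReal.ofReal (p - 1) =
      r * ENNReal.ofReal p := by
    rw [mul_assoc, ← ENNReal.ofReal_mul (by apply div_nonneg <;> linarith)]
    congr 2
    have : p - 1 ≠ 0 := by linarith
    field_simp
  have : Fact (1 ≤ r * ENNReal.ofReal (p / (p - 1))) := ⟨by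
    refine hr1.trans (le_mul_of_one_le_right zero_le ?_)
    rw [ENNReal.one_le_ofReal, le_div_iff₀ (by linarith)]; linarith⟩
  have hmem : MemLp (fun x => p * |u x| ^ (p - 2) * u x) (r * ENNReal.ofReal (p / (p - 1))) μ := by
    have h1 : MemLp (fun x => |u x| ^ (p - 1)) (r * ENNReal.ofReal (p / (p - 1))) μ :=
      memLp_abs_rpow (by linarith) (by rw [hexp]; exact Lp.memLp u)
    refine h1.of_le_mul (c := p) ?_ (Filter.Eventually.of_forall fun x => ?_)
    · have := (Lp.stronglyMeasurable u).measurable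
      exact (by fun_prop : Measurable fun x => p * |u x| ^ (p - 2) * u x).aestronglyMeasurable
    · have e1 : (0 : ℝ) ≤ |u x| ^ (p - 2) := by positivity
      have e2 : (0 : ℝ) ≤ |u x| ^ (p - 1) := by positivity
      rw [norm_mul, norm_mul, Real.norm_of_nonneg hp0.le, Real.norm_of_nonneg e1,
        Real.norm_of_nonneg e2, Real.norm_eq_abs, mul_assoc]
      gcongr
      rcases (abs_nonneg (u x)).eq_or_lt with h | h
      · rw [← h, mul_zero]; positivity
      · rw [← Real.rpow_add_one h.ne']
        apply le_of_eq; congr 1; ring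
  let L : Lp ℝ (r * ENNReal.ofReal p) μ →L[ℝ] Lp ℝ r μ :=
    (ContinuousLinearMap.mul ℝ ℝ).holderL μ (r * ENNReal.ofReal (p / (p - 1)))
      (r * ENNReal.ofReal p) r (hmem.toLp _)
  have hL : ∀ h, L h =ᵐ[μ] fun x => p * |u x| ^ (p - 2) * u x * h x := by
    intro h
    have := (ContinuousLinearMap.mul ℝ ℝ).coeFn_holder (r := r) (hmem.toLp _) h
    filter_upwards [this, hmem.coeFn_toLp] with x h1 h2
    change (ContinuousLinearMap.mul ℝ ℝ).holder r (hmem.toLp _) h x = _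
    rw [h1, h2]; rfl
  refine ⟨L, hL, ?_⟩
  have bound : ∀ h : Lp ℝ (r * ENNReal.ofReal p) μ, ‖h‖ ≤ 1 →
      ‖absPow r hp0 (u + h) - absPow r hp0 u - L h‖ ≤
        p * (p - 1) * (‖u‖ + 1) ^ p * ‖h‖ ^ 2 := by
    intro h hh
    rcases eq_or_ne h 0 with rfl | hne
    · simp
    have hη : 0 < ‖h‖ := norm_pos_iff.2 hne
    -- The normalised function k = |u| + |h|/‖h‖ absorbs the remainder: for ‖h‖ ≤ 1, (|u|+|h|)^(p-2)
    -- h² ≤ ‖h‖² k^p pointwise, and ‖k‖ ≤ ‖u‖ + 1.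
    set k : Lp ℝ (r * ENNReal.ofReal p) μ := |u| + |‖h‖⁻¹ • h| with hk
    have hkn : ‖k‖ ≤ ‖u‖ + 1 := by
      refine (norm_add_le _ _).trans ?_
      rw [norm_abs_eq_norm, norm_abs_eq_norm, norm_smul, norm_inv, norm_norm,
        inv_mul_cancel₀ hη.ne']
    have hp1 : 0 ≤ p * (p - 1) := mul_nonneg hp0.le (by linarith)
    have pt : ∀ᵐ x ∂μ, ‖(absPow r hp0 (u + h) - absPow r hp0 u - L h) x‖ ≤
        (p * (p - 1) * ‖h‖ ^ 2) * ‖absPow r hp0 k x‖ := by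
      filter_upwards [Lp.coeFn_sub (absPow r hp0 (u + h) - absPow r hp0 u) (L h),
        Lp.coeFn_sub (absPow r hp0 (u + h)) (absPow r hp0 u), hL h, coeFn_absPow r hp0 (u + h),
        coeFn_absPow r hp0 u, coeFn_absPow r hp0 k, Lp.coeFn_add u h,
        Lp.coeFn_add |u| |‖h‖⁻¹ • h|, Lp.coeFn_abs u, Lp.coeFn_abs (‖h‖⁻¹ • h),
        Lp.coeFn_smul ‖h‖⁻¹ h] with x h1 h2 h3 h4 h5 h6 h7 h8 h9 h10 h11
      rw [h1, Pi.sub_apply, h2, Pi.sub_apply, h3, h4, h5, h6, h7, hk, h8, Pi.add_apply, Pi.add_apply,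
        h9, h10, h11, Pi.smul_apply, smul_eq_mul, Real.norm_eq_abs]
      refine (abs_rpow_taylor hp (u x) (h x)).trans ?_
      set a := |u x|
      rw [Real.norm_of_nonneg (by positivity), abs_of_nonneg (by positivity : 0 ≤ a + _), abs_mul,
        abs_of_nonneg (by positivity : 0 ≤ ‖h‖⁻¹), ← sq_abs (h x)]
      set b := ‖h‖⁻¹ * |h x| with hb
      have hb0 : 0 ≤ b := by positivity
      have ha0 : 0 ≤ a := abs_nonneg _
      have hx : |h x| = ‖h‖ * b := by rw [hb]; field_simp
      have hxb : |h x| ≤ b := by rw [hx]; exact mul_le_of_le_one_left hb0 hh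
      rw [mul_assoc (p * (p - 1)), mul_assoc (p * (p - 1))]
      refine mul_le_mul_of_nonneg_left ?_ hp1
      rw [hx, mul_pow, mul_left_comm]
      refine mul_le_mul_of_nonneg_left ?_ (by positivity)
      rw [← hx]
      calc (a + |h x|) ^ (p - 2) * b ^ 2 ≤ (a + b) ^ (p - 2) * (a + b) ^ (2 : ℝ) := by
            rw [Real.rpow_two]
            gcongr
            · linarith
        _ = (a + b) ^ p := by
            rw [← Real.rpow_add' (by positivity) (by linarith)]; congr 1; ring
    have h2 := Lp.norm_le_mul_norm_of_ae_le_mul pt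
    refine h2.trans ?_
    rw [norm_absPow]
    calc p * (p - 1) * ‖h‖ ^ 2 * ‖k‖ ^ p ≤ p * (p - 1) * ‖h‖ ^ 2 * (‖u‖ + 1) ^ p := by gcongr
      _ = _ := by ring
  rw [hasFDerivAt_iff_isLittleO_nhds_zero]
  have h1 : (fun h => absPow r hp0 (u + h) - absPow r hp0 u - L h) =O[nhds 0]
      fun h => ‖h‖ ^ 2 := by
    refine Asymptotics.IsBigO.of_bound (p * (p - 1) * (‖u‖ + 1) ^ p) ?_
    filter_upwards [Metric.closedBall_mem_nhds (0 : Lp ℝ (r * ENNReal.ofReal p) μ) zero_lt_one]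
      with h hh
    rw [norm_pow, norm_norm]
    exact bound h (by simpa using hh)
  exact h1.trans_isLittleO (Asymptotics.isLittleO_norm_pow_id one_lt_two)

end Nemytskii

/-! ### Strong L² convergence from almost everywhere convergence -/

section Scheffe

variable {X F : Type*} [MeasurableSpace X] {μ : Measure X} [NormedAddCommGroup F]

lemma eLpNorm_two_sq (f : X → F) : eLpNorm f 2 μ ^ 2 = ∫⁻ x, ‖f x‖ₑ ^ 2 ∂μ := by
  rw [eLpNorm_eq_lintegral_rpow_enorm_toReal (by norm_num) (by norm_num), ← ENNReal.rpow_natCast,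
    ← ENNReal.rpow_mul]
  simp

lemma memLp_two_iff {f : X → F} (hf : AEStronglyMeasurable f μ) :
    MemLp f 2 μ ↔ ∫⁻ x, ‖f x‖ₑ ^ 2 ∂μ < ⊤ := by
  rw [← eLpNorm_two_sq, ENNReal.pow_lt_top_iff]
  simp [MemLp, hf]

/-- Almost everywhere convergence without gain of mass is strong convergence in `L²`. -/
lemma tendsto_lintegral_sq_sub {f : ℕ → X → F} {g : X → F}
    (hf : ∀ n, StronglyMeasurable (f n)) (hg : StronglyMeasurable g)
    (hle : ∀ n, ∫⁻ x, ‖f n x‖ₑ ^ 2 ∂μ ≤ ∫⁻ x, ‖g x‖ₑ ^ 2 ∂μ)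
    (hfin : ∫⁻ x, ‖g x‖ₑ ^ 2 ∂μ ≠ ⊤)
    (hae : ∀ᵐ x ∂μ, Filter.Tendsto (fun n => f n x) Filter.atTop (nhds (g x))) :
    Filter.Tendsto (fun n => ∫⁻ x, ‖f n x - g x‖ₑ ^ 2 ∂μ) Filter.atTop (nhds 0) := by
  set M := ∫⁻ x, ‖g x‖ₑ ^ 2 ∂μ with hM
  have hgm : Measurable fun x => ‖g x‖ₑ := hg.enorm
  have hfm : ∀ n, Measurable fun x => ‖f n x‖ₑ := fun n => (hf n).enorm
  have hfgm : ∀ n, Measurable fun x => ‖f n x - g x‖ₑ := fun n => ((hf n).sub hg).enorm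
  -- Fatou's lemma is applied to this nonnegative function, whose limit is 4|g|². Since the integral
  -- of h n plus that of |f n - g|² is at most 4M, the latter must tend to 0.
  obtain ⟨h, hh⟩ : ∃ h : ℕ → X → ℝ≥0∞, h = fun n x =>
    2 * ‖f n x‖ₑ ^ 2 + 2 * ‖g x‖ₑ ^ 2 - ‖f n x - g x‖ₑ ^ 2 := ⟨_, rfl⟩
  have hhm : ∀ n, Measurable (h n) := fun n => by
    rw [hh]
    exact (((hfm n).pow_const 2).const_mul 2 |>.add ((hgm.pow_const 2).const_mul 2)).sub
      ((hfgm n).pow_const 2)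
  have hlim : ∀ᵐ x ∂μ, Filter.liminf (fun n => h n x) Filter.atTop = 4 * ‖g x‖ₑ ^ 2 := by
    filter_upwards [hae] with x hx
    refine Filter.Tendsto.liminf_eq ?_
    have h1 : Filter.Tendsto (fun n => ‖f n x‖ₑ ^ 2) Filter.atTop (nhds (‖g x‖ₑ ^ 2)) :=
      ENNReal.Tendsto.pow hx.enorm
    have h2 : Filter.Tendsto (fun n => ‖f n x - g x‖ₑ ^ 2) Filter.atTop (nhds 0) := by
      have := (hx.sub_const (g x)).enorm
      rw [sub_self, enorm_zero] at this
      simpa using ENNReal.Tendsto.pow (n := 2) this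
    have h3 := ENNReal.Tendsto.sub (((ENNReal.Tendsto.const_mul h1 (Or.inr (by simp :
      (2 : ℝ≥0∞) ≠ ⊤))).add_const (2 * ‖g x‖ₑ ^ 2))) h2 (Or.inr (by simp))
    rw [hh]
    convert h3 using 2
    rw [tsub_zero]; ring
  have hfat : 4 * M ≤ Filter.liminf (fun n => ∫⁻ x, h n x ∂μ) Filter.atTop := by
    refine le_trans (le_of_eq ?_) (lintegral_liminf_le hhm)
    rw [lintegral_congr_ae hlim, lintegral_const_mul _ (hgm.pow_const 2)]
  have hpt : ∀ n x, ‖f n x - g x‖ₑ ^ 2 ≤ 2 * ‖f n x‖ₑ ^ 2 + 2 * ‖g x‖ₑ ^ 2 := fun n x => by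
    have h1 : ‖f n x - g x‖ ^ 2 ≤ 2 * ‖f n x‖ ^ 2 + 2 * ‖g x‖ ^ 2 := by
      have := norm_sub_le (f n x) (g x)
      have := norm_nonneg (f n x - g x)
      nlinarith [sq_nonneg (‖f n x‖ - ‖g x‖)]
    have h2 := ENNReal.ofReal_le_ofReal h1
    rwa [ENNReal.ofReal_add (by positivity) (by positivity), ENNReal.ofReal_mul (by norm_num),
      ENNReal.ofReal_mul (by norm_num), ENNReal.ofReal_pow (by positivity),
      ENNReal.ofReal_pow (by positivity), ENNReal.ofReal_pow (by positivity), ofReal_norm,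
      ofReal_norm, ofReal_norm, ENNReal.ofReal_ofNat] at h2
  have hsum : ∀ n, (∫⁻ x, h n x ∂μ) + ∫⁻ x, ‖f n x - g x‖ₑ ^ 2 ∂μ ≤ 4 * M := fun n => by
    rw [← lintegral_add_left (hhm n)]
    calc _ = ∫⁻ x, (2 * ‖f n x‖ₑ ^ 2 + 2 * ‖g x‖ₑ ^ 2) ∂μ := by
          refine lintegral_congr fun x => ?_
          rw [hh]
          exact tsub_add_cancel_of_le (hpt n x)
      _ = 2 * (∫⁻ x, ‖f n x‖ₑ ^ 2 ∂μ) + 2 * M := by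
          rw [lintegral_add_left (((hfm n).pow_const 2).const_mul 2),
            lintegral_const_mul _ ((hfm n).pow_const 2), lintegral_const_mul _ (hgm.pow_const 2)]
      _ ≤ 2 * M + 2 * M := by gcongr; exact hle n
      _ = 4 * M := by ring
  have h4M : 4 * M ≠ ⊤ := ENNReal.mul_ne_top (by simp) hfin
  rw [ENNReal.tendsto_nhds_zero]
  intro ε hε
  rcases eq_or_ne (4 * M) 0 with h0 | h0
  · refine Filter.Eventually.of_forall fun n => ?_
    have := hsum n
    rw [h0, nonpos_iff_eq_zero, add_eq_zero] at this
    rw [this.2]; exact zero_le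
  have hlt : 4 * M - ε < Filter.liminf (fun n => ∫⁻ x, h n x ∂μ) Filter.atTop :=
    (ENNReal.sub_lt_self h4M h0 hε.ne').trans_le hfat
  filter_upwards [Filter.eventually_lt_of_lt_liminf hlt] with n hn
  have hn' : ∫⁻ x, h n x ∂μ ≠ ⊤ :=
    ne_top_of_le_ne_top h4M (le_self_add.trans (hsum n))
  have h5 : (∫⁻ x, h n x ∂μ) + ∫⁻ x, ‖f n x - g x‖ₑ ^ 2 ∂μ ≤ (∫⁻ x, h n x ∂μ) + ε :=
    (hsum n).trans (tsub_le_iff_right.1 hn.le)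
  exact (ENNReal.add_le_add_iff_left hn').1 h5

end Scheffe

/-! ### Mollification -/

section Mollify

variable {N : ℕ} {F : Type*} [NormedAddCommGroup F] [NormedSpace ℝ F]

/-- A sequence of smooth bumps concentrating at the origin. -/
noncomputable def stdBump (N n : ℕ) : ContDiffBump (0 : Space N) :=
  ⟨1 / (n + 1), 2 / (n + 1), by positivity, by gcongr; norm_num⟩

/-- The mollification of `f` at scale `2 / (n + 1)`. -/
noncomputable def mollify (n : ℕ) (f : Space N → F) : Space N → F :=
  convolution ((stdBump N n).normed volume) f (ContinuousLinearMap.lsmul ℝ ℝ) volume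

lemma mollify_apply (n : ℕ) (f : Space N → F) (x : Space N) :
    mollify n f x = ∫ t, (stdBump N n).normed volume t • f (x - t) := rfl

lemma mollify_apply_swap (n : ℕ) (f : Space N → F) (x : Space N) :
    mollify n f x = ∫ t, (stdBump N n).normed volume (x - t) • f t := by
  rw [mollify, convolution_eq_swap]; rfl

lemma contDiff_mollify [CompleteSpace F] (n : ℕ) {f : Space N → F} (hf : LocallyIntegrable f) :
    ContDiff ℝ ∞ (mollify n f) :=
  (stdBump N n).hasCompactSupport_normed.contDiff_convolution_left _
    (stdBump N n).contDiff_normed hf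

lemma ae_tendsto_mollify [CompleteSpace F] {f : Space N → F} (hf : LocallyIntegrable f) :
    ∀ᵐ x, Filter.Tendsto (fun n => mollify n f x) Filter.atTop (nhds (f x)) := by
  refine ContDiffBump.ae_convolution_tendsto_right_of_locallyIntegrable (K := 2) ?_ ?_ hf
  · have := tendsto_one_div_add_atTop_nhds_zero_nat (𝕜 := ℝ)
    have := this.const_mul 2
    rw [mul_zero] at this
    refine this.congr fun n => ?_
    simp only [stdBump]; ring
  · refine Filter.Eventually.of_forall fun n => le_of_eq ?_
    simp only [stdBump]; ring

/-- The mollifier is a probability density, so Jensen bounds the square of the average by the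
average of the square. Tonelli and translation invariance finish. -/
lemma lintegral_enorm_mollify_sq_le (n : ℕ) {f : Space N → F} (hf : StronglyMeasurable f) :
    ∫⁻ x, ‖mollify n f x‖ₑ ^ 2 ≤ ∫⁻ x, ‖f x‖ₑ ^ 2 := by
  set ρ : Space N → ℝ := (stdBump N n).normed volume with hρ
  have hρc : Continuous ρ := (stdBump N n).continuous_normed
  have hρ0 : ∀ x, 0 ≤ ρ x := (stdBump N n).nonneg_normed
  have hρm : Measurable fun t => ENNReal.ofReal (ρ t) := by fun_prop
  have hρ1 : ∫⁻ t, ENNReal.ofReal (ρ t) = 1 := by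
    rw [← ofReal_integral_eq_lintegral_ofReal (stdBump N n).integrable_normed
      (Filter.Eventually.of_forall hρ0), (stdBump N n).integral_normed, ENNReal.ofReal_one]
  have hfe : Measurable fun x => ‖f x‖ₑ := hf.enorm
  have hpt : ∀ x, ‖mollify n f x‖ₑ ^ 2 ≤ ∫⁻ t, ENNReal.ofReal (ρ t) * ‖f (x - t)‖ₑ ^ 2 := by
    intro x
    have hfx : Measurable fun t => ‖f (x - t)‖ₑ := hfe.comp (by fun_prop)
    have h1 : ‖mollify n f x‖ₑ ≤ ∫⁻ t, ENNReal.ofReal (ρ t) * ‖f (x - t)‖ₑ := by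
      rw [mollify_apply]
      refine (enorm_integral_le_lintegral_enorm _).trans (le_of_eq ?_)
      refine lintegral_congr fun t => ?_
      rw [enorm_smul, ← hρ, Real.enorm_of_nonneg (hρ0 t)]
    set ν := (volume : Measure (Space N)).withDensity fun t => ENNReal.ofReal (ρ t) with hν
    have : IsProbabilityMeasure ν := ⟨by
      rw [hν, withDensity_apply _ MeasurableSet.univ, Measure.restrict_univ, hρ1]⟩
    have h2 : ∀ g : Space N → ℝ≥0∞, Measurable g →
        ∫⁻ t, ENNReal.ofReal (ρ t) * g t = ∫⁻ t, g t ∂ν := fun g hg => by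
      rw [hν, lintegral_withDensity_eq_lintegral_mul _ hρm hg]; rfl
    rw [h2 _ hfx] at h1
    rw [h2 _ (hfx.pow_const 2)]
    have h3 := eLpNorm_le_eLpNorm_of_exponent_le (μ := ν) (f := fun t => f (x - t))
      (p := 1) (q := 2) (by norm_num)
      (hf.comp_measurable (by fun_prop : Measurable fun t => x - t)).aestronglyMeasurable
    rw [eLpNorm_one_eq_lintegral_enorm] at h3
    calc _ ≤ (∫⁻ t, ‖f (x - t)‖ₑ ∂ν) ^ 2 := by gcongr
      _ ≤ _ := by gcongr
      _ = _ := eLpNorm_two_sq _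
  calc _ ≤ ∫⁻ x, ∫⁻ t, ENNReal.ofReal (ρ t) * ‖f (x - t)‖ₑ ^ 2 := lintegral_mono hpt
    _ = ∫⁻ t, ∫⁻ x, ENNReal.ofReal (ρ t) * ‖f (x - t)‖ₑ ^ 2 := by
        refine lintegral_lintegral_swap (Measurable.aemeasurable ?_)
        have : Measurable fun z : Space N × Space N => ‖f (z.1 - z.2)‖ₑ :=
          hfe.comp (by fun_prop)
        exact (hρm.comp measurable_snd).mul (this.pow_const 2)
    _ = ∫⁻ t, ENNReal.ofReal (ρ t) * ∫⁻ x, ‖f x‖ₑ ^ 2 := by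
        refine lintegral_congr fun t => ?_
        rw [lintegral_const_mul, lintegral_sub_right_eq_self (fun x => ‖f x‖ₑ ^ 2)]
        have : Measurable fun x => ‖f (x - t)‖ₑ := hfe.comp (by fun_prop)
        exact this.pow_const 2
    _ = _ := by rw [lintegral_mul_const _ hρm, hρ1, one_mul]

/-- Mollifications converge almost everywhere and do not increase the L² norm, which is all that
`tendsto_lintegral_sq_sub` requires. -/
lemma tendsto_lintegral_mollify_sub [CompleteSpace F] {f : Space N → F}
    (hf : StronglyMeasurable f) (hf2 : MemLp f 2) :
    Filter.Tendsto (fun n => ∫⁻ x, ‖mollify n f x - f x‖ₑ ^ 2) Filter.atTop (nhds 0) := by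
  have hloc : LocallyIntegrable f := hf2.locallyIntegrable (by norm_num)
  refine tendsto_lintegral_sq_sub (fun n => ?_) hf (fun n => lintegral_enorm_mollify_sq_le n hf)
    ((memLp_two_iff hf.aestronglyMeasurable).1 hf2).ne (ae_tendsto_mollify hloc)
  exact (contDiff_mollify n hloc).continuous.stronglyMeasurable

/-- The derivative of the mollification of a weakly differentiable function. -/
lemma fderiv_mollify {u : Space N → ℝ} {g : Space N → Space N} (hug : IsWeakGradient u g)
    (hu : LocallyIntegrable u) (hg : LocallyIntegrable g) (n : ℕ) (x v : Space N) :
    fderiv ℝ (mollify n u) x v = inner ℝ (mollify n g x) v := by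
  set ρ : Space N → ℝ := (stdBump N n).normed volume with hρ
  have hρs : ContDiff ℝ ∞ ρ := (stdBump N n).contDiff_normed
  have hρc : HasCompactSupport ρ := (stdBump N n).hasCompactSupport_normed
  have hd := hρc.hasFDerivAt_convolution_left (ContinuousLinearMap.lsmul ℝ ℝ)
    (hρs.of_le (by simp)) hu x
  have h1 : fderiv ℝ (mollify n u) x v = ∫ t, fderiv ℝ ρ (x - t) v * u t := by
    rw [mollify, hd.fderiv, convolution_eq_swap, ContinuousLinearMap.integral_apply]
    · rfl
    · have := (hρc.fderiv ℝ).convolutionExists_left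
        ((ContinuousLinearMap.lsmul ℝ ℝ (E := ℝ)).precompL (Space N))
        (hρs.continuous_fderiv (by simp)) hu x
      exact this.integrable_swap
  have hφ : ContDiff ℝ ∞ fun t => ρ (x - t) := hρs.comp (contDiff_const.sub contDiff_id)
  have hφc : HasCompactSupport fun t => ρ (x - t) :=
    hρc.comp_homeomorph (Homeomorph.subLeft x)
  have h2 := hug _ hφ hφc v
  have h3 : ∀ t, fderiv ℝ (fun t => ρ (x - t)) t v = - fderiv ℝ ρ (x - t) v := fun t => by
    have h := ((hρs.differentiable (by simp) (x - t)).hasFDerivAt.comp t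
      ((hasFDerivAt_id t).const_sub x)).fderiv
    have h' : fderiv ℝ (fun t => ρ (x - t)) t = _ := h
    rw [h']
    simp
  have hint : Integrable fun t => ρ (x - t) • g t := by
    have := hρc.convolutionExists_left (ContinuousLinearMap.lsmul ℝ ℝ (E := Space N))
        hρs.continuous hg x
    exact this.integrable_swap
  have h4 : inner ℝ (mollify n g x) v = ∫ t, inner ℝ (g t) v * ρ (x - t) := by
    rw [mollify_apply_swap, real_inner_comm, ← integral_inner hint]
    refine integral_congr_ae (Filter.Eventually.of_forall fun t => ?_)
    simp only [inner_smul_right, real_inner_comm, mul_comm]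
  rw [h1, h4, ← neg_eq_iff_eq_neg.2 h2, ← integral_neg]
  refine integral_congr_ae (Filter.Eventually.of_forall fun t => ?_)
  simp only [h3]; ring

end Mollify

/-! ### Sobolev inequalities for compactly supported C¹ functions -/

section CompactlySupported

variable {N : ℕ}

lemma lintegral_enorm_fderiv_pow_le {w : Space N → ℝ} (hw : ContDiff ℝ 1 w) (m : ℕ) :
    ∫⁻ x, ‖fderiv ℝ (fun x => w x ^ (m + 1)) x‖ₑ ≤
      (m + 1) * ((∫⁻ x, ‖w x‖ₑ ^ (2 * m)) ^ (1 / 2 : ℝ) *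
        (∫⁻ x, ‖fderiv ℝ w x‖ₑ ^ 2) ^ (1 / 2 : ℝ)) := by
  have hwe : Measurable fun x => ‖w x‖ₑ := hw.continuous.measurable.enorm
  have hde : Measurable fun x => ‖fderiv ℝ w x‖ₑ :=
    (hw.continuous_fderiv one_ne_zero).measurable.enorm
  have hpt : ∀ x, ‖fderiv ℝ (fun x => w x ^ (m + 1)) x‖ₑ =
      (m + 1) * (‖w x‖ₑ ^ m * ‖fderiv ℝ w x‖ₑ) := fun x => by
    rw [fderiv_fun_pow (m + 1) (hw.differentiable one_ne_zero x), enorm_smul]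
    simp only [add_tsub_cancel_right, nsmul_eq_mul]
    rw [enorm_mul, enorm_pow, mul_assoc]
    congr 1
    rw [Real.enorm_of_nonneg (by positivity)]
    push_cast
    rw [ENNReal.ofReal_add (by positivity) (by positivity)]; simp
  simp_rw [hpt]
  rw [lintegral_const_mul _
    (show Measurable fun x => ‖w x‖ₑ ^ m * ‖fderiv ℝ w x‖ₑ from (hwe.pow_const m).mul hde)]
  gcongr
  refine (ENNReal.lintegral_mul_le_Lp_mul_Lq volume Real.HolderConjugate.two_two
    (hwe.pow_const m).aemeasurable hde.aemeasurable).trans (le_of_eq ?_)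
  simp [← pow_mul, mul_comm m 2]

/-- Bootstrapping: in the plane the L² norm of w^(m+2) is controlled by the L¹ norm of its gradient.
By Cauchy–Schwarz this is controlled by ∫ |w|^(2(m+1)), the previous step of the induction, and ∫
|∇w|². -/
lemma lintegral_even_pow_le_dim_two :
    ∀ (A : ℝ≥0∞), A ≠ ⊤ → ∀ m : ℕ, ∃ C : ℝ≥0∞, C ≠ ⊤ ∧ ∀ w : Space 2 → ℝ, ContDiff ℝ 1 w →
      HasCompactSupport w → ∫⁻ x, ‖w x‖ₑ ^ 2 ≤ A → ∫⁻ x, ‖fderiv ℝ w x‖ₑ ^ 2 ≤ A →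
      ∫⁻ x, ‖w x‖ₑ ^ (2 * (m + 1)) ≤ C := by
  intro A hA m
  induction m with
  | zero => exact ⟨A, hA, fun w _ _ h _ => by simpa using h⟩
  | succ m ih =>
    obtain ⟨C, hC, H⟩ := ih
    refine ⟨lintegralPowLePowLIntegralFDerivConst (volume : Measure (Space 2)) 2 *
      ((m + 2) * (C ^ (1 / 2 : ℝ) * A ^ (1 / 2 : ℝ))) ^ (2 : ℝ), ?_, fun w hw hwc h1 h2 => ?_⟩
    · finiteness
    · have hconj : Real.HolderConjugate (Module.finrank ℝ (Space 2)) 2 := by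
        rw [finrank_euclideanSpace]
        simpa using Real.HolderConjugate.two_two
      have h3 := lintegral_pow_le_pow_lintegral_fderiv (volume : Measure (Space 2))
        (u := fun x => w x ^ (m + 1 + 1)) (hw.pow _)
        (hwc.comp_left (g := fun t : ℝ => t ^ (m + 1 + 1)) (by simp)) hconj
      have h4 := lintegral_enorm_fderiv_pow_le hw (m + 1)
      have h5 := H w hw hwc h1 h2
      calc _ = ∫⁻ x, ‖w x ^ (m + 1 + 1)‖ₑ ^ (2 : ℝ) := by
            refine lintegral_congr fun x => ?_
            rw [enorm_pow, ENNReal.rpow_ofNat, ← pow_mul, mul_comm]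
        _ ≤ _ := h3
        _ ≤ _ := by
            gcongr
            refine h4.trans ?_
            push_cast
            rw [add_assoc, one_add_one_eq_two]
            gcongr

/-- The fundamental theorem of calculus for w², transported to the real line by a linear isometry.
-/
lemma enorm_sq_le_dim_one {w : Space 1 → ℝ} (hw : ContDiff ℝ 1 w) (hwc : HasCompactSupport w)
    (x : Space 1) : ‖w x‖ₑ ^ 2 ≤ ∫⁻ y, ‖fderiv ℝ (fun y => w y ^ 2) y‖ₑ := by
  let e : ℝ ≃ₗᵢ[ℝ] Space 1 :=
    ((stdOrthonormalBasis ℝ ℝ).reindex (finCongr (Module.finrank_self ℝ))).repr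
  have hw2 : ContDiff ℝ 1 fun y => w y ^ 2 := hw.pow 2
  have h := HasCompactSupport.enorm_le_lintegral_Ici_deriv (f := (fun y => w y ^ 2) ∘ e)
    (hw2.comp e.contDiff)
    ((hwc.comp_left (g := fun t : ℝ => t ^ 2) (by simp)).comp_homeomorph e.toHomeomorph)
    (e.symm x)
  simp only [Function.comp_apply, LinearIsometryEquiv.apply_symm_apply, enorm_pow] at h
  refine h.trans ?_
  calc _ ≤ ∫⁻ t, ‖deriv ((fun y => w y ^ 2) ∘ e) t‖ₑ := setLIntegral_le_lintegral _ _
    _ ≤ ∫⁻ t, ‖fderiv ℝ (fun y => w y ^ 2) (e t)‖ₑ := by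
        refine lintegral_mono fun t => ?_
        have h1 := ((hw2.differentiable one_ne_zero (e t)).hasFDerivAt.comp t
          e.toContinuousLinearEquiv.hasFDerivAt).hasDerivAt
        have h2 : deriv ((fun y => w y ^ 2) ∘ e) t =
          fderiv ℝ (fun y => w y ^ 2) (e t) (e 1) := h1.deriv
        rw [h2, ← ofReal_norm, ← ofReal_norm]
        refine ENNReal.ofReal_le_ofReal ((ContinuousLinearMap.le_opNorm _ _).trans ?_)
        simp
    _ = _ := (e.measurePreserving).lintegral_comp
        (hw2.continuous_fderiv one_ne_zero).measurable.enorm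

/-- The Gagliardo–Nirenberg–Sobolev inequality at the critical exponent 2N/(N-2). -/
lemma lintegral_rpow_le_dim_ge_three (hN : 3 ≤ N) (A : ℝ≥0∞) (hA : A ≠ ⊤) :
    ∃ C : ℝ≥0∞, C ≠ ⊤ ∧ ∀ w : Space N → ℝ, ContDiff ℝ 1 w →
      HasCompactSupport w → ∫⁻ x, ‖fderiv ℝ w x‖ₑ ^ 2 ≤ A →
      ∫⁻ x, ‖w x‖ₑ ^ (2 * N / (N - 2) : ℝ) ≤ C := by
  have hN' : (3 : ℝ) ≤ N := by exact_mod_cast hN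
  have hN2 : (0 : ℝ) < N - 2 := by linarith
  set s : ℝ := 2 * N / (N - 2) with hs
  have hs0 : 0 < s := by positivity
  refine ⟨(SNormLESNormFDerivOfEqConst ℝ (volume : Measure (Space N)) (2 : NNReal) *
    A ^ (1 / 2 : ℝ)) ^ s, by finiteness, fun w hw hwc h => ?_⟩
  have h1 := eLpNorm_le_eLpNorm_fderiv_of_eq (volume : Measure (Space N)) hw hwc
    (p := 2) (p' := s.toNNReal) (by norm_num) (by rw [finrank_euclideanSpace]; simp; omega) (by
      rw [finrank_euclideanSpace, Real.coe_toNNReal _ hs0.le, Fintype.card_fin, hs]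
      push_cast
      field_simp)
  have h2 : eLpNorm (fderiv ℝ w) 2 volume ≤ A ^ (1 / 2 : ℝ) := by
    rw [eLpNorm_eq_lintegral_rpow_enorm_toReal (by norm_num) (by norm_num)]
    simp only [ENNReal.toReal_ofNat, ENNReal.rpow_ofNat]
    gcongr
  have h3 : ∫⁻ x, ‖w x‖ₑ ^ s = eLpNorm w s.toNNReal volume ^ s := by
    have : ((s.toNNReal : ℝ≥0∞)).toReal = s := by simp [hs0.le]
    rw [eLpNorm_eq_lintegral_rpow_enorm_toReal (by simpa using hs0) (by simp), this,
      ← ENNReal.rpow_mul, one_div, inv_mul_cancel₀ hs0.ne', ENNReal.rpow_one]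
  rw [h3]
  gcongr
  exact h1.trans (by gcongr; exact h2)

lemma rpow_le_rpow_add_rpow (t : ℝ≥0∞) {a q b : ℝ} (h1 : a ≤ q) (h2 : q ≤ b) :
    t ^ q ≤ t ^ a + t ^ b := by
  rcases le_total t 1 with h | h
  · exact (ENNReal.rpow_le_rpow_of_exponent_ge h h1).trans le_self_add
  · exact (ENNReal.rpow_le_rpow_of_exponent_le h h2).trans le_add_self

/-- The Sobolev inequality for compactly supported functions, without explicit constant. -/
theorem exists_lintegral_rpow_le (hN : 1 ≤ N) {q : ℝ} (hq : 2 ≤ q) (hqN : ((N : ℝ) - 2) * q ≤ 2 * N)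
    (A : ℝ≥0∞) (hA : A ≠ ⊤) :
    ∃ C : ℝ≥0∞, C ≠ ⊤ ∧ ∀ w : Space N → ℝ, ContDiff ℝ 1 w → HasCompactSupport w →
      ∫⁻ x, ‖w x‖ₑ ^ 2 ≤ A → ∫⁻ x, ‖fderiv ℝ w x‖ₑ ^ 2 ≤ A → ∫⁻ x, ‖w x‖ₑ ^ q ≤ C := by
  have interp : ∀ b : ℝ, q ≤ b → ∀ w : Space N → ℝ, Continuous w →
      ∫⁻ x, ‖w x‖ₑ ^ q ≤ (∫⁻ x, ‖w x‖ₑ ^ 2) + ∫⁻ x, ‖w x‖ₑ ^ b := by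
    intro b hb w hw
    have hwe : Measurable fun x => ‖w x‖ₑ := hw.measurable.enorm
    rw [← lintegral_add_left (hwe.pow_const 2)]
    refine lintegral_mono fun x => ?_
    simpa using rpow_le_rpow_add_rpow ‖w x‖ₑ (a := 2) hq hb
  -- For N = 1 the function is bounded and |w|^q is split as |w|^(q-2) |w|². For N ≥ 2 the exponent
  -- q is interpolated between 2 and a larger one: an arbitrary even integer if N = 2, the critical
  -- exponent if N ≥ 3.
  rcases (by omega : N = 1 ∨ N = 2 ∨ 3 ≤ N) with rfl | rfl | hN3
  · refine ⟨((1 + 1) * (A ^ (1 / 2 : ℝ) * A ^ (1 / 2 : ℝ))) ^ ((q - 2) / 2) * A, ?_,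
      fun w hw hwc h1 h2 => ?_⟩
    · have : 0 ≤ (q - 2) / 2 := by linarith
      finiteness
    · have hwe : Measurable fun x => ‖w x‖ₑ := hw.continuous.measurable.enorm
      have h3 : ∀ x, ‖w x‖ₑ ^ 2 ≤ (1 + 1) * (A ^ (1 / 2 : ℝ) * A ^ (1 / 2 : ℝ)) := fun x => by
        refine (enorm_sq_le_dim_one hw hwc x).trans
          ((lintegral_enorm_fderiv_pow_le hw 1).trans ?_)
        push_cast
        gcongr
      calc _ ≤ ∫⁻ x, ((1 + 1) * (A ^ (1 / 2 : ℝ) * A ^ (1 / 2 : ℝ))) ^ ((q - 2) / 2) *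
            ‖w x‖ₑ ^ 2 := by
            refine lintegral_mono fun x => ?_
            have h4 : ‖w x‖ₑ ^ q = (‖w x‖ₑ ^ 2) ^ ((q - 2) / 2) * ‖w x‖ₑ ^ 2 := by
              rw [← ENNReal.rpow_natCast, ← ENNReal.rpow_mul,
                ← ENNReal.rpow_add_of_nonneg _ _ (by push_cast; linarith) (by norm_num)]
              congr 1; push_cast; ring
            change ‖w x‖ₑ ^ q ≤ _
            rw [h4]
            gcongr
            exact h3 x
        _ ≤ _ := by
            rw [lintegral_const_mul _ (hwe.pow_const 2)]
            gcongr
  · obtain ⟨m, hm⟩ := exists_nat_ge q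
    obtain ⟨C, hC, H⟩ := lintegral_even_pow_le_dim_two A hA m
    refine ⟨A + C, by finiteness, fun w hw hwc h1 h2 => ?_⟩
    refine (interp ((2 * (m + 1) : ℕ) : ℝ) (by push_cast; linarith) w hw.continuous).trans ?_
    simp_rw [ENNReal.rpow_natCast]
    exact add_le_add h1 (H w hw hwc h1 h2)
  · obtain ⟨C, hC, H⟩ := lintegral_rpow_le_dim_ge_three hN3 A hA
    have hN' : (3 : ℝ) ≤ N := by exact_mod_cast hN3
    refine ⟨A + C, by finiteness, fun w hw hwc h1 h2 => ?_⟩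
    refine (interp (2 * N / (N - 2)) ?_ w hw.continuous).trans
      (add_le_add h1 (H w hw hwc h2))
    rw [le_div_iff₀ (by linarith)]; linarith

end CompactlySupported

/-! ### Smooth cutoffs -/

section Cutoff

/-- A smooth cutoff function equal to `1` on the ball of radius `n + 1`. -/
noncomputable def cutoff (N n : ℕ) (x : Space N) : ℝ :=
  (⟨1, 2, by norm_num, by norm_num⟩ : ContDiffBump (0 : Space N)) (((n : ℝ) + 1)⁻¹ • x)

lemma contDiff_cutoff (N n : ℕ) : ContDiff ℝ ∞ (cutoff N n) :=
  ContDiffBump.contDiff _ |>.comp (contDiff_const_smul _)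

lemma hasCompactSupport_cutoff (N n : ℕ) : HasCompactSupport (cutoff N n) :=
  (ContDiffBump.hasCompactSupport _).comp_smul (by positivity)

lemma norm_cutoff_le (N n : ℕ) (x : Space N) : ‖cutoff N n x‖ ≤ 1 := by
  rw [cutoff, Real.norm_of_nonneg (ContDiffBump.nonneg _)]
  exact ContDiffBump.le_one _

lemma tendsto_cutoff (N : ℕ) (x : Space N) :
    Filter.Tendsto (fun n => cutoff N n x) Filter.atTop (nhds 1) := by
  obtain ⟨m, hm⟩ := exists_nat_ge ‖x‖
  refine tendsto_const_nhds.congr' ?_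
  filter_upwards [Filter.eventually_ge_atTop m] with n hn
  refine (ContDiffBump.one_of_mem_closedBall _ ?_).symm
  have : (m : ℝ) ≤ n := by exact_mod_cast hn
  rw [mem_closedBall_zero_iff, norm_smul, Real.norm_of_nonneg (by positivity),
    inv_mul_le_iff₀ (by positivity)]
  linarith

/-- One fixed bump is dilated by n + 1, which only shrinks the gradient; the bound is uniform in n.
-/
lemma exists_norm_fderiv_cutoff_le (N : ℕ) :
    ∃ C : ℝ, 0 ≤ C ∧ ∀ n x, ‖fderiv ℝ (cutoff N n) x‖ ≤ C := by
  let χ : ContDiffBump (0 : Space N) := ⟨1, 2, by norm_num, by norm_num⟩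
  have hχ : ContDiff ℝ ∞ χ := χ.contDiff
  obtain ⟨C, hC⟩ := (χ.hasCompactSupport.fderiv ℝ).exists_bound_of_continuous
    (hχ.continuous_fderiv (by simp))
  have hC0 : 0 ≤ C := (norm_nonneg _).trans (hC 0)
  refine ⟨C, hC0, fun n x => ?_⟩
  have h1 : fderiv ℝ (cutoff N n) x = ((n : ℝ) + 1)⁻¹ • fderiv ℝ χ (((n : ℝ) + 1)⁻¹ • x) :=
    fderiv_comp_smul ..
  rw [h1, norm_smul, Real.norm_of_nonneg (by positivity)]
  have : ((n : ℝ) + 1)⁻¹ ≤ 1 := inv_le_one_of_one_le₀ (by linarith [Nat.cast_nonneg (α := ℝ) n])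
  calc _ ≤ 1 * C := by gcongr; exact hC _
    _ = C := one_mul C

end Cutoff

/-! ### Elementary structure of H¹ -/

section Basic

variable {N : ℕ}

lemma H1.stronglyMeasurable_toFun (u : H1 N) : StronglyMeasurable u.toFun :=
  Lp.stronglyMeasurable _

lemma H1.stronglyMeasurable_grad (u : H1 N) : StronglyMeasurable u.grad :=
  Lp.stronglyMeasurable _

lemma H1.memLp_toFun (u : H1 N) : MemLp u.toFun 2 := Lp.memLp _

lemma H1.memLp_grad (u : H1 N) : MemLp u.grad 2 := Lp.memLp _

lemma H1.locallyIntegrable_toFun (u : H1 N) : LocallyIntegrable u.toFun :=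
  u.memLp_toFun.locallyIntegrable (by norm_num)

lemma H1.locallyIntegrable_grad (u : H1 N) : LocallyIntegrable u.grad :=
  u.memLp_grad.locallyIntegrable (by norm_num)

lemma H1.isWeakGradient (u : H1 N) : IsWeakGradient u.toFun u.grad := u.2

lemma H1.toFun_add (u v : H1 N) : (u + v).toFun =ᵐ[volume] u.toFun + v.toFun :=
  Lp.coeFn_add u.1.fst v.1.fst

lemma H1.toFun_smul (c : ℝ) (u : H1 N) : (c • u).toFun =ᵐ[volume] c • u.toFun :=
  Lp.coeFn_smul c u.1.fst

lemma H1.toFun_sub (u v : H1 N) : (u - v).toFun =ᵐ[volume] u.toFun - v.toFun :=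
  Lp.coeFn_sub u.1.fst v.1.fst

lemma H1.toFun_zero : (0 : H1 N).toFun =ᵐ[volume] 0 :=
  Lp.coeFn_zero ℝ 2 (volume : Measure (Space N))

lemma H1.grad_sub (u v : H1 N) : (u - v).grad =ᵐ[volume] u.grad - v.grad :=
  Lp.coeFn_sub u.1.snd v.1.snd

lemma lintegral_enorm_sq_Lp {F : Type*} [NormedAddCommGroup F]
    (f : Lp F 2 (volume : Measure (Space N))) : ∫⁻ x, ‖f x‖ₑ ^ 2 = ENNReal.ofReal (‖f‖ ^ 2) := by
  rw [← eLpNorm_two_sq, ENNReal.ofReal_pow (norm_nonneg _), ofReal_norm, Lp.enorm_def]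

lemma H1.norm_sq (u : H1 N) : ‖u‖ ^ 2 = ‖u.1.fst‖ ^ 2 + ‖u.1.snd‖ ^ 2 :=
  WithLp.prod_norm_sq_eq_of_L2 u.1

lemma H1.ofReal_norm_sq (u : H1 N) :
    ENNReal.ofReal (‖u‖ ^ 2) = (∫⁻ x, ‖u.toFun x‖ₑ ^ 2) + ∫⁻ x, ‖u.grad x‖ₑ ^ 2 := by
  rw [H1.norm_sq, ENNReal.ofReal_add (by positivity) (by positivity)]
  exact (congr_arg₂ _ (lintegral_enorm_sq_Lp u.1.fst) (lintegral_enorm_sq_Lp u.1.snd)).symm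

lemma H1.inner_eq (u v : H1 N) : inner ℝ u v =
    (∫ x, u.toFun x * v.toFun x) + ∫ x, inner ℝ (u.grad x) (v.grad x) := by
  change inner ℝ u.1 v.1 = _
  rw [WithLp.prod_inner_apply, L2.inner_def, L2.inner_def]
  congr 1
  refine integral_congr_ae (Filter.Eventually.of_forall fun x => ?_)
  simp only [RCLike.inner_apply, conj_trivial]
  exact mul_comm _ _

lemma energy_eq_norm_sq (u : H1 N) : energy u = ‖u‖ ^ 2 := by
  have h1 : Integrable fun x => ‖u.grad x‖ ^ 2 := u.memLp_grad.integrable_norm_pow two_ne_zero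
  have h2 : Integrable fun x => ‖u.toFun x‖ ^ 2 := u.memLp_toFun.integrable_norm_pow two_ne_zero
  rw [energy, ← real_inner_self_eq_norm_sq, H1.inner_eq]
  simp only [real_inner_self_eq_norm_sq]
  rw [add_comm, ← integral_add]
  · refine integral_congr_ae (Filter.Eventually.of_forall fun x => ?_)
    simp only [sq_abs]; ring
  · exact h1
  · simpa only [← sq, Real.norm_eq_abs, sq_abs] using h2

end Basic

/-! ### The Sobolev embedding of H¹ -/

section Embedding

variable {N : ℕ}

lemma norm_fderiv_mollify_le (u : H1 N) (n : ℕ) (x : Space N) :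
    ‖fderiv ℝ (mollify n u.toFun) x‖ ≤ ‖mollify n u.grad x‖ := by
  refine ContinuousLinearMap.opNorm_le_bound _ (norm_nonneg _) fun v => ?_
  rw [fderiv_mollify u.isWeakGradient u.locallyIntegrable_toFun u.locallyIntegrable_grad]
  exact norm_inner_le_norm _ _

/-- Cutoffs times mollifications are smooth, compactly supported and uniformly bounded in H¹. They
converge to u almost everywhere, so Fatou's lemma passes the Sobolev bound to u. -/
theorem exists_lintegral_rpow_le_of_norm_le_one (hN : 1 ≤ N) {q : ℝ} (hq : 2 ≤ q)
    (hqN : ((N : ℝ) - 2) * q ≤ 2 * N) :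
    ∃ C : ℝ≥0∞, C ≠ ⊤ ∧ ∀ u : H1 N, ‖u‖ ≤ 1 → ∫⁻ x, ‖u.toFun x‖ₑ ^ q ≤ C := by
  obtain ⟨K, hK0, hK⟩ := exists_norm_fderiv_cutoff_le N
  obtain ⟨C, hC, H⟩ := exists_lintegral_rpow_le hN hq hqN (1 + ENNReal.ofReal (2 * (1 + K ^ 2)))
    (by finiteness)
  refine ⟨C, hC, fun u hu => ?_⟩
  have hu2 : ENNReal.ofReal (‖u‖ ^ 2) ≤ 1 := by
    rw [ENNReal.ofReal_le_one]; exact pow_le_one₀ (norm_nonneg _) hu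
  rw [H1.ofReal_norm_sq] at hu2
  have hs : ∀ n, ContDiff ℝ ∞ (mollify n u.toFun) := fun n =>
    contDiff_mollify n u.locallyIntegrable_toFun
  have hgs : ∀ n, ContDiff ℝ ∞ (mollify n u.grad) := fun n =>
    contDiff_mollify n u.locallyIntegrable_grad
  obtain ⟨w, hw⟩ : ∃ w : ℕ → Space N → ℝ, w = fun n x => cutoff N n x * mollify n u.toFun x :=
    ⟨_, rfl⟩
  have hws : ∀ n, ContDiff ℝ 1 (w n) := fun n => by
    rw [hw]; exact ((contDiff_cutoff N n).mul (hs n)).of_le (by simp)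
  have hwc : ∀ n, HasCompactSupport (w n) := fun n => by
    rw [hw]; exact (hasCompactSupport_cutoff N n).mul_right
  have hmol : ∀ n, ∫⁻ x, ‖mollify n u.toFun x‖ₑ ^ 2 ≤ ∫⁻ x, ‖u.toFun x‖ₑ ^ 2 := fun n =>
    lintegral_enorm_mollify_sq_le n u.stronglyMeasurable_toFun
  have hmolg : ∀ n, ∫⁻ x, ‖mollify n u.grad x‖ₑ ^ 2 ≤ ∫⁻ x, ‖u.grad x‖ₑ ^ 2 := fun n =>
    lintegral_enorm_mollify_sq_le n u.stronglyMeasurable_grad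
  have h1 : ∀ n, ∫⁻ x, ‖w n x‖ₑ ^ 2 ≤ 1 := fun n => by
    calc _ ≤ ∫⁻ x, ‖mollify n u.toFun x‖ₑ ^ 2 := by
          refine lintegral_mono fun x => ?_
          simp only [hw]
          rw [enorm_mul, ← ofReal_norm, ]
          gcongr
          refine mul_le_of_le_one_left zero_le ?_
          rw [ENNReal.ofReal_le_one]; exact norm_cutoff_le N n x
      _ ≤ 1 := (hmol n).trans (le_self_add.trans hu2)
  have h2 : ∀ n, ∫⁻ x, ‖fderiv ℝ (w n) x‖ₑ ^ 2 ≤ ENNReal.ofReal (2 * (1 + K ^ 2)) := fun n => by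
    have hpt : ∀ x, ‖fderiv ℝ (w n) x‖ₑ ^ 2 ≤ ENNReal.ofReal 2 * ‖mollify n u.grad x‖ₑ ^ 2 +
        ENNReal.ofReal (2 * K ^ 2) * ‖mollify n u.toFun x‖ₑ ^ 2 := fun x => by
      have e1 : fderiv ℝ (w n) x = cutoff N n x • fderiv ℝ (mollify n u.toFun) x +
          mollify n u.toFun x • fderiv ℝ (cutoff N n) x := by
        rw [hw]
        exact fderiv_fun_mul ((contDiff_cutoff N n).differentiable (by simp) x)
          ((hs n).differentiable (by simp) x)
      have e2 : ‖fderiv ℝ (w n) x‖ ≤ ‖mollify n u.grad x‖ + K * ‖mollify n u.toFun x‖ := by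
        rw [e1]
        refine (norm_add_le _ _).trans (add_le_add ?_ ?_)
        · rw [norm_smul]
          exact (mul_le_of_le_one_left (norm_nonneg _) (norm_cutoff_le N n x)).trans
            (norm_fderiv_mollify_le u n x)
        · rw [norm_smul, mul_comm]
          gcongr
          exact hK n x
      have e3 : ‖fderiv ℝ (w n) x‖ ^ 2 ≤ 2 * ‖mollify n u.grad x‖ ^ 2 +
          2 * K ^ 2 * ‖mollify n u.toFun x‖ ^ 2 := by
        have := norm_nonneg (fderiv ℝ (w n) x)
        nlinarith [sq_nonneg (‖mollify n u.grad x‖ - K * ‖mollify n u.toFun x‖)]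
      have e4 := ENNReal.ofReal_le_ofReal e3
      rwa [ENNReal.ofReal_add (by positivity) (by positivity), ENNReal.ofReal_mul (by positivity),
        ENNReal.ofReal_mul (by positivity), ENNReal.ofReal_pow (by positivity),
        ENNReal.ofReal_pow (by positivity), ENNReal.ofReal_pow (by positivity), ofReal_norm,
        ofReal_norm, ofReal_norm] at e4
    have m1 : Measurable fun x => ‖mollify n u.grad x‖ₑ := (hgs n).continuous.measurable.enorm
    have m2 : Measurable fun x => ‖mollify n u.toFun x‖ₑ := (hs n).continuous.measurable.enorm
    calc _ ≤ _ := lintegral_mono hpt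
      _ = ENNReal.ofReal 2 * (∫⁻ x, ‖mollify n u.grad x‖ₑ ^ 2) +
          ENNReal.ofReal (2 * K ^ 2) * ∫⁻ x, ‖mollify n u.toFun x‖ₑ ^ 2 := by
          rw [lintegral_add_left ((m1.pow_const 2).const_mul _),
            lintegral_const_mul _ (m1.pow_const 2), lintegral_const_mul _ (m2.pow_const 2)]
      _ ≤ ENNReal.ofReal 2 * 1 + ENNReal.ofReal (2 * K ^ 2) * 1 := by
          gcongr
          · exact (hmolg n).trans (le_add_self.trans hu2)
          · exact (hmol n).trans (le_self_add.trans hu2)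
      _ = _ := by
          rw [mul_one, mul_one, ← ENNReal.ofReal_add (by positivity) (by positivity)]
          congr 1; ring
  have h3 : ∀ n, ∫⁻ x, ‖w n x‖ₑ ^ q ≤ C := fun n =>
    H (w n) (hws n) (hwc n) ((h1 n).trans le_self_add) ((h2 n).trans le_add_self)
  have hlim : ∀ᵐ x, Filter.liminf (fun n => ‖w n x‖ₑ ^ q) Filter.atTop = ‖u.toFun x‖ₑ ^ q := by
    filter_upwards [ae_tendsto_mollify u.locallyIntegrable_toFun] with x hx
    refine Filter.Tendsto.liminf_eq ?_
    have h4 := ((tendsto_cutoff N x).mul hx).enorm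
    rw [one_mul] at h4
    rw [hw]
    exact (ENNReal.continuous_rpow_const.tendsto _).comp h4
  calc _ = ∫⁻ x, Filter.liminf (fun n => ‖w n x‖ₑ ^ q) Filter.atTop :=
        (lintegral_congr_ae hlim).symm
    _ ≤ Filter.liminf (fun n => ∫⁻ x, ‖w n x‖ₑ ^ q) Filter.atTop :=
        lintegral_liminf_le fun n => (hws n).continuous.measurable.enorm.pow_const q
    _ ≤ C := Filter.liminf_le_of_le (by isBoundedDefault) fun b hb => by
        obtain ⟨n, hn⟩ := hb.exists
        exact hn.trans (h3 n)

/-- The Sobolev embedding of `H¹` into `L^q`. -/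
theorem exists_sobolev_embedding (hN : 1 ≤ N) {q : ℝ≥0∞} [Fact (1 ≤ q)] (hqt : q ≠ ⊤)
    (hq : 2 ≤ q.toReal) (hqN : ((N : ℝ) - 2) * q.toReal ≤ 2 * N) :
    ∃ ι : H1 N →L[ℝ] Lp ℝ q (volume : Measure (Space N)), ∀ u, ι u =ᵐ[volume] u.toFun := by
  obtain ⟨C, hC, H⟩ := exists_lintegral_rpow_le_of_norm_le_one hN hq hqN
  have hq0 : q ≠ 0 := by rintro rfl; simp at hq; linarith
  have hqr : 0 < q.toReal := by linarith
  have hb : ∀ u : H1 N, ‖u‖ ≤ 1 → eLpNorm u.toFun q volume ≤ C ^ (1 / q.toReal) := fun u hu => by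
    rw [eLpNorm_eq_lintegral_rpow_enorm_toReal hq0 hqt]
    gcongr
    exact H u hu
  have hCt : C ^ (1 / q.toReal) ≠ ⊤ := by finiteness
  -- Integrability is known on the unit ball; scaling u into it and back gives the general case.
  have hmem : ∀ u : H1 N, MemLp u.toFun q := fun u => by
    obtain ⟨c, hc0, hc⟩ : ∃ c : ℝ, c ≠ 0 ∧ ‖c • u‖ ≤ 1 := by
      refine ⟨(‖u‖ + 1)⁻¹, by positivity, ?_⟩
      rw [norm_smul, Real.norm_of_nonneg (by positivity), inv_mul_le_iff₀ (by positivity)]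
      linarith
    have h1 : MemLp (c • u).toFun q :=
      ⟨(H1.stronglyMeasurable_toFun _).aestronglyMeasurable, (hb _ hc).trans_lt hCt.lt_top⟩
    have h2 := (h1.ae_eq (H1.toFun_smul c u)).const_smul c⁻¹
    rwa [smul_smul, inv_mul_cancel₀ hc0, one_smul] at h2
  let ι₀ : H1 N →ₗ[ℝ] Lp ℝ q (volume : Measure (Space N)) :=
    { toFun := fun u => (hmem u).toLp _
      map_add' := fun u v => by
        rw [← MemLp.toLp_add]
        exact MemLp.toLp_congr _ _ (H1.toFun_add u v)
      map_smul' := fun c u => by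
        rw [RingHom.id_apply, ← MemLp.toLp_const_smul]
        exact MemLp.toLp_congr _ _ (H1.toFun_smul c u) }
  have hι : ∀ u : H1 N, ‖u‖ ≤ 1 → ‖ι₀ u‖ ≤ (C ^ (1 / q.toReal)).toReal := fun u hu => by
    change ‖(hmem u).toLp _‖ ≤ _
    rw [Lp.norm_toLp]
    exact ENNReal.toReal_mono hCt (hb u hu)
  refine ⟨ι₀.mkContinuous (C ^ (1 / q.toReal)).toReal fun u => ?_,
    fun u => (hmem u).coeFn_toLp⟩
  rcases eq_or_ne u 0 with rfl | hu
  · simp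
  have hun : 0 < ‖u‖ := norm_pos_iff.2 hu
  have h1 := hι (‖u‖⁻¹ • u) (by rw [norm_smul, norm_inv, norm_norm, inv_mul_cancel₀ hun.ne'])
  rw [map_smul, norm_smul, norm_inv, norm_norm, inv_mul_le_iff₀ hun] at h1
  rwa [mul_comm]

end Embedding

/-! ### Uniqueness and chain rule for weak gradients -/

section WeakGradient

variable {N : ℕ}

lemma IsWeakGradient.congr {u u' : Space N → ℝ} {g g' : Space N → Space N}
    (h : IsWeakGradient u g) (hu : u =ᵐ[volume] u') (hg : g =ᵐ[volume] g') :
    IsWeakGradient u' g' := by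
  intro φ hφ hc v
  have h1 : ∫ x, u' x * fderiv ℝ φ x v = ∫ x, u x * fderiv ℝ φ x v :=
    integral_congr_ae (by filter_upwards [hu] with x hx; rw [hx])
  have h2 : ∫ x, inner ℝ (g' x) v * φ x = ∫ x, inner ℝ (g x) v * φ x :=
    integral_congr_ae (by filter_upwards [hg] with x hx; rw [hx])
  rw [h1, h2, h φ hφ hc v]

/-- The fundamental lemma of the calculus of variations, applied to each coordinate. -/
lemma IsWeakGradient.ae_unique {u : Space N → ℝ} {g g' : Space N → Space N}
    (h : IsWeakGradient u g) (h' : IsWeakGradient u g') (hg : LocallyIntegrable g)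
    (hg' : LocallyIntegrable g') : g =ᵐ[volume] g' := by
  have key : ∀ v : Space N, ∀ᵐ x, inner ℝ v (g x) = inner ℝ v (g' x) := by
    intro v
    have hl : ∀ {g : Space N → Space N}, LocallyIntegrable g →
        LocallyIntegrable fun x => inner ℝ v (g x) := fun hg x => by
      obtain ⟨s, hs, hi⟩ := hg x
      exact ⟨s, hs, hi.const_inner v⟩
    refine ae_eq_of_integral_contDiff_smul_eq (hl hg) (hl hg') fun φ hφ hc => ?_
    have h1 := (h φ hφ hc v).symm.trans (h' φ hφ hc v)
    rw [neg_inj] at h1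
    simpa only [smul_eq_mul, mul_comm, real_inner_comm] using h1
  have key' : ∀ᵐ x, ∀ i : Fin N, inner ℝ (EuclideanSpace.single i (1 : ℝ)) (g x) =
      inner ℝ (EuclideanSpace.single i (1 : ℝ)) (g' x) := ae_all_iff.2 fun i => key _
  filter_upwards [key'] with x hx
  ext i
  simpa [EuclideanSpace.inner_single_left] using hx i

/-- The gradient component is determined by the function, so the choice made in `H1.ofFun` is
harmless. -/
lemma H1.ext_toFun {u v : H1 N} (h : u.toFun =ᵐ[volume] v.toFun) : u = v := by
  have hg : u.grad =ᵐ[volume] v.grad :=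
    (u.isWeakGradient.congr h (Filter.EventuallyEq.refl _ _)).ae_unique v.isWeakGradient
      u.locallyIntegrable_grad v.locallyIntegrable_grad
  have h1 : u.1.fst = v.1.fst := Lp.ext h
  have h2 : u.1.snd = v.1.snd := Lp.ext hg
  exact Subtype.ext (WithLp.ofLp_injective 2 (Prod.ext h1 h2))

lemma H1.ofFun_eq {f : Space N → ℝ} {w : H1 N} (h : w.toFun =ᵐ[volume] f) : H1.ofFun f = w := by
  have hex : ∃ w : H1 N, w.toFun =ᵐ[volume] f := ⟨w, h⟩
  rw [H1.ofFun, dif_pos hex]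
  exact H1.ext_toFun (hex.choose_spec.trans h.symm)

lemma exists_H1 {f : Space N → ℝ} {g : Space N → Space N} (hf : MemLp f 2) (hg : MemLp g 2)
    (h : IsWeakGradient f g) : ∃ w : H1 N, w.toFun =ᵐ[volume] f ∧ w.grad =ᵐ[volume] g :=
  ⟨⟨WithLp.toLp 2 (hf.toLp f, hg.toLp g), h.congr hf.coeFn_toLp.symm hg.coeFn_toLp.symm⟩,
    hf.coeFn_toLp, hg.coeFn_toLp⟩

lemma tendsto_lintegral_of_le_mul {X F G : Type*} [MeasurableSpace X] {μ : Measure X}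
    [NormedAddCommGroup F] [NormedAddCommGroup G] {f : ℕ → X → ℝ≥0∞} {d : ℕ → X → F} {h : X → G}
    (hd : ∀ n, AEStronglyMeasurable (d n) μ) (hh : MemLp h 2 μ)
    (hle : ∀ n x, f n x ≤ ‖d n x‖ₑ * ‖h x‖ₑ)
    (hlim : Filter.Tendsto (fun n => ∫⁻ x, ‖d n x‖ₑ ^ 2 ∂μ) Filter.atTop (nhds 0)) :
    Filter.Tendsto (fun n => ∫⁻ x, f n x ∂μ) Filter.atTop (nhds 0) := by
  have hC : (∫⁻ x, ‖h x‖ₑ ^ (2 : ℝ) ∂μ) ^ (1 / 2 : ℝ) ≠ ⊤ := by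
    have := ((memLp_two_iff hh.1).1 hh).ne
    simp only [ENNReal.rpow_ofNat]
    finiteness
  have h1 : Filter.Tendsto (fun n => (∫⁻ x, ‖d n x‖ₑ ^ 2 ∂μ) ^ (1 / 2 : ℝ) *
      (∫⁻ x, ‖h x‖ₑ ^ (2 : ℝ) ∂μ) ^ (1 / 2 : ℝ)) Filter.atTop (nhds 0) := by
    have h2 := ((ENNReal.continuous_rpow_const (y := (1 / 2 : ℝ))).tendsto 0).comp hlim
    rw [ENNReal.zero_rpow_of_pos (by norm_num)] at h2
    simpa using ENNReal.Tendsto.mul_const h2 (Or.inr hC)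
  refine tendsto_of_tendsto_of_tendsto_of_le_of_le tendsto_const_nhds h1 (fun n => zero_le)
    fun n => ?_
  refine (lintegral_mono (hle n)).trans ?_
  simpa using ENNReal.lintegral_mul_le_Lp_mul_Lq μ Real.HolderConjugate.two_two (hd n).enorm hh.1.enorm

lemma integrable_mul_smul_inner {u : Space N → ℝ} {g : Space N → Space N} (hg : MemLp g 2)
    {ψ : ℝ → ℝ} (hψ : Measurable ψ) (hψ1 : ∀ t, |ψ t| ≤ 1) (hu : StronglyMeasurable u)
    {φ : Space N → ℝ} (hφ : MemLp φ 2) (v : Space N) :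
    Integrable fun x => inner ℝ (ψ (u x) • g x) v * φ x := by
  have h1 : Integrable fun x => inner ℝ (g x) v * φ x := (hg.inner_const v).integrable_mul hφ
  refine h1.mono ?_ (Filter.Eventually.of_forall fun x => ?_)
  · exact (((hψ.comp hu.measurable).aestronglyMeasurable.smul hg.1).inner
      aestronglyMeasurable_const).mul hφ.1
  · rw [inner_smul_left, norm_mul, norm_mul, norm_mul, conj_trivial, mul_assoc]
    exact mul_le_of_le_one_left (by positivity) (hψ1 _)

/-- The chain rule for weak gradients. -/
theorem IsWeakGradient.comp {u : Space N → ℝ} {g : Space N → Space N} (h : IsWeakGradient u g)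
    (hum : StronglyMeasurable u) (hgm : StronglyMeasurable g) (hu : MemLp u 2) (hg : MemLp g 2)
    {F ψ : ℝ → ℝ} (hF : ∀ t, HasDerivAt F (ψ t) t) (hψ : Continuous ψ) (hψ1 : ∀ t, |ψ t| ≤ 1)
    (hF0 : F 0 = 0) : IsWeakGradient (fun x => F (u x)) (fun x => ψ (u x) • g x) := by
  intro φ hφ hc v
  have hul : LocallyIntegrable u := hu.locallyIntegrable (by norm_num)
  have hgl : LocallyIntegrable g := hg.locallyIntegrable (by norm_num)
  have hφ1 : ContDiff ℝ 1 φ := hφ.of_le (by simp)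
  have hφ' : Continuous fun x => fderiv ℝ φ x v :=
    (hφ.continuous_fderiv (by simp)).clm_apply continuous_const
  have hφ2 : MemLp φ 2 := hφ.continuous.memLp_of_hasCompactSupport hc
  have hφ'2 : MemLp (fun x => fderiv ℝ φ x v) 2 :=
    hφ'.memLp_of_hasCompactSupport (hc.fderiv_apply ℝ v)
  have hFc : Continuous F := continuous_iff_continuousAt.2 fun t => (hF t).continuousAt
  have hFl : ∀ s t, |F s - F t| ≤ |s - t| := fun s t => by
    simpa using Convex.norm_image_sub_le_of_norm_hasDerivWithin_le (s := Set.univ) (C := 1)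
      (fun z _ => (hF z).hasDerivWithinAt) (fun z _ => hψ1 z) convex_univ (Set.mem_univ t)
      (Set.mem_univ s)
  obtain ⟨un, hun⟩ : ∃ un : ℕ → Space N → ℝ, un = fun n => mollify n u := ⟨_, rfl⟩
  obtain ⟨gn, hgn⟩ : ∃ gn : ℕ → Space N → Space N, gn = fun n => mollify n g := ⟨_, rfl⟩
  have hus : ∀ n, ContDiff ℝ ∞ (un n) := fun n => by rw [hun]; exact contDiff_mollify n hul
  have hgs : ∀ n, ContDiff ℝ ∞ (gn n) := fun n => by rw [hgn]; exact contDiff_mollify n hgl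
  have hder : ∀ n x, fderiv ℝ (un n) x v = inner ℝ (gn n x) v := fun n x => by
    rw [hun, hgn]; exact fderiv_mollify h hul hgl n x v
  have hcomp : ∀ n x, HasFDerivAt (fun x => F (un n x)) (ψ (un n x) • fderiv ℝ (un n) x) x :=
    fun n x => (hF (un n x)).comp_hasFDerivAt x
      ((hus n).differentiable (by simp) x).hasFDerivAt
  have hcd : ∀ n x, fderiv ℝ (fun x => F (un n x)) x v = inner ℝ (ψ (un n x) • gn n x) v :=
    fun n x => by
      rw [(hcomp n x).fderiv, _root_.smul_apply, hder, inner_smul_left]; rfl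
  have hcc : ∀ n, Continuous fun x => inner ℝ (ψ (un n x) • gn n x) v := fun n =>
    ((hψ.comp (hus n).continuous).smul (hgs n).continuous).inner continuous_const
  have hparts : ∀ n, ∫ x, F (un n x) * fderiv ℝ φ x v =
      - ∫ x, inner ℝ (ψ (un n x) • gn n x) v * φ x := fun n => by
    have h1 := integral_mul_fderiv_eq_neg_fderiv_mul_of_integrable (μ := (volume : Measure (Space N)))
      (f := fun x => F (un n x)) (g := φ) (v := v) ?_ ?_ ?_
      (fun x _ => (hcomp n x).differentiableAt) (fun x _ => hφ1.differentiable one_ne_zero x)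
    · simpa only [hcd] using h1
    · simp only [hcd]
      exact ((hcc n).mul hφ.continuous).integrable_of_hasCompactSupport hc.mul_left
    · exact ((hFc.comp (hus n).continuous).mul hφ').integrable_of_hasCompactSupport
        (hc.fderiv_apply ℝ v).mul_left
    · exact ((hFc.comp (hus n).continuous).mul hφ.continuous).integrable_of_hasCompactSupport
        hc.mul_left
  have hFu : MemLp (fun x => F (u x)) 2 := by
    refine hu.mono (hFc.comp_aestronglyMeasurable hu.1) (Filter.Eventually.of_forall fun x => ?_)
    simpa [hF0] using hFl (u x) 0
  have hlim1 : Filter.Tendsto (fun n => ∫ x, F (un n x) * fderiv ℝ φ x v) Filter.atTop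
      (nhds (∫ x, F (u x) * fderiv ℝ φ x v)) := by
    refine tendsto_integral_of_L1 _ (hFu.integrable_mul hφ'2).1 (Filter.Eventually.of_forall fun n =>
      ((hFc.comp (hus n).continuous).mul hφ').integrable_of_hasCompactSupport
        (hc.fderiv_apply ℝ v).mul_left) ?_
    refine tendsto_lintegral_of_le_mul (d := fun n x => mollify n u x - u x)
      (fun n => (contDiff_mollify n hul).continuous.aestronglyMeasurable.sub hu.1) hφ'2
      (fun n x => ?_) (tendsto_lintegral_mollify_sub hum hu)
    rw [Pi.mul_apply, ← sub_mul, enorm_mul, hun]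
    gcongr
    rw [← ofReal_norm, ← ofReal_norm]
    exact ENNReal.ofReal_le_ofReal (hFl _ _)
  have hlim2 : Filter.Tendsto (fun n => ∫ x, inner ℝ (ψ (un n x) • gn n x) v * φ x) Filter.atTop
      (nhds (∫ x, inner ℝ (ψ (u x) • g x) v * φ x)) := by
    have hint1 : ∀ n, Integrable fun x => inner ℝ (ψ (un n x) • g x) v * φ x := fun n =>
      integrable_mul_smul_inner hg hψ.measurable hψ1 (hus n).continuous.stronglyMeasurable hφ2 v
    have hint2 : ∀ n, Integrable fun x => inner ℝ (ψ (un n x) • gn n x) v * φ x := fun n =>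
      ((hcc n).mul hφ.continuous).integrable_of_hasCompactSupport hc.mul_left
    -- The product ψ(u_n) g_n is handled in two steps: here g is kept fixed and dominated
    -- convergence applies, since ψ is bounded; replacing g_n by g then costs an L² error.
    have hA : Filter.Tendsto (fun n => ∫ x, inner ℝ (ψ (un n x) • g x) v * φ x) Filter.atTop
        (nhds (∫ x, inner ℝ (ψ (u x) • g x) v * φ x)) := by
      refine tendsto_integral_of_dominated_convergence (fun x => ‖inner ℝ (g x) v * φ x‖)
        (fun n => (hint1 n).1) ((hg.inner_const v).integrable_mul hφ2).norm
        (fun n => Filter.Eventually.of_forall fun x => ?_) ?_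
      · rw [inner_smul_left, norm_mul, norm_mul, norm_mul, conj_trivial, mul_assoc]
        exact mul_le_of_le_one_left (by positivity) (hψ1 _)
      · filter_upwards [ae_tendsto_mollify hul] with x hx
        rw [hun]
        exact ((((hψ.tendsto _).comp hx).smul_const (g x)).inner tendsto_const_nhds).mul_const _
    have hB : Filter.Tendsto (fun n => ∫ x, (inner ℝ (ψ (un n x) • gn n x) v * φ x -
        inner ℝ (ψ (un n x) • g x) v * φ x)) Filter.atTop (nhds 0) := by
      have := tendsto_integral_of_L1 (μ := (volume : Measure (Space N))) (fun _ => (0 : ℝ))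
        aestronglyMeasurable_const (F := fun n x => inner ℝ (ψ (un n x) • gn n x) v * φ x -
        inner ℝ (ψ (un n x) • g x) v * φ x) (l := Filter.atTop)
        (Filter.Eventually.of_forall fun n => (hint2 n).sub (hint1 n)) ?_
      · simpa using this
      · refine tendsto_lintegral_of_le_mul (d := fun n x => mollify n g x - g x)
          (h := fun x => ‖v‖ * φ x)
          (fun n => (contDiff_mollify n hgl).continuous.aestronglyMeasurable.sub hg.1)
          (hφ2.const_mul _) (fun n x => ?_) (tendsto_lintegral_mollify_sub hgm hg)
        rw [sub_zero, ← sub_mul, ← inner_sub_left, ← smul_sub, inner_smul_left, hgn,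
          ← ofReal_norm, ← ofReal_norm, ← ofReal_norm, ← ENNReal.ofReal_mul (norm_nonneg _)]
        refine ENNReal.ofReal_le_ofReal ?_
        rw [norm_mul, norm_mul, norm_mul, norm_norm, conj_trivial, ← mul_assoc]
        refine mul_le_mul_of_nonneg_right ?_ (norm_nonneg _)
        calc _ ≤ ‖inner ℝ (mollify n g x - g x) v‖ :=
              mul_le_of_le_one_left (norm_nonneg _) (hψ1 _)
          _ ≤ _ := norm_inner_le_norm _ _
    have hAB := hB.add hA
    rw [zero_add] at hAB
    refine hAB.congr fun n => ?_
    rw [integral_sub (hint2 n) (hint1 n)]; ring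
  exact tendsto_nhds_unique (hlim1.congr hparts) hlim2.neg

/-- The chain rule for pointwise limits of smooth functions. -/
theorem IsWeakGradient.comp_of_tendsto {u : Space N → ℝ} {g : Space N → Space N}
    (h : IsWeakGradient u g)
    (hum : StronglyMeasurable u) (hgm : StronglyMeasurable g) (hu : MemLp u 2) (hg : MemLp g 2)
    {F ψ : ℕ → ℝ → ℝ} (hF : ∀ k t, HasDerivAt (F k) (ψ k t) t) (hψ : ∀ k, Continuous (ψ k))
    (hψ1 : ∀ k t, |ψ k t| ≤ 1) (hF0 : ∀ k, F k 0 = 0) {G γ : ℝ → ℝ}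
    (hG : ∀ t, Filter.Tendsto (fun k => F k t) Filter.atTop (nhds (G t)))
    (hγ : ∀ t, Filter.Tendsto (fun k => ψ k t) Filter.atTop (nhds (γ t))) :
    IsWeakGradient (fun x => G (u x)) (fun x => γ (u x) • g x) := by
  intro φ hφ hc v
  have hφ' : Continuous fun x => fderiv ℝ φ x v :=
    (hφ.continuous_fderiv (by simp)).clm_apply continuous_const
  have hφ2 : MemLp φ 2 := hφ.continuous.memLp_of_hasCompactSupport hc
  have hφ'2 : MemLp (fun x => fderiv ℝ φ x v) 2 :=
    hφ'.memLp_of_hasCompactSupport (hc.fderiv_apply ℝ v)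
  have hFb : ∀ k t, |F k t| ≤ |t| := fun k t => by
    simpa [hF0] using Convex.norm_image_sub_le_of_norm_hasDerivWithin_le (s := Set.univ) (C := 1)
      (fun z _ => (hF k z).hasDerivWithinAt) (fun z _ => hψ1 k z) convex_univ (Set.mem_univ 0)
      (Set.mem_univ t)
  have hFc : ∀ k, Continuous (F k) := fun k =>
    continuous_iff_continuousAt.2 fun t => (hF k t).continuousAt
  have hlim1 : Filter.Tendsto (fun k => ∫ x, F k (u x) * fderiv ℝ φ x v) Filter.atTop
      (nhds (∫ x, G (u x) * fderiv ℝ φ x v)) := by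
    refine tendsto_integral_of_dominated_convergence (fun x => ‖u x * fderiv ℝ φ x v‖)
      (fun k => ((hFc k).comp_aestronglyMeasurable hu.1).mul hφ'2.1) (hu.integrable_mul hφ'2).norm
      (fun k => Filter.Eventually.of_forall fun x => ?_)
      (Filter.Eventually.of_forall fun x => (hG _).mul_const _)
    rw [norm_mul, norm_mul]
    gcongr
    exact hFb _ _
  have hlim2 : Filter.Tendsto (fun k => ∫ x, inner ℝ (ψ k (u x) • g x) v * φ x) Filter.atTop
      (nhds (∫ x, inner ℝ (γ (u x) • g x) v * φ x)) := by
    refine tendsto_integral_of_dominated_convergence (fun x => ‖inner ℝ (g x) v * φ x‖)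
      (fun k => (integrable_mul_smul_inner hg (hψ k).measurable (hψ1 k) hum hφ2 v).1)
      ((hg.inner_const v).integrable_mul hφ2).norm
      (fun k => Filter.Eventually.of_forall fun x => ?_)
      (Filter.Eventually.of_forall fun x =>
        (((hγ _).smul_const _).inner tendsto_const_nhds).mul_const _)
    rw [inner_smul_left, norm_mul, norm_mul, norm_mul, conj_trivial, mul_assoc]
    exact mul_le_of_le_one_left (by positivity) (hψ1 _ _)
  exact tendsto_nhds_unique
    (hlim1.congr fun k => h.comp hum hgm hu hg (hF k) (hψ k) (hψ1 k) (hF0 k) φ hφ hc v) hlim2.neg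

end WeakGradient

/-! ### Absolute value, positive and negative parts in H¹ -/

section Abs

variable {N : ℕ}

lemma abs_div_abs_le_one (t : ℝ) : |(t / |t|)| ≤ 1 := by
  rw [abs_div, abs_abs]; exact div_self_le_one _

lemma tendsto_inv_nat_add_one :
    Filter.Tendsto (fun k : ℕ => ((k : ℝ) + 1)⁻¹) Filter.atTop (nhds 0) := by
  simpa using tendsto_one_div_add_atTop_nhds_zero_nat (𝕜 := ℝ)

/-- |t| is the limit of √(t²+ε²) - ε as ε = 1/(k+1) tends to 0, and the derivatives tend to t/|t|.
At t = 0 the limit is 0, which agrees with the convention 0/0 = 0. -/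
lemma H1.isWeakGradient_abs (u : H1 N) :
    IsWeakGradient (fun x => |u.toFun x|) (fun x => (u.toFun x / |u.toFun x|) • u.grad x) := by
  refine u.isWeakGradient.comp_of_tendsto u.stronglyMeasurable_toFun u.stronglyMeasurable_grad
    u.memLp_toFun u.memLp_grad (F := fun k t => √(t ^ 2 + (((k : ℝ) + 1)⁻¹) ^ 2) - ((k : ℝ) + 1)⁻¹)
    (ψ := fun k t => t / √(t ^ 2 + (((k : ℝ) + 1)⁻¹) ^ 2)) (fun k t => ?_) (fun k => ?_)
    (fun k t => ?_) (fun k => ?_) (G := fun t => |t|) (γ := fun t => t / |t|) (fun t => ?_)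
    (fun t => ?_)
  · have hpos : t ^ 2 + (((k : ℝ) + 1)⁻¹) ^ 2 ≠ 0 := by positivity
    have h := ((((hasDerivAt_id t).pow 2).add_const ((((k : ℝ) + 1)⁻¹) ^ 2)).sqrt hpos).sub_const
      (((k : ℝ) + 1)⁻¹)
    refine h.congr_deriv ?_
    simp only [id, Pi.pow_apply]
    field_simp
    norm_num
  · have : ∀ t : ℝ, √(t ^ 2 + (((k : ℝ) + 1)⁻¹) ^ 2) ≠ 0 := fun t => by positivity
    fun_prop (disch := exact this _)
  · rw [abs_div, abs_of_nonneg (Real.sqrt_nonneg _)]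
    refine div_le_one_of_le₀ ?_ (Real.sqrt_nonneg _)
    exact Real.abs_le_sqrt (by linarith [sq_nonneg (((k : ℝ) + 1)⁻¹)])
  · rw [zero_pow two_ne_zero, zero_add, Real.sqrt_sq (by positivity), sub_self]
  · have h : Continuous fun ε : ℝ => √(t ^ 2 + ε ^ 2) - ε := by fun_prop
    have h2 := (h.tendsto 0).comp tendsto_inv_nat_add_one
    have e : √(t ^ 2 + 0 ^ 2) - 0 = |t| := by simp [Real.sqrt_sq_eq_abs]
    rw [e] at h2
    exact h2
  · rcases eq_or_ne t 0 with rfl | ht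
    · simp
    · have h : ContinuousAt (fun ε : ℝ => t / √(t ^ 2 + ε ^ 2)) 0 := by
        refine ContinuousAt.div continuousAt_const (by fun_prop) ?_
        positivity
      have h2 := h.tendsto.comp tendsto_inv_nat_add_one
      have e : t / √(t ^ 2 + 0 ^ 2) = t / |t| := by simp [Real.sqrt_sq_eq_abs]
      rw [e] at h2
      exact h2

/-- The weak gradient vanishes almost everywhere on the zero set. -/
lemma H1.grad_eq_zero (u : H1 N) : ∀ᵐ x, u.toFun x = 0 → u.grad x = 0 := by
  have h : IsWeakGradient (fun _ => (0 : ℝ))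
      (fun x => (if u.toFun x = 0 then (1 : ℝ) else 0) • u.grad x) := by
    -- The functions arctan((k+1)t)/(k+1) tend to 0 while their derivatives tend to the indicator of
    -- {0}. So 1_{u=0} ∇u is a weak gradient of 0 and vanishes by uniqueness.
    refine u.isWeakGradient.comp_of_tendsto u.stronglyMeasurable_toFun u.stronglyMeasurable_grad
      u.memLp_toFun u.memLp_grad (F := fun k t => ((k : ℝ) + 1)⁻¹ * Real.arctan (((k : ℝ) + 1) * t))
      (ψ := fun k t => 1 / (1 + (((k : ℝ) + 1) * t) ^ 2)) (fun k t => ?_) (fun k => ?_)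
      (fun k t => ?_) (fun k => ?_) (G := fun _ => 0) (γ := fun t => if t = 0 then 1 else 0)
      (fun t => ?_) (fun t => ?_)
    · have h := (((hasDerivAt_id t).const_mul ((k : ℝ) + 1)).arctan).const_mul (((k : ℝ) + 1)⁻¹)
      refine h.congr_deriv ?_
      simp only [id]
      field_simp
    · have : ∀ t : ℝ, 1 + (((k : ℝ) + 1) * t) ^ 2 ≠ 0 := fun t => by positivity
      fun_prop (disch := exact this _)
    · rw [abs_of_nonneg (by positivity)]
      exact div_le_one_of_le₀ (by nlinarith [sq_nonneg (((k : ℝ) + 1) * t)]) (by positivity)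
    · simp
    · refine squeeze_zero_norm (a := fun k : ℕ => ((k : ℝ) + 1)⁻¹ * (Real.pi / 2)) (fun k => ?_) ?_
      · rw [norm_mul, Real.norm_of_nonneg (by positivity), Real.norm_eq_abs]
        gcongr
        exact abs_le.2 ⟨(Real.neg_pi_div_two_lt_arctan _).le, (Real.arctan_lt_pi_div_two _).le⟩
      · simpa using tendsto_inv_nat_add_one.mul_const (Real.pi / 2)
    · rcases eq_or_ne t 0 with rfl | ht
      · simp
      · simp only [if_neg ht]
        have h1 : Filter.Tendsto (fun k : ℕ => (k : ℝ) + 1) Filter.atTop Filter.atTop :=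
          Filter.tendsto_atTop_add_const_right _ _ tendsto_natCast_atTop_atTop
        have h2 : Filter.Tendsto (fun k : ℕ => 1 + (((k : ℝ) + 1) * t) ^ 2) Filter.atTop
            Filter.atTop := by
          refine Filter.tendsto_atTop_add_const_left _ _ ?_
          simp_rw [mul_pow]
          exact ((Filter.tendsto_pow_atTop two_ne_zero).comp h1).atTop_mul_const (by positivity)
        simp only [one_div]
        exact h2.inv_tendsto_atTop
  have h0 : IsWeakGradient (fun _ : Space N => (0 : ℝ)) (fun _ => 0) := by
    intro φ _ _ v; simp
  have hl : LocallyIntegrable fun x => (if u.toFun x = 0 then (1 : ℝ) else 0) • u.grad x := by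
    refine u.locallyIntegrable_grad.mono ?_ (Filter.Eventually.of_forall fun x => ?_)
    · refine StronglyMeasurable.aestronglyMeasurable ?_
      have h1 : StronglyMeasurable fun x => if u.toFun x = 0 then (1 : ℝ) else 0 :=
        StronglyMeasurable.ite (u.stronglyMeasurable_toFun.measurable (measurableSet_singleton 0))
          stronglyMeasurable_const stronglyMeasurable_const
      exact h1.smul u.stronglyMeasurable_grad
    · split_ifs <;> simp
  filter_upwards [h.ae_unique h0 hl (locallyIntegrable_const 0)] with x hx h2
  simpa [h2] using hx

lemma H1.exists_abs (u : H1 N) : ∃ w : H1 N, w.toFun =ᵐ[volume] (fun x => |u.toFun x|) ∧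
    w.grad =ᵐ[volume] fun x => (u.toFun x / |u.toFun x|) • u.grad x := by
  refine exists_H1 u.memLp_toFun.norm ?_ u.isWeakGradient_abs
  refine u.memLp_grad.mono ?_ (Filter.Eventually.of_forall fun x => ?_)
  · have := u.stronglyMeasurable_toFun.measurable
    exact (by fun_prop : Measurable fun x => u.toFun x / |u.toFun x|).aestronglyMeasurable.smul
      u.memLp_grad.1
  · rw [norm_smul]
    exact mul_le_of_le_one_left (norm_nonneg _) (abs_div_abs_le_one _)

/-- The absolute value `|u|` in `H¹`. -/
noncomputable def H1.abs (u : H1 N) : H1 N := u.exists_abs.choose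

lemma H1.toFun_abs (u : H1 N) : u.abs.toFun =ᵐ[volume] fun x => |u.toFun x| :=
  u.exists_abs.choose_spec.1

lemma H1.grad_abs (u : H1 N) :
    u.abs.grad =ᵐ[volume] fun x => (u.toFun x / |u.toFun x|) • u.grad x :=
  u.exists_abs.choose_spec.2

/-- The factor u/|u| has modulus one off the zero set of u, and ∇u vanishes almost everywhere on
that set. -/
lemma H1.norm_abs (u : H1 N) : ‖u.abs‖ = ‖u‖ := by
  have h : ENNReal.ofReal (‖u.abs‖ ^ 2) = ENNReal.ofReal (‖u‖ ^ 2) := by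
    rw [H1.ofReal_norm_sq, H1.ofReal_norm_sq]
    congr 1
    · refine lintegral_congr_ae ?_
      filter_upwards [u.toFun_abs] with x hx
      simp only [hx, ← Real.norm_eq_abs, enorm_norm]
    · refine lintegral_congr_ae ?_
      filter_upwards [u.grad_abs, u.grad_eq_zero] with x hx h0
      simp only [hx]
      rcases eq_or_ne (u.toFun x) 0 with h | h
      · simp [h0 h]
      · have h1 : |u.toFun x| ≠ 0 := abs_ne_zero.2 h
        rw [enorm_smul, ← ofReal_norm (u.toFun x / _), norm_div, Real.norm_eq_abs,
          Real.norm_eq_abs, abs_abs, div_self h1]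
        simp
  rw [ENNReal.ofReal_eq_ofReal_iff (by positivity) (by positivity)] at h
  exact (pow_left_inj₀ (norm_nonneg _) (norm_nonneg _) two_ne_zero).1 h

lemma H1.pos_eq (u : H1 N) : u.pos = (2⁻¹ : ℝ) • (u + u.abs) := by
  refine H1.ofFun_eq ?_
  filter_upwards [H1.toFun_smul 2⁻¹ (u + u.abs), H1.toFun_add u u.abs, u.toFun_abs] with x h1 h2 h3
  rw [h1, Pi.smul_apply, h2, Pi.add_apply, h3, smul_eq_mul]
  rcases le_total 0 (u.toFun x) with h | h
  · rw [abs_of_nonneg h, max_eq_left h]; ring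
  · rw [abs_of_nonpos h, max_eq_right h]; ring

lemma H1.neg_eq (u : H1 N) : u.neg = (2⁻¹ : ℝ) • (u - u.abs) := by
  refine H1.ofFun_eq ?_
  filter_upwards [H1.toFun_smul 2⁻¹ (u - u.abs), H1.toFun_sub u u.abs, u.toFun_abs] with x h1 h2 h3
  rw [h1, Pi.smul_apply, h2, Pi.sub_apply, h3, smul_eq_mul]
  rcases le_total 0 (u.toFun x) with h | h
  · rw [abs_of_nonneg h, min_eq_right h]; ring
  · rw [abs_of_nonpos h, min_eq_left h]; ring

lemma H1.toFun_pos (u : H1 N) : u.pos.toFun =ᵐ[volume] fun x => max (u.toFun x) 0 := by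
  rw [u.pos_eq]
  filter_upwards [H1.toFun_smul 2⁻¹ (u + u.abs), H1.toFun_add u u.abs, u.toFun_abs] with x h1 h2 h3
  rw [h1, Pi.smul_apply, h2, Pi.add_apply, h3, smul_eq_mul]
  rcases le_total 0 (u.toFun x) with h | h
  · rw [abs_of_nonneg h, max_eq_left h]; ring
  · rw [abs_of_nonpos h, max_eq_right h]; ring

lemma H1.pos_add_neg (u : H1 N) : u.pos + u.neg = u := by
  rw [H1.pos_eq, H1.neg_eq]; module

lemma H1.toFun_neg (u : H1 N) : u.neg.toFun =ᵐ[volume] fun x => min (u.toFun x) 0 := by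
  have h : u.neg = u - u.pos := by rw [eq_sub_iff_add_eq, add_comm, u.pos_add_neg]
  rw [h]
  filter_upwards [H1.toFun_sub u u.pos, u.toFun_pos] with x h1 h2
  rw [h1, Pi.sub_apply, h2, sub_eq_iff_eq_add, min_add_max, add_zero]

lemma inner_half_add_half_sub {E : Type*} [NormedAddCommGroup E] [InnerProductSpace ℝ E] (a b : E) :
    inner ℝ ((2⁻¹ : ℝ) • (a + b)) ((2⁻¹ : ℝ) • (a - b)) = (‖a‖ ^ 2 - ‖b‖ ^ 2) / 4 := by
  rw [real_inner_smul_left, real_inner_smul_right, inner_add_left, inner_sub_right,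
    inner_sub_right, real_inner_self_eq_norm_sq, real_inner_self_eq_norm_sq, real_inner_comm]
  ring

/-- u^± = (u ± |u|)/2, and the sum and difference of two vectors of equal norm are orthogonal. -/
lemma H1.inner_pos_neg (u : H1 N) : inner ℝ u.pos u.neg = 0 := by
  have h := inner_half_add_half_sub u u.abs
  rw [H1.norm_abs, sub_self, zero_div] at h
  rw [H1.pos_eq, H1.neg_eq]
  exact h

lemma H1.inner_self_pos (u : H1 N) : inner ℝ u u.pos = ‖u.pos‖ ^ 2 := by
  nth_rewrite 1 [← u.pos_add_neg]
  rw [inner_add_left, real_inner_comm u.pos u.neg, H1.inner_pos_neg,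
    real_inner_self_eq_norm_sq, add_zero]

lemma H1.inner_self_neg (u : H1 N) : inner ℝ u u.neg = ‖u.neg‖ ^ 2 := by
  nth_rewrite 1 [← u.pos_add_neg]
  rw [inner_add_left, H1.inner_pos_neg, real_inner_self_eq_norm_sq, zero_add]

lemma H1.norm_sq_pos_add_neg (u : H1 N) : ‖u‖ ^ 2 = ‖u.pos‖ ^ 2 + ‖u.neg‖ ^ 2 := by
  nth_rewrite 1 [← u.pos_add_neg]
  rw [norm_add_sq_real, H1.inner_pos_neg]; ring

/-- The positive and negative parts of `a u⁺ + b u⁻`. -/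
lemma H1.parts_of_combination (u : H1 N) {a b : ℝ} (ha : 0 ≤ a) (hb : 0 ≤ b) :
    (a • u.pos + b • u.neg).pos = a • u.pos ∧ (a • u.pos + b • u.neg).neg = b • u.neg := by
  constructor
  · refine H1.ofFun_eq ?_
    filter_upwards [H1.toFun_add (a • u.pos) (b • u.neg), H1.toFun_smul a u.pos,
      H1.toFun_smul b u.neg, u.toFun_pos, u.toFun_neg] with x h1 h2 h3 h4 h5
    rw [h1, Pi.add_apply, h2, h3, Pi.smul_apply, Pi.smul_apply, h4, h5, smul_eq_mul, smul_eq_mul]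
    rcases le_total 0 (u.toFun x) with h | h
    · rw [max_eq_left h, min_eq_right h, mul_zero, add_zero, max_eq_left (by positivity)]
    · rw [max_eq_right h, min_eq_left h, mul_zero, zero_add,
        max_eq_right (mul_nonpos_of_nonneg_of_nonpos hb h)]
  · refine H1.ofFun_eq ?_
    filter_upwards [H1.toFun_add (a • u.pos) (b • u.neg), H1.toFun_smul a u.pos,
      H1.toFun_smul b u.neg, u.toFun_pos, u.toFun_neg] with x h1 h2 h3 h4 h5
    rw [h1, Pi.add_apply, h2, h3, Pi.smul_apply, Pi.smul_apply, h4, h5, smul_eq_mul, smul_eq_mul]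
    rcases le_total 0 (u.toFun x) with h | h
    · rw [max_eq_left h, min_eq_right h, mul_zero, add_zero, min_eq_right (by positivity)]
    · rw [max_eq_right h, min_eq_left h, mul_zero, zero_add,
        min_eq_left (mul_nonpos_of_nonneg_of_nonpos hb h)]

lemma tendsto_div_abs {x : ℝ} (hx : x ≠ 0) :
    Filter.Tendsto (fun t : ℝ => t / |t|) (nhds x) (nhds (x / |x|)) :=
  (continuousAt_id.div continuous_abs.continuousAt (abs_ne_zero.2 hx)).tendsto

/-- With s the sign factor, s(w)∇w - s(u)∇u = s(w)(∇w - ∇u) + (s(w) - s(u))∇u: a term controlled by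
the H¹ distance, and one in which only the fixed gradient ∇u appears. -/
lemma H1.ofReal_norm_abs_sub_sq_le (u w : H1 N) :
    ENNReal.ofReal (‖w.abs - u.abs‖ ^ 2) ≤ 2 * ENNReal.ofReal (‖w - u‖ ^ 2) +
      2 * ∫⁻ x, ‖(w.toFun x / |w.toFun x| - u.toFun x / |u.toFun x|) • u.grad x‖ₑ ^ 2 := by
  have m1 : Measurable fun x => ‖(w - u).grad x‖ₑ := (w - u).stronglyMeasurable_grad.enorm
  have h1 : ∫⁻ x, ‖(w.abs - u.abs).toFun x‖ₑ ^ 2 ≤ 2 * ∫⁻ x, ‖(w - u).toFun x‖ₑ ^ 2 := by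
    refine le_trans (lintegral_mono_ae ?_) (le_mul_of_one_le_left zero_le (by norm_num))
    filter_upwards [H1.toFun_sub w.abs u.abs, H1.toFun_sub w u, u.toFun_abs, w.toFun_abs]
      with x h1 h2 h3 h4
    rw [h1, h2, Pi.sub_apply, Pi.sub_apply, h3, h4, ← ofReal_norm, ← ofReal_norm]
    gcongr
    exact abs_abs_sub_abs_le _ _
  have h2 : ∫⁻ x, ‖(w.abs - u.abs).grad x‖ₑ ^ 2 ≤ 2 * (∫⁻ x, ‖(w - u).grad x‖ₑ ^ 2) +
      2 * ∫⁻ x, ‖(w.toFun x / |w.toFun x| - u.toFun x / |u.toFun x|) • u.grad x‖ₑ ^ 2 := by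
    have m2 : Measurable fun x =>
        ‖(w.toFun x / |w.toFun x| - u.toFun x / |u.toFun x|) • u.grad x‖ₑ := by
      have := w.stronglyMeasurable_toFun.measurable
      have := u.stronglyMeasurable_toFun.measurable
      have := u.stronglyMeasurable_grad.measurable
      fun_prop
    rw [← lintegral_const_mul _ (m1.pow_const 2), ← lintegral_const_mul _ (m2.pow_const 2),
      ← lintegral_add_left ((m1.pow_const 2).const_mul 2)]
    refine lintegral_mono_ae ?_
    filter_upwards [H1.grad_sub w.abs u.abs, H1.grad_sub w u, u.grad_abs, w.grad_abs]
      with x h1 h2 h3 h4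
    rw [h1, h2, Pi.sub_apply, Pi.sub_apply, h3, h4]
    set a := w.toFun x / |w.toFun x|
    set b := u.toFun x / |u.toFun x|
    have e0 : a • w.grad x - b • u.grad x = a • (w.grad x - u.grad x) + (a - b) • u.grad x := by
      module
    have e1 : ‖a • w.grad x - b • u.grad x‖ ≤ ‖w.grad x - u.grad x‖ + ‖(a - b) • u.grad x‖ := by
      rw [e0]
      refine (norm_add_le _ _).trans (add_le_add_left ?_ _)
      rw [norm_smul]
      exact mul_le_of_le_one_left (norm_nonneg _) (abs_div_abs_le_one _)
    have e2 : ‖a • w.grad x - b • u.grad x‖ ^ 2 ≤ 2 * ‖w.grad x - u.grad x‖ ^ 2 +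
        2 * ‖(a - b) • u.grad x‖ ^ 2 := by
      have := norm_nonneg (a • w.grad x - b • u.grad x)
      nlinarith [sq_nonneg (‖w.grad x - u.grad x‖ - ‖(a - b) • u.grad x‖)]
    have e4 := ENNReal.ofReal_le_ofReal e2
    rwa [ENNReal.ofReal_add (by positivity) (by positivity), ENNReal.ofReal_mul (by positivity),
      ENNReal.ofReal_mul (by positivity), ENNReal.ofReal_pow (by positivity),
      ENNReal.ofReal_pow (by positivity), ENNReal.ofReal_pow (by positivity), ofReal_norm,
      ofReal_norm, ofReal_norm, ENNReal.ofReal_ofNat] at e4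
  rw [H1.ofReal_norm_sq, H1.ofReal_norm_sq, mul_add, add_assoc]
  exact add_le_add h1 h2

lemma H1.continuous_fst : Continuous fun u : H1 N => u.1.fst :=
  (WithLp.continuous_fst 2 _ _).comp continuous_subtype_val

/-- Along an almost everywhere convergent subsequence, the term (s(w_n) - s(u))∇u tends to 0 by
dominated convergence. The sign is discontinuous only at 0, and there ∇u vanishes. -/
theorem H1.continuous_abs : Continuous (H1.abs : H1 N → H1 N) := by
  refine continuous_iff_seqContinuous.2 fun w u hw => ?_
  refine Filter.tendsto_of_subseq_tendsto fun ns hns => ?_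
  have hw' := hw.comp hns
  have hfst : Filter.Tendsto (fun k => (w (ns k)).1.fst) Filter.atTop (nhds u.1.fst) :=
    (H1.continuous_fst.tendsto u).comp hw'
  obtain ⟨ms, hms, hae⟩ := (tendstoInMeasure_of_tendsto_Lp hfst).exists_seq_tendsto_ae
  refine ⟨ms, ?_⟩
  have hw'' := hw'.comp hms.tendsto_atTop
  set z : ℕ → H1 N := fun k => w (ns (ms k)) with hz
  have hzu : Filter.Tendsto z Filter.atTop (nhds u) := hw''
  have hD : Filter.Tendsto (fun k => ∫⁻ x, ‖((z k).toFun x / |(z k).toFun x| -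
      u.toFun x / |u.toFun x|) • u.grad x‖ₑ ^ 2) Filter.atTop (nhds 0) := by
    have h0 : (∫⁻ x : Space N, (0 : ℝ≥0∞)) = 0 := lintegral_zero
    rw [← h0]
    refine tendsto_lintegral_of_dominated_convergence (fun x => 4 * ‖u.grad x‖ₑ ^ 2) (fun k => ?_)
      (fun k => Filter.Eventually.of_forall fun x => ?_) ?_ ?_
    · have := (z k).stronglyMeasurable_toFun.measurable
      have := u.stronglyMeasurable_toFun.measurable
      have := u.stronglyMeasurable_grad.measurable
      fun_prop
    · have h1 : ‖((z k).toFun x / |(z k).toFun x| - u.toFun x / |u.toFun x|)‖ ≤ 2 := by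
        refine (norm_sub_le _ _).trans ?_
        have h1 := abs_div_abs_le_one ((z k).toFun x)
        have h2 := abs_div_abs_le_one (u.toFun x)
        rw [Real.norm_eq_abs, Real.norm_eq_abs]; linarith
      have h2 : ‖((z k).toFun x / |(z k).toFun x| - u.toFun x / |u.toFun x|)‖ₑ ≤ 2 := by
        rw [← ofReal_norm]
        exact (ENNReal.ofReal_le_ofReal h1).trans (by simp)
      simp only [enorm_smul, mul_pow]
      gcongr
      calc _ ≤ (2 : ℝ≥0∞) ^ 2 := by gcongr
        _ = 4 := by norm_num
    · rw [lintegral_const_mul _ (u.stronglyMeasurable_grad.enorm.pow_const 2)]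
      have := ((memLp_two_iff u.memLp_grad.1).1 u.memLp_grad).ne
      finiteness
    · filter_upwards [hae, u.grad_eq_zero] with x hx h0
      rcases eq_or_ne (u.toFun x) 0 with h | h
      · simp [h0 h]
      · have h1 := (tendsto_div_abs h).comp hx
        have h2 := ((h1.sub_const (u.toFun x / |u.toFun x|)).smul_const (u.grad x)).enorm
        rw [sub_self, zero_smul, enorm_zero] at h2
        have h3 := ENNReal.Tendsto.pow (n := 2) h2
        rw [zero_pow two_ne_zero] at h3
        exact h3
  have hN : Filter.Tendsto (fun k => ENNReal.ofReal (‖z k - u‖ ^ 2)) Filter.atTop (nhds 0) := by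
    have h1 := tendsto_iff_norm_sub_tendsto_zero.1 hzu
    have h2 := ENNReal.tendsto_ofReal (h1.pow 2)
    simpa using h2
  have hle : Filter.Tendsto (fun k => ENNReal.ofReal (‖(z k).abs - u.abs‖ ^ 2)) Filter.atTop
      (nhds 0) := by
    have h1 := (ENNReal.Tendsto.const_mul hN (Or.inr (by simp : (2 : ℝ≥0∞) ≠ ⊤))).add
      (ENNReal.Tendsto.const_mul hD (Or.inr (by simp : (2 : ℝ≥0∞) ≠ ⊤)))
    simp only [mul_zero, add_zero] at h1
    exact tendsto_of_tendsto_of_tendsto_of_le_of_le tendsto_const_nhds h1 (fun _ => zero_le)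
      fun k => H1.ofReal_norm_abs_sub_sq_le u (z k)
  rw [tendsto_iff_norm_sub_tendsto_zero]
  have h1 := (ENNReal.tendsto_toReal (by simp : (0 : ℝ≥0∞) ≠ ⊤)).comp hle
  have h2 := (Real.continuous_sqrt.tendsto _).comp h1
  simp only [ENNReal.toReal_zero, Real.sqrt_zero] at h2
  refine h2.congr fun k => ?_
  simp only [Function.comp_apply]
  rw [ENNReal.toReal_ofReal (by positivity), Real.sqrt_sq (norm_nonneg _)]

lemma H1.continuous_pos : Continuous (H1.pos : H1 N → H1 N) := by
  have : (H1.pos : H1 N → H1 N) = fun u => (2⁻¹ : ℝ) • (u + u.abs) := funext H1.pos_eq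
  rw [this]
  exact ((continuous_id (X := H1 N)).add H1.continuous_abs).const_smul (2⁻¹ : ℝ)

lemma H1.continuous_neg : Continuous (H1.neg : H1 N → H1 N) := by
  have : (H1.neg : H1 N → H1 N) = fun u => (2⁻¹ : ℝ) • (u - u.abs) := funext H1.neg_eq
  rw [this]
  exact ((continuous_id (X := H1 N)).sub H1.continuous_abs).const_smul (2⁻¹ : ℝ)

end Abs

/-! ### Winding number on the disc -/

section Degree

lemma circlePoint_zero_eq_two_pi : circlePoint (2 * Real.pi) = circlePoint 0 := by
  refine Subtype.ext ?_
  change Complex.exp (((2 * Real.pi : ℝ) : ℂ) * Complex.I) = Complex.exp (((0 : ℝ) : ℂ) * Complex.I)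
  simp [Complex.exp_two_pi_mul_I]

lemma continuous_circlePoint : Continuous circlePoint :=
  Continuous.subtype_mk (by fun_prop) _

lemma norm_circlePoint (s : ℝ) : ‖(circlePoint s : ℂ)‖ = 1 := Complex.norm_exp_ofReal_mul_I s

/-- The radial retraction of the plane onto the unit disc. -/
noncomputable def discRetraction : C(ℂ, Disc) where
  toFun z := ⟨((max 1 ‖z‖)⁻¹ : ℝ) • z, by
    have h : 0 < max 1 ‖z‖ := lt_max_of_lt_left one_pos
    rw [mem_closedBall_zero_iff, norm_smul, norm_inv, Real.norm_of_nonneg h.le]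
    exact inv_mul_le_one_of_le₀ (le_max_right _ _) h.le⟩
  continuous_toFun := by
    have h : ∀ z : ℂ, max 1 ‖z‖ ≠ 0 := fun z => (lt_max_of_lt_left one_pos).ne'
    exact Continuous.subtype_mk (by fun_prop (disch := exact h _)) _

lemma discRetraction_coe (t : Disc) : discRetraction t = t := by
  refine Subtype.ext ?_
  have h : ‖(t : ℂ)‖ ≤ 1 := mem_closedBall_zero_iff.1 t.2
  change ((max 1 ‖(t : ℂ)‖)⁻¹ : ℝ) • (t : ℂ) = t
  rw [max_eq_left h, inv_one, one_smul]

/-- A continuous integer-valued function of a real variable is constant. -/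
lemma eq_of_continuous_of_forall_int {d : ℝ → ℝ} (hd : Continuous d)
    (h : ∀ s, ∃ n : ℤ, d s = n) (s t : ℝ) : d s = d t := by
  choose g hg using h
  have hgc : Continuous g := by
    rw [Int.isClosedEmbedding_coe_real.isInducing.continuous_iff]
    exact hd.congr hg
  rw [hg, hg, PreconnectedSpace.constant inferInstance hgc]

/-- A continuous map on the disc with nonzero degree has a zero. -/
theorem HasDegree.exists_eq_zero {f : Disc → ℂ} (hf : Continuous f) {n : ℤ} (hn : n ≠ 0)
    (h : HasDegree f n) : ∃ t, f t = 0 := by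
  by_contra! h0
  obtain ⟨θ, hθ, hfθ, hdeg⟩ := h
  -- A zero-free map on the disc, extended to the plane by the retraction, has a continuous
  -- logarithm F. The imaginary part of F and θ differ on the circle by a constant multiple of 2π,
  -- and F takes the same value at both ends of the turn, so θ cannot increase.
  obtain ⟨F, ⟨-, hF⟩, -⟩ := Complex.isCoveringMapOn_exp.existsUnique_continuousMap_lifts
    ((⟨f, hf⟩ : C(Disc, ℂ)).comp discRetraction) (a₀ := 0)
    (e₀ := Complex.log (f (discRetraction 0))) (Complex.exp_log (h0 _)) (fun a => h0 _)
  have hF' : ∀ s, Complex.exp (F (circlePoint s)) = f (circlePoint s) := fun s => by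
    have := congrFun hF (circlePoint s : ℂ)
    simpa [discRetraction_coe] using this
  have hint : ∀ s, ∃ m : ℤ, ((F (circlePoint s)).im - θ s) / (2 * Real.pi) = m := fun s => by
    have h1 := hF' s
    have hn : (‖f (circlePoint s)‖ : ℂ) ≠ 0 := by simpa using h0 (circlePoint s)
    rw [hfθ s] at h1
    have h2 : Complex.exp (F (circlePoint s)) =
        (‖f (circlePoint s)‖ : ℂ) * Complex.exp ((F (circlePoint s)).im * Complex.I) := by
      rw [← hF' s, Complex.norm_exp, Complex.ofReal_exp, ← Complex.exp_add, Complex.re_add_im]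
    rw [h2] at h1
    obtain ⟨m, hm⟩ := Complex.exp_eq_exp_iff_exists_int.1 (mul_left_cancel₀ hn h1)
    refine ⟨m, ?_⟩
    have h3 := congrArg Complex.im hm
    simp at h3
    rw [h3]
    field_simp
    ring
  have hc := eq_of_continuous_of_forall_int (by
    have := continuous_circlePoint
    fun_prop) hint (2 * Real.pi) 0
  rw [circlePoint_zero_eq_two_pi] at hc
  have hpi := Real.pi_pos
  field_simp at hc
  have : 2 * Real.pi * n = 0 := by linarith
  simp [hn] at this

/-- A map which on the circle never is a nonpositive multiple of the identity has degree one. -/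
theorem hasDegree_one {f : Disc → ℂ} (hf : Continuous f)
    (h : ∀ t : Disc, ‖(t : ℂ)‖ = 1 → f t * (starRingEnd ℂ) t ∈ Complex.slitPlane) :
    HasDegree f 1 := by
  have hconj : ∀ s : ℝ, (starRingEnd ℂ) (circlePoint s : ℂ) = Complex.exp (-(s * Complex.I)) := by
    intro s
    change (starRingEnd ℂ) (Complex.exp (s * Complex.I)) = _
    rw [← Complex.exp_conj]
    simp
  -- The argument of f is that of the circle point, s, plus the principal argument of the quotient.
  -- The latter is continuous because the quotient stays in the slit plane, and it is 2π-periodic.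
  refine ⟨fun s => s + Complex.arg (f (circlePoint s) * (starRingEnd ℂ) (circlePoint s : ℂ)),
    ?_, fun s => ?_, ?_⟩
  · refine continuous_id.add (continuous_iff_continuousAt.2 fun s => ?_)
    refine ContinuousAt.comp (g := Complex.arg) (Complex.continuousAt_arg (h _ (norm_circlePoint s))) ?_
    have := continuous_circlePoint
    exact Continuous.continuousAt (by fun_prop)
  · have h1 := Complex.norm_mul_exp_arg_mul_I (f (circlePoint s) * (starRingEnd ℂ) (circlePoint s : ℂ))
    rw [norm_mul, RCLike.norm_conj, norm_circlePoint, mul_one] at h1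
    rw [Complex.ofReal_add, add_mul, Complex.exp_add, mul_left_comm, h1, hconj, mul_left_comm,
      ← Complex.exp_add, add_neg_cancel, Complex.exp_zero, mul_one]
  · simp only [circlePoint_zero_eq_two_pi]
    push_cast; ring

/-- If w z̄ were a nonpositive real, w and z would be real-proportional with opposite directions, so
no pair of corresponding coordinates could have a positive product. -/
lemma mem_slitPlane_of_same_sign {w z : ℂ} (h : 0 < w.re * z.re ∨ 0 < w.im * z.im) :
    w * (starRingEnd ℂ) z ∈ Complex.slitPlane := by
  rw [Complex.mem_slitPlane_iff]
  by_contra! hc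
  obtain ⟨h1, h2⟩ := hc
  simp only [Complex.mul_re, Complex.mul_im, Complex.conj_re, Complex.conj_im] at h1 h2
  have h3 : w.im * z.re = w.re * z.im := by linarith
  have h4 : (w.im * z.im) * z.re ^ 2 = (w.re * z.re) * z.im ^ 2 := by
    linear_combination z.im * z.re * h3
  rcases h with h | h
  · have hz : 0 < z.re ^ 2 := by
      have : z.re ≠ 0 := fun h0 => by simp [h0] at h
      positivity
    have : 0 ≤ w.im * z.im := by
      by_contra! hneg
      nlinarith [sq_nonneg z.im]
    linarith
  · have hz : 0 < z.im ^ 2 := by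
      have : z.im ≠ 0 := fun h0 => by simp [h0] at h
      positivity
    have : 0 ≤ w.re * z.re := by
      by_contra! hneg
      nlinarith [sq_nonneg z.re]
    linarith

end Degree

/-! ### Interaction, action functional and the map ξ -/

section Functional

/-- The range of parameters for which the action functional is studied. -/
structure Admissible (N : ℕ) (α p : ℝ) : Prop where
  one_le : 1 ≤ N
  pos : 0 < α
  lt : α < N
  two_lt : 2 < p
  subcritical : ((N : ℝ) - 2) * p ≤ N + α

/-- The constant `A_α` of the Riesz kernel. -/
noncomputable def rieszConst (N : ℕ) (α : ℝ) : ℝ :=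
  Real.Gamma ((N - α) / 2) / (Real.Gamma (α / 2) * Real.pi ^ ((N : ℝ) / 2) * 2 ^ α)

variable {N : ℕ} {α p : ℝ}

lemma rieszKernel_eq (N : ℕ) (α : ℝ) (x : Space N) :
    rieszKernel N α x = rieszConst N α * ‖x‖ ^ (-((N : ℝ) - α)) := by
  rw [rieszKernel, rieszConst, Real.rpow_neg (norm_nonneg _), div_eq_mul_inv]

namespace Admissible

lemma pow_pos (h : Admissible N α p) : 0 < p := by linarith [h.two_lt]

lemma rieszConst_pos (h : Admissible N α p) : 0 < rieszConst N α := by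
  have h1 := Real.Gamma_pos_of_pos (show 0 < ((N : ℝ) - α) / 2 by linarith [h.lt])
  have h2 := Real.Gamma_pos_of_pos (show 0 < α / 2 by linarith [h.pos])
  have := Real.pi_pos
  unfold rieszConst
  positivity

lemma hlsExp_eq (N : ℕ) (α : ℝ) :
    hlsExp N (N - α) = ENNReal.ofReal (2 * N / (N + α)) := by
  rw [hlsExp]; congr 2; ring

lemma one_le_hlsExp (h : Admissible N α p) : 1 ≤ hlsExp N (N - α) := by
  have h0 := h.pos
  have h1 := h.lt
  rw [hlsExp_eq, ENNReal.one_le_ofReal, le_div_iff₀ (by linarith)]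
  linarith

lemma toReal_exponent (h : Admissible N α p) :
    (hlsExp N (N - α) * ENNReal.ofReal p).toReal = 2 * N / (N + α) * p := by
  have h0 := h.pos
  have h1 := h.lt
  rw [hlsExp_eq, ENNReal.toReal_mul, ENNReal.toReal_ofReal (by positivity),
    ENNReal.toReal_ofReal h.pow_pos.le]

lemma one_le_exponent (h : Admissible N α p) : 1 ≤ hlsExp N (N - α) * ENNReal.ofReal p :=
  one_le_mul h.one_le_hlsExp (ENNReal.one_le_ofReal.2 (by linarith [h.two_lt]))

/-- The exponent is q = 2Np/(N+α). It is at least 2 because p > 2 and α < N, and at most critical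
exactly when (N-2)p ≤ N+α. -/
lemma exists_embedding (h : Admissible N α p)
    [Fact (1 ≤ hlsExp N (N - α) * ENNReal.ofReal p)] :
    ∃ ι : H1 N →L[ℝ] Lp ℝ (hlsExp N (N - α) * ENNReal.ofReal p) (volume : Measure (Space N)),
      ∀ u, ι u =ᵐ[volume] u.toFun := by
  have h0 := h.pos
  have h1 := h.lt
  have h2 := h.two_lt
  have h3 : 0 < (N : ℝ) + α := by linarith
  have h4 : (0 : ℝ) < N := by linarith
  refine exists_sobolev_embedding h.one_le (ENNReal.mul_ne_top ENNReal.ofReal_ne_top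
    ENNReal.ofReal_ne_top) ?_ ?_
  · rw [h.toReal_exponent, div_mul_eq_mul_div, le_div_iff₀ h3]
    nlinarith
  · rw [h.toReal_exponent, div_mul_eq_mul_div, mul_div_assoc', div_le_iff₀ h3]
    nlinarith [h.subcritical]

lemma memLp_abs_rpow (h : Admissible N α p) (u : H1 N) :
    MemLp (fun x => |u.toFun x| ^ p) (hlsExp N (N - α)) := by
  have : Fact (1 ≤ hlsExp N (N - α) * ENNReal.ofReal p) := ⟨h.one_le_exponent⟩
  obtain ⟨ι, hι⟩ := h.exists_embedding
  exact Choquard.memLp_abs_rpow h.pow_pos ((memLp_congr_ae (hι u)).1 (Lp.memLp (ι u)))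

lemma sub_pos (h : Admissible N α p) : 0 < (N : ℝ) - α := by linarith [h.lt]

lemma sub_lt (h : Admissible N α p) : (N : ℝ) - α < N := by linarith [h.pos]

end Admissible

lemma H1.measurable_abs_rpow (u : H1 N) (p : ℝ) : Measurable fun x => |u.toFun x| ^ p :=
  (u.stronglyMeasurable_toFun.measurable.abs).pow_const p

/-- Fubini's theorem, legitimate by the Hardy–Littlewood–Sobolev bound with lam = N - α. -/
lemma interaction_eq_rieszPair (h : Admissible N α p) (u w : H1 N) :
    interaction α p u w = rieszConst N α *
      rieszPair (N - α) (fun x => |u.toFun x| ^ p) (fun x => |w.toFun x| ^ p) := by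
  have hi := integrable_rieszPair h.one_le h.sub_pos h.sub_lt (u.measurable_abs_rpow p)
    (w.measurable_abs_rpow p) (h.memLp_abs_rpow u) (h.memLp_abs_rpow w)
  rw [rieszPair, Measure.volume_eq_prod, integral_prod _ (by rwa [← Measure.volume_eq_prod]),
    interaction, ← integral_const_mul]
  refine integral_congr_ae (Filter.Eventually.of_forall fun x => ?_)
  simp only [rieszPotential]
  rw [← integral_mul_const, ← integral_const_mul]
  refine integral_congr_ae (Filter.Eventually.of_forall fun y => ?_)
  simp only [rieszKernel_eq]
  ring

namespace Admissible

lemma interaction_comm (h : Admissible N α p) (u w : H1 N) :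
    interaction α p u w = interaction α p w u := by
  rw [interaction_eq_rieszPair h, interaction_eq_rieszPair h, rieszPair_comm]

lemma interaction_nonneg (h : Admissible N α p) (u w : H1 N) : 0 ≤ interaction α p u w := by
  rw [interaction_eq_rieszPair h]
  exact mul_nonneg h.rieszConst_pos.le (rieszPair_nonneg _ (fun _ => by positivity)
    (fun _ => by positivity))

lemma interaction_self_pos (h : Admissible N α p) {u : H1 N} (hu : u ≠ 0) :
    0 < interaction α p u u := by
  rw [interaction_eq_rieszPair h]
  refine mul_pos h.rieszConst_pos (rieszPair_self_pos h.one_le h.sub_pos h.sub_lt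
    (u.measurable_abs_rpow p) (h.memLp_abs_rpow u) (fun _ => by positivity) fun h0 => hu ?_)
  refine H1.ext_toFun ?_
  filter_upwards [h0, H1.toFun_zero] with x hx hz
  rw [hz, Pi.zero_apply]
  have := (Real.rpow_eq_zero (abs_nonneg _) h.pow_pos.ne').1 hx
  exact abs_eq_zero.1 this

lemma interaction_sq_le (h : Admissible N α p) (u w : H1 N) :
    interaction α p u w ^ 2 ≤ interaction α p u u * interaction α p w w := by
  simp only [interaction_eq_rieszPair h]
  have := rieszPair_sq_le h.one_le h.sub_pos h.sub_lt (u.measurable_abs_rpow p)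
    (w.measurable_abs_rpow p) (h.memLp_abs_rpow u) (h.memLp_abs_rpow w)
    (fun _ => by positivity) (fun _ => by positivity)
  have hA := sq_nonneg (rieszConst N α)
  nlinarith

lemma interaction_smul_right (_h : Admissible N α p) (u w : H1 N) (b : ℝ) :
    interaction α p u (b • w) = |b| ^ p * interaction α p u w := by
  rw [interaction, interaction, ← integral_const_mul]
  refine integral_congr_ae ?_
  filter_upwards [H1.toFun_smul b w] with x hx
  rw [hx, Pi.smul_apply, smul_eq_mul, abs_mul, Real.mul_rpow (abs_nonneg _) (abs_nonneg _)]
  ring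

lemma interaction_smul_left (h : Admissible N α p) (u w : H1 N) (a : ℝ) :
    interaction α p (a • u) w = |a| ^ p * interaction α p u w := by
  rw [h.interaction_comm, h.interaction_smul_right, h.interaction_comm]

end Admissible

lemma H1.abs_rpow_eq_add (hp : 0 < p) (u : H1 N) :
    ∀ᵐ x, |u.toFun x| ^ p = |u.pos.toFun x| ^ p + |u.neg.toFun x| ^ p := by
  filter_upwards [u.toFun_pos, u.toFun_neg] with x h1 h2
  rw [h1, h2]
  rcases le_total 0 (u.toFun x) with h | h
  · rw [max_eq_left h, min_eq_right h, abs_zero, Real.zero_rpow hp.ne', add_zero]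
  · rw [max_eq_right h, min_eq_left h, abs_zero, Real.zero_rpow hp.ne', zero_add]

namespace Admissible

lemma exists_bilinear (h : Admissible N α p) [Fact (1 ≤ hlsExp N (N - α))] :
    ∃ B : Lp ℝ (hlsExp N (N - α)) (volume : Measure (Space N)) →L[ℝ]
      Lp ℝ (hlsExp N (N - α)) (volume : Measure (Space N)) →L[ℝ] ℝ,
      (∀ f g, B f g = B g f) ∧ ∀ (f g : Lp ℝ (hlsExp N (N - α)) (volume : Measure (Space N)))
        (u w : H1 N), f =ᵐ[volume] (fun x => |u.toFun x| ^ p) →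
        g =ᵐ[volume] (fun x => |w.toFun x| ^ p) → B f g = interaction α p u w := by
  obtain ⟨B, hB⟩ := exists_rieszPair_clm h.one_le h.sub_pos h.sub_lt
  refine ⟨rieszConst N α • B, fun f g => ?_, fun f g u w hf hg => ?_⟩
  · simp only [smul_apply, hB]
    rw [rieszPair_comm]
  · simp only [smul_apply, hB]
    rw [interaction_eq_rieszPair h, rieszPair_congr _ hf hg, smul_eq_mul]

/-- The interaction is a continuous bilinear expression in `|u| ^ p` and `|w| ^ p`, and
`u ↦ |u| ^ p` is differentiable. -/
lemma exists_factorization (h : Admissible N α p) [Fact (1 ≤ hlsExp N (N - α))] :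
    ∃ (B : Lp ℝ (hlsExp N (N - α)) (volume : Measure (Space N)) →L[ℝ]
      Lp ℝ (hlsExp N (N - α)) (volume : Measure (Space N)) →L[ℝ] ℝ)
      (Ψ : H1 N → Lp ℝ (hlsExp N (N - α)) (volume : Measure (Space N))) (C : ℝ),
      (∀ f g, B f g = B g f) ∧ (∀ u w, interaction α p u w = B (Ψ u) (Ψ w)) ∧
      (∀ u, Ψ u =ᵐ[volume] fun x => |u.toFun x| ^ p) ∧ 0 ≤ C ∧ (∀ u, ‖Ψ u‖ ≤ C * ‖u‖ ^ p) ∧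
      ∀ u, ∃ L : H1 N →L[ℝ] Lp ℝ (hlsExp N (N - α)) (volume : Measure (Space N)),
        (∀ v, L v =ᵐ[volume] fun x => p * |u.toFun x| ^ (p - 2) * u.toFun x * v.toFun x) ∧
        HasFDerivAt Ψ L u := by
  have : Fact (1 ≤ hlsExp N (N - α) * ENNReal.ofReal p) := ⟨h.one_le_exponent⟩
  obtain ⟨ι, hι⟩ := h.exists_embedding
  obtain ⟨B, hB, hB'⟩ := h.exists_bilinear
  have hΨ : ∀ u, absPow (hlsExp N (N - α)) h.pow_pos (ι u) =ᵐ[volume] fun x => |u.toFun x| ^ p :=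
    fun u => (coeFn_absPow _ h.pow_pos (ι u)).trans (by
      filter_upwards [hι u] with x hx; rw [hx])
  refine ⟨B, fun u => absPow _ h.pow_pos (ι u), ‖ι‖ ^ p, hB,
    fun u w => (hB' _ _ u w (hΨ u) (hΨ w)).symm, hΨ, by positivity, fun u => ?_, fun u => ?_⟩
  · rw [norm_absPow]
    exact (Real.rpow_le_rpow (norm_nonneg _) (ι.le_opNorm u) h.pow_pos.le).trans_eq
      (Real.mul_rpow ι.opNorm_nonneg (norm_nonneg _))
  · obtain ⟨L, hL, hd⟩ := exists_hasFDerivAt_absPow (hlsExp N (N - α)) ENNReal.ofReal_ne_top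
      h.two_lt (ι u)
    refine ⟨L.comp ι, fun v => ?_, hd.comp u ι.hasFDerivAt⟩
    filter_upwards [hL (ι v), hι u, hι v] with x h1 h2 h3
    rw [ContinuousLinearMap.comp_apply, h1, h2, h3]

lemma continuous_interaction (h : Admissible N α p) :
    Continuous fun z : H1 N × H1 N => interaction α p z.1 z.2 := by
  have : Fact (1 ≤ hlsExp N (N - α)) := ⟨h.one_le_hlsExp⟩
  obtain ⟨B, Ψ, C, -, hB, -, -, -, hd⟩ := h.exists_factorization
  have hΨ : Continuous Ψ := continuous_iff_continuousAt.2 fun u =>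
    let ⟨_, _, h⟩ := hd u
    h.continuousAt
  simp only [hB]
  exact (B.continuous.comp (hΨ.comp continuous_fst)).clm_apply (hΨ.comp continuous_snd)

lemma exists_interaction_le (h : Admissible N α p) :
    ∃ C, 0 ≤ C ∧ ∀ u w : H1 N, interaction α p u w ≤ C * ‖u‖ ^ p * ‖w‖ ^ p := by
  have : Fact (1 ≤ hlsExp N (N - α)) := ⟨h.one_le_hlsExp⟩
  obtain ⟨B, Ψ, C, -, hB, -, hC, hle, -⟩ := h.exists_factorization
  refine ⟨‖B‖ * C * C, by positivity, fun u w => ?_⟩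
  rw [hB]
  calc B (Ψ u) (Ψ w) ≤ ‖B‖ * ‖Ψ u‖ * ‖Ψ w‖ := (Real.le_norm_self _).trans (B.le_opNorm₂ _ _)
    _ ≤ ‖B‖ * (C * ‖u‖ ^ p) * (C * ‖w‖ ^ p) := by gcongr <;> apply hle
    _ = _ := by ring

/-- The two parts have disjoint supports, so |u|^p = |u⁺|^p + |u⁻|^p, and the interaction is linear
in |u|^p. -/
lemma interaction_eq_pos_add_neg (h : Admissible N α p) (u w : H1 N) :
    interaction α p u w = interaction α p u.pos w + interaction α p u.neg w := by
  have : Fact (1 ≤ hlsExp N (N - α)) := ⟨h.one_le_hlsExp⟩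
  obtain ⟨B, Ψ, C, -, hB, hΨ, -⟩ := h.exists_factorization
  have : Ψ u = Ψ u.pos + Ψ u.neg := by
    refine Lp.ext ?_
    filter_upwards [hΨ u, hΨ u.pos, hΨ u.neg, u.abs_rpow_eq_add h.pow_pos,
      Lp.coeFn_add (Ψ u.pos) (Ψ u.neg)] with x h1 h2 h3 h4 h5
    rw [h1, h5, Pi.add_apply, h2, h3, h4]
  rw [hB, hB, hB, this, map_add, add_apply]

/-- The side condition on v holds for v = u, u⁺, u⁻, the only directions in which the derivative is
evaluated; it turns |u|^(p-2) u v into |v|^p. -/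
lemma hasFDerivAt_action (h : Admissible N α p) (u : H1 N) :
    ∃ L : H1 N →L[ℝ] ℝ, HasFDerivAt (action α p) L u ∧ ∀ v : H1 N,
      (∀ᵐ x, |u.toFun x| ^ (p - 2) * u.toFun x * v.toFun x = |v.toFun x| ^ p) →
      L v = inner ℝ u v - interaction α p u v := by
  have : Fact (1 ≤ hlsExp N (N - α)) := ⟨h.one_le_hlsExp⟩
  obtain ⟨B, Ψ, C, hsymm, hB, hΨ, -, -, hd⟩ := h.exists_factorization
  obtain ⟨L, hL, hd⟩ := hd u
  have h1 : HasFDerivAt (fun u : H1 N => B (Ψ u) (Ψ u)) _ u := (B.hasFDerivAt.comp u hd).clm_apply hd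
  have h2 : HasFDerivAt (fun u : H1 N => ‖u‖ ^ 2) _ u := (hasStrictFDerivAt_norm_sq u).hasFDerivAt
  have h3 := (h2.const_mul (1 / 2)).sub (h1.const_mul (1 / (2 * p)))
  refine ⟨_, h3.congr_of_eventuallyEq (Filter.Eventually.of_forall fun w => ?_), fun v hv => ?_⟩
  · simp only [action, energy_eq_norm_sq, hB, Pi.sub_apply]
  · have hLv : L v = p • Ψ v := by
      refine Lp.ext ?_
      filter_upwards [hL v, hΨ v, hv, Lp.coeFn_smul p (Ψ v)] with x e1 e2 e3 e4
      rw [e1, e4, Pi.smul_apply, e2, ← e3, smul_eq_mul]; ring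
    have hp0 := h.pow_pos.ne'
    have e1 : B (L v) (Ψ u) = p * interaction α p u v := by
      rw [hLv, map_smul, smul_apply, hsymm, ← hB, smul_eq_mul]
    have e2 : B (Ψ u) (L v) = p * interaction α p u v := by
      rw [hLv, map_smul, ← hB, smul_eq_mul]
    simp [e1, e2]
    field_simp
    ring

lemma differentiable_action (h : Admissible N α p) :
    Differentiable ℝ (action α p : H1 N → ℝ) := fun u =>
  let ⟨_, hL, _⟩ := h.hasFDerivAt_action u
  hL.differentiableAt

lemma fderiv_action_apply (h : Admissible N α p) {u v : H1 N}
    (hv : ∀ᵐ x, |u.toFun x| ^ (p - 2) * u.toFun x * v.toFun x = |v.toFun x| ^ p) :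
    fderiv ℝ (action α p) u v = inner ℝ u v - interaction α p u v := by
  obtain ⟨L, hL, hLv⟩ := h.hasFDerivAt_action u
  rw [hL.fderiv, hLv v hv]

end Admissible

lemma abs_rpow_mul_self_mul_self (hp : 2 < p) (t : ℝ) : |t| ^ (p - 2) * t * t = |t| ^ p := by
  rcases eq_or_ne t 0 with rfl | ht
  · simp [Real.zero_rpow (by linarith : p ≠ 0)]
  · have : 0 < |t| := abs_pos.2 ht
    rw [mul_assoc, ← sq, ← sq_abs, ← Real.rpow_natCast, ← Real.rpow_add this]
    congr 1; push_cast; ring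

namespace Admissible

lemma fderiv_action_self (h : Admissible N α p) (u : H1 N) :
    fderiv ℝ (action α p) u u = ‖u‖ ^ 2 - interaction α p u u := by
  rw [h.fderiv_action_apply, real_inner_self_eq_norm_sq]
  exact Filter.Eventually.of_forall fun x => abs_rpow_mul_self_mul_self h.two_lt _

lemma fderiv_action_pos (h : Admissible N α p) (u : H1 N) :
    fderiv ℝ (action α p) u u.pos = ‖u.pos‖ ^ 2 - interaction α p u u.pos := by
  rw [h.fderiv_action_apply, H1.inner_self_pos]
  filter_upwards [u.toFun_pos] with x hx
  rw [hx]
  rcases le_total 0 (u.toFun x) with h0 | h0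
  · rw [max_eq_left h0]; exact abs_rpow_mul_self_mul_self h.two_lt _
  · rw [max_eq_right h0, abs_zero, Real.zero_rpow h.pow_pos.ne', mul_zero]

lemma fderiv_action_neg (h : Admissible N α p) (u : H1 N) :
    fderiv ℝ (action α p) u u.neg = ‖u.neg‖ ^ 2 - interaction α p u u.neg := by
  rw [h.fderiv_action_apply, H1.inner_self_neg]
  filter_upwards [u.toFun_neg] with x hx
  rw [hx]
  rcases le_total 0 (u.toFun x) with h0 | h0
  · rw [min_eq_right h0, abs_zero, Real.zero_rpow h.pow_pos.ne', mul_zero]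
  · rw [min_eq_left h0]; exact abs_rpow_mul_self_mul_self h.two_lt _

/-- Division by zero gives 0, so the formula already yields -1 at w = 0 and the case distinction
disappears. -/
lemma xiPart_eq (u w : H1 N) : xiPart α p u w = interaction α p u w / ‖w‖ ^ 2 - 1 := by
  rw [xiPart, energy_eq_norm_sq]
  split_ifs with h0
  · simp [h0]
  · rfl

/-- Only points with T u = 0 need care. There the quotient is at most C ‖u‖^p ‖T u‖^(p-2), which
tends to 0 because p > 2. -/
lemma continuous_xiPart (h : Admissible N α p) {T : H1 N → H1 N} (hT : Continuous T) :
    Continuous fun u => xiPart α p u (T u) := by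
  refine continuous_iff_continuousAt.2 fun u => ?_
  simp only [xiPart_eq]
  refine ContinuousAt.sub ?_ continuousAt_const
  rcases eq_or_ne (T u) 0 with h0 | h0
  · obtain ⟨C, hC, hle⟩ := h.exists_interaction_le (N := N)
    have hb : ∀ u w : H1 N, interaction α p u w / ‖w‖ ^ 2 ≤ C * ‖u‖ ^ p * ‖w‖ ^ (p - 2) := by
      intro u w
      rcases eq_or_ne w 0 with rfl | hw
      · simp only [norm_zero, ne_eq, OfNat.ofNat_ne_zero, not_false_eq_true, zero_pow, div_zero]
        positivity
      · have hw' : 0 < ‖w‖ := norm_pos_iff.2 hw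
        rw [div_le_iff₀ (by positivity), mul_assoc, ← Real.rpow_natCast, ← Real.rpow_add hw']
        simpa using hle u w
    have hlim : ContinuousAt (fun u => C * ‖u‖ ^ p * ‖T u‖ ^ (p - 2)) u := by
      have h1 : Continuous fun u : H1 N => ‖u‖ ^ p :=
        continuous_norm.rpow_const fun _ => Or.inr h.pow_pos.le
      have h2 : Continuous fun u : H1 N => ‖T u‖ ^ (p - 2) :=
        hT.norm.rpow_const fun _ => Or.inr (by linarith [h.two_lt])
      fun_prop
    have h2 := hlim.tendsto
    rw [h0, norm_zero, Real.zero_rpow (by linarith [h.two_lt]), mul_zero] at h2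
    rw [ContinuousAt, h0, norm_zero, zero_pow two_ne_zero, div_zero]
    exact tendsto_of_tendsto_of_tendsto_of_le_of_le tendsto_const_nhds h2
      (fun v => div_nonneg (h.interaction_nonneg _ _) (sq_nonneg _)) fun v => hb _ _
  · refine ContinuousAt.div ?_ (by fun_prop) (by simpa using h0)
    exact (h.continuous_interaction.comp (continuous_id.prodMk hT)).continuousAt

theorem continuous_xi (h : Admissible N α p) : Continuous (xi α p : H1 N → ℂ) := by
  have h1 := h.continuous_xiPart H1.continuous_pos
  have h2 := h.continuous_xiPart H1.continuous_neg
  have : (xi α p : H1 N → ℂ) = fun u => (xiPart α p u u.pos : ℂ) + xiPart α p u u.neg * Complex.I := by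
    funext u; apply Complex.ext <;> simp [xi]
  rw [this]
  fun_prop

end Admissible

end Functional

/-! ### The Nehari manifold and the nodal Nehari set -/

section Nehari

variable {N : ℕ} {α p : ℝ}

/-- Continuously differentiable functions with compact support belong to `H¹`. -/
lemma exists_H1_of_contDiff {f : Space N → ℝ} (hf : ContDiff ℝ 1 f) (hc : HasCompactSupport f) :
    ∃ w : H1 N, w.toFun =ᵐ[volume] f := by
  have hgc : Continuous (gradient f) := by
    have h1 : Continuous (fderiv ℝ f) := hf.continuous_fderiv one_ne_zero
    exact (InnerProductSpace.toDual ℝ (Space N)).symm.continuous.comp h1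
  have hgs : HasCompactSupport (gradient f) := by
    refine (hc.fderiv (𝕜 := ℝ)).mono fun x hx h0 => hx ?_
    simp only [gradient, h0, map_zero]
  have hinner : ∀ x v, inner ℝ (gradient f x) v = fderiv ℝ f x v := fun x v => by
    simp [gradient]
  obtain ⟨w, hw, -⟩ := exists_H1 (hf.continuous.memLp_of_hasCompactSupport hc)
    (hgc.memLp_of_hasCompactSupport hgs) (fun φ hφ hφc v => by
      simp only [hinner]
      have hcont : Continuous (fun x => fderiv ℝ φ x v) :=
        (hφ.continuous_fderiv (by simp)).clm_apply continuous_const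
      have hcont' : Continuous (fun x => fderiv ℝ f x v) :=
        (hf.continuous_fderiv one_ne_zero).clm_apply continuous_const
      exact integral_mul_fderiv_eq_neg_fderiv_mul_of_integrable
        ((hcont'.mul hφ.continuous).integrable_of_hasCompactSupport hφc.mul_left)
        ((hf.continuous.mul hcont).integrable_of_hasCompactSupport hc.mul_right)
        ((hf.continuous.mul hφ.continuous).integrable_of_hasCompactSupport hc.mul_right)
        (fun x _ => hf.differentiable one_ne_zero x) (fun x _ => hφ.differentiable (by simp) x))
  exact ⟨w, hw⟩

/-- Take a bump function times a coordinate: it is positive at one basis vector and negative at its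
opposite. -/
lemma exists_pos_ne_zero_and_neg_ne_zero (hN : 1 ≤ N) : ∃ w : H1 N, w.pos ≠ 0 ∧ w.neg ≠ 0 := by
  let φ : ContDiffBump (0 : Space N) := ⟨1, 2, one_pos, one_lt_two⟩
  let i : Fin N := ⟨0, hN⟩
  let f : Space N → ℝ := fun x => φ x * x i
  have hproj : ContDiff ℝ 1 (fun x : Space N => x i) :=
    (EuclideanSpace.proj (𝕜 := ℝ) i : Space N →L[ℝ] ℝ).contDiff
  have hf : ContDiff ℝ 1 f := φ.contDiff.mul hproj
  have hval : ∀ t : ℝ, |t| ≤ 1 → f (EuclideanSpace.single i t) = t := fun t ht => by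
    have h1 : φ (EuclideanSpace.single i t) = 1 := by
      refine φ.one_of_mem_closedBall ?_
      rw [mem_closedBall_zero_iff, PiLp.norm_single]
      exact ht
    simp [f, h1]
  obtain ⟨w, hw⟩ := exists_H1_of_contDiff hf φ.hasCompactSupport.mul_right
  refine ⟨w, fun h0 => ?_, fun h0 => ?_⟩
  · have h1 : (fun x => max (f x) 0) =ᵐ[volume] fun _ => 0 := by
      filter_upwards [w.toFun_pos, hw, H1.toFun_zero (N := N)] with x h1 h2 h3
      rw [← h2, ← h1, h0, h3, Pi.zero_apply]
    have h2 := congrFun (((hf.continuous.max continuous_const).ae_eq_iff_eq volume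
      continuous_const).1 h1) (EuclideanSpace.single i 1)
    simp only [hval 1 (by simp)] at h2
    norm_num at h2
  · have h1 : (fun x => min (f x) 0) =ᵐ[volume] fun _ => 0 := by
      filter_upwards [w.toFun_neg, hw, H1.toFun_zero (N := N)] with x h1 h2 h3
      rw [← h2, ← h1, h0, h3, Pi.zero_apply]
    have h2 := congrFun (((hf.continuous.min continuous_const).ae_eq_iff_eq volume
      continuous_const).1 h1) (EuclideanSpace.single i (-1))
    simp only [hval (-1) (by simp)] at h2
    norm_num at h2

namespace Admissible

lemma mem_nehari (h : Admissible N α p) {u : H1 N} :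
    u ∈ nehari N α p ↔ u ≠ 0 ∧ interaction α p u u = ‖u‖ ^ 2 := by
  rw [nehari, Set.mem_ofPred_eq, h.fderiv_action_self, sub_eq_zero, eq_comm (a := ‖u‖ ^ 2)]

lemma mem_nehariNod (h : Admissible N α p) {u : H1 N} :
    u ∈ nehariNod N α p ↔ u.pos ≠ 0 ∧ u.neg ≠ 0 ∧ interaction α p u u.pos = ‖u.pos‖ ^ 2 ∧
      interaction α p u u.neg = ‖u.neg‖ ^ 2 := by
  rw [nehariNod, Set.mem_ofPred_eq, h.fderiv_action_pos, h.fderiv_action_neg, sub_eq_zero,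
    sub_eq_zero, eq_comm (a := ‖u.pos‖ ^ 2), eq_comm (a := ‖u.neg‖ ^ 2)]

lemma interaction_self_eq_add (h : Admissible N α p) (u : H1 N) :
    interaction α p u u = interaction α p u u.pos + interaction α p u u.neg := by
  rw [h.interaction_eq_pos_add_neg u u, h.interaction_comm u.pos, h.interaction_comm u.neg]

lemma nehariNod_subset (h : Admissible N α p) : nehariNod N α p ⊆ nehari N α p := by
  intro u hu
  obtain ⟨h1, h2, h3, h4⟩ := h.mem_nehariNod.1 hu
  refine h.mem_nehari.2 ⟨fun h0 => h1 ?_, ?_⟩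
  · have := u.norm_sq_pos_add_neg
    rw [h0, norm_zero] at this
    rw [h0, ← norm_eq_zero]
    nlinarith [sq_nonneg ‖(0 : H1 N).pos‖, sq_nonneg ‖(0 : H1 N).neg‖]
  · rw [h.interaction_self_eq_add, h3, h4, ← u.norm_sq_pos_add_neg]

lemma action_of_mem_nehari (h : Admissible N α p) {u : H1 N} (hu : u ∈ nehari N α p) :
    action α p u = (1 / 2 - 1 / (2 * p)) * ‖u‖ ^ 2 := by
  rw [action, energy_eq_norm_sq, (h.mem_nehari.1 hu).2]; ring

lemma const_pos (h : Admissible N α p) : 0 < 1 / 2 - 1 / (2 * p) := by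
  have := h.two_lt
  rw [_root_.sub_pos, div_lt_div_iff₀ (by linarith) two_pos]
  linarith

lemma xi_eq_zero_iff (h : Admissible N α p) {u : H1 N} :
    xi α p u = 0 ↔ u ∈ nehariNod N α p := by
  have key : ∀ w : H1 N, xiPart α p u w = 0 ↔ w ≠ 0 ∧ interaction α p u w = ‖w‖ ^ 2 := by
    intro w
    rw [xiPart, energy_eq_norm_sq]
    split_ifs with h0
    · simp [h0]
    · have : ‖w‖ ^ 2 ≠ 0 := by simpa using h0
      rw [sub_eq_zero, div_eq_one_iff_eq this]
      simp [h0]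
  rw [Complex.ext_iff, h.mem_nehariNod]
  change xiPart α p u u.pos = 0 ∧ xiPart α p u u.neg = 0 ↔ _
  rw [key, key]
  tauto

lemma bddBelow_action_nehari (h : Admissible N α p) :
    0 ∈ lowerBounds (action α p '' nehari N α p) := by
  rintro _ ⟨u, hu, rfl⟩
  rw [h.action_of_mem_nehari hu]
  exact mul_nonneg h.const_pos.le (sq_nonneg _)

lemma c0_le (h : Admissible N α p) {u : H1 N} (hu : u ∈ nehari N α p) :
    c0 N α p ≤ action α p u :=
  csInf_le ⟨0, h.bddBelow_action_nehari⟩ ⟨u, hu, rfl⟩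

lemma bddBelow_action_nehariNod (h : Admissible N α p) :
    BddBelow (action α p '' nehariNod N α p) :=
  ⟨0, fun _ hx => h.bddBelow_action_nehari (Set.image_mono h.nehariNod_subset hx)⟩

lemma cNod_le (h : Admissible N α p) {u : H1 N} (hu : u ∈ nehariNod N α p) :
    cNod N α p ≤ action α p u :=
  csInf_le h.bddBelow_action_nehariNod ⟨u, hu, rfl⟩

lemma c0_nonneg (h : Admissible N α p) : 0 ≤ c0 N α p :=
  Real.sInf_nonneg fun _ hx => h.bddBelow_action_nehari hx

/-- Every ray meets the Nehari manifold. -/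
lemma exists_smul_mem_nehari (h : Admissible N α p) {w : H1 N} (hw : w ≠ 0) :
    ∃ t : ℝ, 0 < t ∧ t • w ∈ nehari N α p := by
  have hI := h.interaction_self_pos hw
  have hE : 0 < ‖w‖ ^ 2 := by have := norm_pos_iff.2 hw; positivity
  have hp : 0 < 2 * p - 2 := by linarith [h.two_lt]
  -- Solution of t^(2p) I = t² ‖w‖², where I is the self-interaction of w.
  set t := (‖w‖ ^ 2 / interaction α p w w) ^ (1 / (2 * p - 2)) with ht
  have ht0 : 0 < t := by positivity
  refine ⟨t, ht0, h.mem_nehari.2 ⟨smul_ne_zero ht0.ne' hw, ?_⟩⟩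
  have h1 : t ^ (2 * p - 2) = ‖w‖ ^ 2 / interaction α p w w := by
    rw [ht, ← Real.rpow_mul (by positivity), one_div_mul_cancel hp.ne', Real.rpow_one]
  have h2 : t ^ p * t ^ p = t ^ 2 * t ^ (2 * p - 2) := by
    rw [← Real.rpow_add ht0, ← Real.rpow_natCast, ← Real.rpow_add ht0]
    congr 1; push_cast; ring
  rw [h.interaction_smul_left, h.interaction_smul_right, abs_of_pos ht0, ← mul_assoc, h2, h1,
    norm_smul, Real.norm_of_nonneg ht0.le]
  field_simp

lemma nehari_nonempty (h : Admissible N α p) : (nehari N α p).Nonempty := by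
  obtain ⟨w, hw, -⟩ := exists_pos_ne_zero_and_neg_ne_zero h.one_le
  obtain ⟨t, -, ht⟩ := h.exists_smul_mem_nehari hw
  exact ⟨_, ht⟩

end Admissible

end Nehari

/-! ### The two-parameter family of a sign-changing function -/

section NodalFamily

variable {N : ℕ} {α p : ℝ}

/-- The two-parameter family `σ^(1/p) u⁺ + τ^(1/p) u⁻`. -/
noncomputable def nodalFamily (p : ℝ) (w : H1 N) (σ τ : ℝ) : H1 N :=
  σ ^ (1 / p) • w.pos + τ ^ (1 / p) • w.neg

lemma continuous_nodalFamily (hp : 0 < p) (w : H1 N) :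
    Continuous fun z : ℝ × ℝ => nodalFamily p w z.1 z.2 := by
  have h1 : Continuous fun z : ℝ × ℝ => z.1 ^ (1 / p) :=
    continuous_fst.rpow_const fun _ => Or.inr (by positivity)
  have h2 : Continuous fun z : ℝ × ℝ => z.2 ^ (1 / p) :=
    continuous_snd.rpow_const fun _ => Or.inr (by positivity)
  exact (h1.smul continuous_const).add (h2.smul continuous_const)

lemma pos_nodalFamily (p : ℝ) (w : H1 N) {σ τ : ℝ} (hσ : 0 ≤ σ) (hτ : 0 ≤ τ) :
    (nodalFamily p w σ τ).pos = σ ^ (1 / p) • w.pos :=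
  (w.parts_of_combination (by positivity) (by positivity)).1

lemma neg_nodalFamily (p : ℝ) (w : H1 N) {σ τ : ℝ} (hσ : 0 ≤ σ) (hτ : 0 ≤ τ) :
    (nodalFamily p w σ τ).neg = τ ^ (1 / p) • w.neg :=
  (w.parts_of_combination (by positivity) (by positivity)).2

lemma abs_rpow_one_div_rpow (hp : 0 < p) {σ : ℝ} (hσ : 0 ≤ σ) : |σ ^ (1 / p)| ^ p = σ := by
  rw [abs_of_nonneg (by positivity), ← Real.rpow_mul hσ, one_div_mul_cancel hp.ne', Real.rpow_one]

lemma norm_rpow_smul_sq (p : ℝ) (w : H1 N) {σ : ℝ} (hσ : 0 ≤ σ) :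
    ‖σ ^ (1 / p) • w‖ ^ 2 = σ ^ (2 / p) * ‖w‖ ^ 2 := by
  rw [norm_smul, Real.norm_of_nonneg (by positivity), mul_pow, ← Real.rpow_natCast,
    ← Real.rpow_mul hσ]
  congr 2; push_cast; ring

namespace Admissible

lemma interaction_nodalFamily_pos (h : Admissible N α p) (w : H1 N) {σ τ : ℝ} (hσ : 0 ≤ σ)
    (hτ : 0 ≤ τ) :
    interaction α p (nodalFamily p w σ τ) (nodalFamily p w σ τ).pos =
      σ ^ 2 * interaction α p w.pos w.pos + σ * τ * interaction α p w.pos w.neg := by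
  rw [h.interaction_eq_pos_add_neg, pos_nodalFamily p w hσ hτ, neg_nodalFamily p w hσ hτ]
  simp only [h.interaction_smul_left, h.interaction_smul_right, abs_rpow_one_div_rpow h.pow_pos hσ,
    abs_rpow_one_div_rpow h.pow_pos hτ, h.interaction_comm w.neg w.pos]
  ring

lemma interaction_nodalFamily_neg (h : Admissible N α p) (w : H1 N) {σ τ : ℝ} (hσ : 0 ≤ σ)
    (hτ : 0 ≤ τ) :
    interaction α p (nodalFamily p w σ τ) (nodalFamily p w σ τ).neg =
      τ ^ 2 * interaction α p w.neg w.neg + σ * τ * interaction α p w.pos w.neg := by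
  rw [h.interaction_eq_pos_add_neg, pos_nodalFamily p w hσ hτ, neg_nodalFamily p w hσ hτ]
  simp only [h.interaction_smul_left, h.interaction_smul_right, abs_rpow_one_div_rpow h.pow_pos hσ,
    abs_rpow_one_div_rpow h.pow_pos hτ]
  ring

/-- The exponent 1/p in the parametrisation is what makes the nonlocal part a quadratic form in (σ,
τ) while the norm part is concave. -/
lemma action_nodalFamily (h : Admissible N α p) (w : H1 N) {σ τ : ℝ} (hσ : 0 ≤ σ) (hτ : 0 ≤ τ) :
    action α p (nodalFamily p w σ τ) =
      1 / 2 * (σ ^ (2 / p) * ‖w.pos‖ ^ 2 + τ ^ (2 / p) * ‖w.neg‖ ^ 2) - 1 / (2 * p) *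
        (σ ^ 2 * interaction α p w.pos w.pos + 2 * σ * τ * interaction α p w.pos w.neg +
          τ ^ 2 * interaction α p w.neg w.neg) := by
  rw [action, energy_eq_norm_sq, H1.norm_sq_pos_add_neg, h.interaction_self_eq_add,
    h.interaction_nodalFamily_pos w hσ hτ, h.interaction_nodalFamily_neg w hσ hτ,
    pos_nodalFamily p w hσ hτ, neg_nodalFamily p w hσ hτ, norm_rpow_smul_sq p _ hσ,
    norm_rpow_smul_sq p _ hτ]
  ring

end Admissible

end NodalFamily

/-! ### Energy estimates and the minimax principle -/

section Minimax

variable {N : ℕ} {α p : ℝ}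

/-- Weighted arithmetic–geometric mean with weights 1/p and 1 - 1/p for y² and x^((p-2)/(p-1)). -/
lemma young_ray {x y : ℝ} (hp : 2 < p) (hx : 0 ≤ x) (hy : 0 ≤ y) :
    1 / 2 * (x ^ (1 - 2 / p) * y ^ (2 / p)) - 1 / (2 * p) * y ^ 2 ≤
      (1 / 2 - 1 / (2 * p)) * x ^ ((p - 2) / (p - 1)) := by
  have hp0 : 0 < p := by linarith
  have hp1 : 0 < p - 1 := by linarith
  have h1 : 1 / p ≤ 1 := by rw [div_le_one hp0]; linarith
  have h := Real.geom_mean_le_arith_mean2_weighted (w₁ := 1 / p) (w₂ := 1 - 1 / p)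
    (p₁ := y ^ 2) (p₂ := x ^ ((p - 2) / (p - 1))) (by positivity) (by linarith) (by positivity)
    (by positivity) (by ring)
  have e1 : (y ^ 2) ^ (1 / p) = y ^ (2 / p) := by
    rw [← Real.rpow_natCast, ← Real.rpow_mul hy]; congr 1; push_cast; ring
  have e2 : (x ^ ((p - 2) / (p - 1))) ^ (1 - 1 / p) = x ^ (1 - 2 / p) := by
    rw [← Real.rpow_mul hx]; congr 1; field_simp
  rw [e1, e2] at h
  have e3 : 1 / (2 * p) = 1 / 2 * (1 / p) := by ring
  rw [e3]
  linarith

/-- Used with E the squared norm of a part, a its self-interaction and S = ‖w‖². It is `young_ray`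
at x = E/S, y = σE/S, multiplied by S; the hypothesis on a replaces E²/S by a. -/
lemma ray_le {E a S σ : ℝ} (hp : 2 < p) (hE : 0 < E) (hS : 0 < S) (ha : E ^ 2 ≤ a * S)
    (hσ : 0 ≤ σ) : 1 / 2 * (σ ^ (2 / p) * E) - 1 / (2 * p) * (σ ^ 2 * a) ≤
      (1 / 2 - 1 / (2 * p)) * S * (E / S) ^ ((p - 2) / (p - 1)) := by
  have hp0 : 0 < p := by linarith
  have hx : 0 < E / S := by positivity
  have h := mul_le_mul_of_nonneg_left (young_ray hp hx.le (mul_nonneg hσ hx.le)) hS.le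
  have e1 : (E / S) ^ (1 - 2 / p) * (σ * (E / S)) ^ (2 / p) = σ ^ (2 / p) * (E / S) := by
    rw [Real.mul_rpow hσ hx.le, mul_left_comm, ← Real.rpow_add hx]
    simp
  rw [e1] at h
  have e2 : S * (E / S) ^ 2 ≤ a := by
    rw [div_pow, mul_div_assoc', div_le_iff₀ (by positivity)]
    nlinarith
  have e3 : 1 / (2 * p) * (σ ^ 2 * (S * (E / S) ^ 2)) ≤ 1 / (2 * p) * (σ ^ 2 * a) := by gcongr
  have e4 : S * (1 / 2 * (σ ^ (2 / p) * (E / S))) = 1 / 2 * (σ ^ (2 / p) * E) := by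
    field_simp
  nlinarith

lemma max_rpow_le {A K x : ℝ} (hp : 2 < p) (hK : 0 ≤ K) (hx : 0 ≤ x)
    (h : A ≤ K * x ^ ((p - 2) / (p - 1))) :
    (max A 0) ^ ((p - 1) / (p - 2)) ≤ K ^ ((p - 1) / (p - 2)) * x := by
  have h1 : 0 < p - 1 := by linarith
  have h2 : 0 < p - 2 := by linarith
  calc (max A 0) ^ ((p - 1) / (p - 2)) ≤ (K * x ^ ((p - 2) / (p - 1))) ^ ((p - 1) / (p - 2)) :=
        Real.rpow_le_rpow (le_max_right _ _) (max_le h (by positivity)) (by positivity)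
    _ = K ^ ((p - 1) / (p - 2)) * x := by
        rw [Real.mul_rpow hK (by positivity), ← Real.rpow_mul hx]
        have : (p - 2) / (p - 1) * ((p - 1) / (p - 2)) = 1 := by field_simp
        rw [this, Real.rpow_one]

lemma exists_mul_rpow_le (hp : 1 < p) (K : ℝ) {c : ℝ} (hc : 0 < c) :
    ∀ᶠ T : ℝ in Filter.atTop, K * T ^ (2 / p) ≤ c * T ^ 2 := by
  have h1 : 2 / p < 2 := by rw [div_lt_iff₀ (by linarith)]; linarith
  filter_upwards [(tendsto_rpow_atTop (by linarith : 0 < 2 - 2 / p)).eventually_ge_atTop (K / c),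
    Filter.eventually_gt_atTop 0] with T h2 h3
  have h4 : T ^ 2 = T ^ (2 - 2 / p) * T ^ (2 / p) := by
    rw [← Real.rpow_add h3, ← Real.rpow_natCast]; congr 1; push_cast; ring
  rw [h4, ← mul_assoc]
  gcongr
  rwa [div_le_iff₀' hc] at h2

/-- An increasing piecewise linear function, equal to `0` for `x ≤ -1/√2` and to `T` for
`x ≥ 1/√2`. -/
noncomputable def ramp (T x : ℝ) : ℝ := T * max 0 (min 1 ((1 + √2 * x) / 2))

lemma continuous_ramp (T : ℝ) : Continuous (ramp T) := by unfold ramp; fun_prop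

lemma ramp_nonneg {T : ℝ} (hT : 0 ≤ T) (x : ℝ) : 0 ≤ ramp T x :=
  mul_nonneg hT (le_max_left _ _)

lemma ramp_le {T : ℝ} (hT : 0 ≤ T) (x : ℝ) : ramp T x ≤ T :=
  mul_le_of_le_one_right hT (max_le zero_le_one (min_le_left _ _))

lemma ramp_eq (T : ℝ) {x : ℝ} (hx : 1 / 2 ≤ x ^ 2) :
    (x < 0 ∧ ramp T x = 0) ∨ (0 < x ∧ ramp T x = T) := by
  have h1 : 1 ≤ |√2 * x| := by
    rw [← sq_le_sq₀ zero_le_one (abs_nonneg _), sq_abs, mul_pow, Real.sq_sqrt (by norm_num)]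
    linarith
  have h2 : 0 < √2 := by positivity
  rcases le_abs'.1 h1 with h | h
  · refine Or.inl ⟨by nlinarith, ?_⟩
    rw [ramp, max_eq_left ((min_le_right _ _).trans (by linarith)), mul_zero]
  · refine Or.inr ⟨by nlinarith, ?_⟩
    rw [ramp, min_eq_left (by linarith), max_eq_right zero_le_one, mul_one]

lemma half_le_sq_or {z : ℂ} (hz : ‖z‖ = 1) : 1 / 2 ≤ z.re ^ 2 ∨ 1 / 2 ≤ z.im ^ 2 := by
  have h := Complex.sq_norm z
  rw [hz, Complex.normSq_apply] at h
  by_contra! hc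
  nlinarith [hc.1, hc.2]

namespace Admissible

lemma norm_sq_pos {w : H1 N} (hw : w ≠ 0) : 0 < ‖w‖ ^ 2 := by
  have := norm_pos_iff.2 hw
  positivity

lemma xi_re_of_zero (h : Admissible N α p) (w : H1 N) {τ : ℝ} (hτ : 0 ≤ τ) :
    (xi α p (nodalFamily p w 0 τ)).re = -1 := by
  have hp := h.pow_pos
  change xiPart α p _ _ = -1
  rw [pos_nodalFamily p w le_rfl hτ, Real.zero_rpow (by positivity), zero_smul, xiPart, if_pos rfl]

lemma xi_im_of_zero (h : Admissible N α p) (w : H1 N) {σ : ℝ} (hσ : 0 ≤ σ) :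
    (xi α p (nodalFamily p w σ 0)).im = -1 := by
  have hp := h.pow_pos
  change xiPart α p _ _ = -1
  rw [neg_nodalFamily p w hσ le_rfl, Real.zero_rpow (by positivity), zero_smul, xiPart, if_pos rfl]

/-- The cross interaction only increases the numerator, so the sign is settled by the
self-interaction alone, whatever τ ≥ 0 is. -/
lemma xi_re_pos (h : Admissible N α p) {w : H1 N} (hw : w.pos ≠ 0) {σ τ : ℝ} (hσ : 0 < σ)
    (hτ : 0 ≤ τ) (hlt : σ ^ (2 / p) * ‖w.pos‖ ^ 2 < interaction α p w.pos w.pos * σ ^ 2) :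
    0 < (xi α p (nodalFamily p w σ τ)).re := by
  change 0 < xiPart α p _ _
  have h1 := norm_sq_pos hw
  have h2 := mul_nonneg (mul_nonneg hσ.le hτ) (h.interaction_nonneg w.pos w.neg)
  rw [xiPart_eq, h.interaction_nodalFamily_pos w hσ.le hτ, pos_nodalFamily p w hσ.le hτ,
    norm_rpow_smul_sq p _ hσ.le, _root_.sub_pos, one_lt_div (by positivity)]
  linarith

lemma xi_im_pos (h : Admissible N α p) {w : H1 N} (hw : w.neg ≠ 0) {σ τ : ℝ} (hσ : 0 ≤ σ)
    (hτ : 0 < τ) (hlt : τ ^ (2 / p) * ‖w.neg‖ ^ 2 < interaction α p w.neg w.neg * τ ^ 2) :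
    0 < (xi α p (nodalFamily p w σ τ)).im := by
  change 0 < xiPart α p _ _
  have h1 := norm_sq_pos hw
  have h2 := mul_nonneg (mul_nonneg hσ hτ.le) (h.interaction_nonneg w.pos w.neg)
  rw [xiPart_eq, h.interaction_nodalFamily_neg w hσ hτ.le, neg_nodalFamily p w hσ hτ.le,
    norm_rpow_smul_sq p _ hτ.le, _root_.sub_pos, one_lt_div (by positivity)]
  linarith

lemma action_nodalFamily_nonpos (h : Admissible N α p) (w : H1 N) {T σ τ : ℝ} (hσ : 0 ≤ σ)
    (hτ : 0 ≤ τ) (hσT : σ ≤ T) (hτT : τ ≤ T)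
    (hle : p * (‖w.pos‖ ^ 2 + ‖w.neg‖ ^ 2) * T ^ (2 / p) ≤
      σ ^ 2 * interaction α p w.pos w.pos + τ ^ 2 * interaction α p w.neg w.neg) :
    action α p (nodalFamily p w σ τ) ≤ 0 := by
  have hp := h.pow_pos
  have h1 : σ ^ (2 / p) ≤ T ^ (2 / p) := Real.rpow_le_rpow hσ hσT (by positivity)
  have h2 : τ ^ (2 / p) ≤ T ^ (2 / p) := Real.rpow_le_rpow hτ hτT (by positivity)
  have h3 := mul_nonneg (mul_nonneg hσ hτ) (h.interaction_nonneg w.pos w.neg)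
  have h4 := mul_le_mul_of_nonneg_right h1 (sq_nonneg ‖w.pos‖)
  have h5 := mul_le_mul_of_nonneg_right h2 (sq_nonneg ‖w.neg‖)
  rw [h.action_nodalFamily w hσ hτ, sub_nonpos]
  have h6 : 1 / (2 * p) * (p * (‖w.pos‖ ^ 2 + ‖w.neg‖ ^ 2) * T ^ (2 / p)) ≤ 1 / (2 * p) *
      (σ ^ 2 * interaction α p w.pos w.pos + 2 * σ * τ * interaction α p w.pos w.neg +
        τ ^ 2 * interaction α p w.neg w.neg) := by
    gcongr
    linarith
  refine le_trans ?_ h6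
  have h7 : 1 / (2 * p) * (p * (‖w.pos‖ ^ 2 + ‖w.neg‖ ^ 2) * T ^ (2 / p)) =
      1 / 2 * ((‖w.pos‖ ^ 2 + ‖w.neg‖ ^ 2) * T ^ (2 / p)) := by field_simp
  rw [h7]
  linarith

/-- The disc, mapped onto the cone spanned by the two parts of a sign-changing function. -/
lemma exists_disc (h : Admissible N α p) {w : H1 N} (hp : w.pos ≠ 0) (hn : w.neg ≠ 0) :
    ∃ γ : C(Disc, H1 N), (∀ t, ∃ σ τ, 0 ≤ σ ∧ 0 ≤ τ ∧ γ t = nodalFamily p w σ τ) ∧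
      (∀ t : Disc, ‖(t : ℂ)‖ = 1 →
        xi α p (γ t) * (starRingEnd ℂ) t ∈ Complex.slitPlane) ∧
      ∀ t : Disc, ‖(t : ℂ)‖ = 1 → action α p (γ t) ≤ 0 ∨ ∃ σ, 0 ≤ σ ∧
        (γ t = nodalFamily p w σ 0 ∨ γ t = nodalFamily p w 0 σ) := by
  have h2 := h.two_lt
  have ha := h.interaction_self_pos hp
  have hb := h.interaction_self_pos hn
  have hEp := norm_sq_pos hp
  have hEn := norm_sq_pos hn
  -- Since 2/p < 2, T can be so large that each self-interaction at T dominates the whole norm term.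
  -- This makes both the coordinate of ξ positive and the action nonpositive wherever the
  -- corresponding parameter equals T.
  obtain ⟨T, hTa, hTb, hT⟩ := ((exists_mul_rpow_le (by linarith : 1 < p)
    (p * (‖w.pos‖ ^ 2 + ‖w.neg‖ ^ 2)) ha).and ((exists_mul_rpow_le (by linarith : 1 < p)
    (p * (‖w.pos‖ ^ 2 + ‖w.neg‖ ^ 2)) hb).and (Filter.eventually_gt_atTop 0))).exists
  have hT0 := hT.le
  have hTp : 0 < T ^ (2 / p) := by positivity
  have hre : T ^ (2 / p) * ‖w.pos‖ ^ 2 < interaction α p w.pos w.pos * T ^ 2 := by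
    refine lt_of_lt_of_le ?_ hTa
    rw [mul_comm]
    gcongr
    nlinarith
  have him : T ^ (2 / p) * ‖w.neg‖ ^ 2 < interaction α p w.neg w.neg * T ^ 2 := by
    refine lt_of_lt_of_le ?_ hTb
    rw [mul_comm]
    gcongr
    nlinarith
  let γ : C(Disc, H1 N) := ⟨fun t => nodalFamily p w (ramp T (t : ℂ).re) (ramp T (t : ℂ).im), by
    refine (continuous_nodalFamily h.pow_pos w).comp (g := fun z : ℝ × ℝ => nodalFamily p w z.1 z.2)
      (f := fun t : Disc => (ramp T (t : ℂ).re, ramp T (t : ℂ).im)) ?_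
    have := continuous_ramp T
    fun_prop⟩
  have hγ : ∀ t, γ t = nodalFamily p w (ramp T (t : ℂ).re) (ramp T (t : ℂ).im) := fun t => rfl
  have hr := fun x => ramp_nonneg hT0 x
  refine ⟨γ, fun t => ⟨_, _, hr _, hr _, hγ t⟩, fun t ht => mem_slitPlane_of_same_sign ?_,
    fun t ht => ?_⟩
  -- At a boundary point some coordinate has modulus at least 1/√2, so its ramp is saturated: at 0
  -- that coordinate of ξ is -1, at T it is positive, in both cases with the sign of the disc
  -- coordinate.
  · rcases half_le_sq_or ht with h1 | h1 <;> rcases ramp_eq T h1 with ⟨h3, h4⟩ | ⟨h3, h4⟩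
    · left; rw [hγ, h4, h.xi_re_of_zero w (hr _)]; linarith
    · left; rw [hγ, h4]; exact mul_pos (h.xi_re_pos hp hT (hr _) hre) h3
    · right; rw [hγ, h4, h.xi_im_of_zero w (hr _)]; linarith
    · right; rw [hγ, h4]; exact mul_pos (h.xi_im_pos hn (hr _) hT him) h3
  · rcases half_le_sq_or ht with h1 | h1 <;> rcases ramp_eq T h1 with ⟨h3, h4⟩ | ⟨h3, h4⟩
    · right; exact ⟨ramp T (t : ℂ).im, hr _, Or.inr (by rw [hγ, h4])⟩
    · left
      rw [hγ, h4]
      refine h.action_nodalFamily_nonpos w hT0 (hr _) le_rfl (ramp_le hT0 _) ?_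
      have := mul_nonneg (sq_nonneg (ramp T (t : ℂ).im)) hb.le
      linarith
    · right; exact ⟨ramp T (t : ℂ).re, hr _, Or.inl (by rw [hγ, h4])⟩
    · left
      rw [hγ, h4]
      refine h.action_nodalFamily_nonpos w (hr _) hT0 (ramp_le hT0 _) le_rfl ?_
      have := mul_nonneg (sq_nonneg (ramp T (t : ℂ).re)) ha.le
      linarith

/-- A disc on which `ξ` has degree one intersects the nodal Nehari set. -/
lemma exists_mem_nehariNod (h : Admissible N α p) (γ : C(Disc, H1 N))
    (hd : HasDegree (fun t => xi α p (γ t)) 1) : ∃ t, γ t ∈ nehariNod N α p := by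
  obtain ⟨t, ht⟩ := HasDegree.exists_eq_zero (h.continuous_xi.comp γ.continuous) one_ne_zero hd
  exact ⟨t, h.xi_eq_zero_iff.1 ht⟩

/-- The degree argument itself produces an element, starting from any sign-changing function. -/
lemma nehariNod_nonempty (h : Admissible N α p) : (nehariNod N α p).Nonempty := by
  obtain ⟨w, hp, hn⟩ := exists_pos_ne_zero_and_neg_ne_zero h.one_le
  obtain ⟨γ, -, hγ, -⟩ := h.exists_disc hp hn
  obtain ⟨t, ht⟩ := h.exists_mem_nehariNod γ
    (hasDegree_one (h.continuous_xi.comp γ.continuous) hγ)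
  exact ⟨_, ht⟩

lemma isGLB_c0 (h : Admissible N α p) : IsGLB (action α p '' nehari N α p) (c0 N α p) :=
  isGLB_csInf (h.nehari_nonempty.image _) ⟨0, h.bddBelow_action_nehari⟩

lemma isGLB_cNod (h : Admissible N α p) : IsGLB (action α p '' nehariNod N α p) (cNod N α p) :=
  isGLB_csInf (h.nehariNod_nonempty.image _) h.bddBelow_action_nehariNod

/-- On the nodal Nehari set the two-parameter family has maximal action at the function itself. -/
lemma action_nodalFamily_le (h : Admissible N α p) {w : H1 N} (hw : w ∈ nehariNod N α p)
    {σ τ : ℝ} (hσ : 0 ≤ σ) (hτ : 0 ≤ τ) : action α p (nodalFamily p w σ τ) ≤ action α p w := by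
  obtain ⟨-, -, h1, h2⟩ := h.mem_nehariNod.1 hw
  have hp := h.pow_pos
  have hp2 := h.two_lt
  rw [h.interaction_eq_pos_add_neg] at h1 h2
  rw [h.interaction_comm w.neg] at h1
  have hsq := h.interaction_sq_le w.pos w.neg
  have ha := h.interaction_nonneg w.pos w.pos
  have hb := h.interaction_nonneg w.neg w.neg
  rw [h.action_nodalFamily w hσ hτ, h.action_of_mem_nehari (h.nehariNod_subset hw),
    w.norm_sq_pos_add_neg, ← h1, ← h2]
  set a := interaction α p w.pos w.pos
  set b := interaction α p w.neg w.neg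
  set m := interaction α p w.pos w.neg
  have hm : 0 ≤ m := h.interaction_nonneg _ _
  -- Bernoulli: the concave function s^(2/p) lies below its tangent at s = 1.
  have bern : ∀ s : ℝ, 0 ≤ s → s ^ (2 / p) ≤ 1 + 2 / p * (s - 1) := fun s hs => by
    have := rpow_one_add_le_one_add_mul_self (s := s - 1) (by linarith) (p := 2 / p)
      (by positivity) (by rw [div_le_one hp]; linarith)
    simpa using this
  have h3 := mul_le_mul_of_nonneg_right (bern σ hσ) (by linarith : 0 ≤ a + m)
  have h4 := mul_le_mul_of_nonneg_right (bern τ hτ) (by linarith : 0 ≤ m + b)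
  -- The form is positive semidefinite because m² ≤ ab; when a = 0 this forces m = 0.
  have quad : ∀ x y : ℝ, 0 ≤ x ^ 2 * a + 2 * x * y * m + y ^ 2 * b := by
    intro x y
    rcases ha.eq_or_lt with h0 | h0
    · have : m = 0 := by
        rw [← h0, zero_mul] at hsq
        nlinarith
      rw [← h0, this]
      nlinarith [mul_nonneg (sq_nonneg y) hb]
    · have h5 : 0 ≤ a * (x ^ 2 * a + 2 * x * y * m + y ^ 2 * b) := by
        nlinarith [sq_nonneg (a * x + m * y), mul_nonneg (sq_nonneg y) (sub_nonneg.2 hsq)]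
      exact nonneg_of_mul_nonneg_right h5 h0
  have h5 := mul_nonneg (by positivity : 0 ≤ 1 / (2 * p)) (quad (σ - 1) (τ - 1))
  -- After the tangent bound, the deficit is exactly 1/(2p) times the quadratic form at (σ-1, τ-1).
  have e : (1 / 2 - 1 / (2 * p)) * (a + m + (m + b)) -
      (1 / 2 * ((1 + 2 / p * (σ - 1)) * (a + m) + (1 + 2 / p * (τ - 1)) * (m + b)) -
        1 / (2 * p) * (σ ^ 2 * a + 2 * σ * τ * m + τ ^ 2 * b)) =
      1 / (2 * p) * ((σ - 1) ^ 2 * a + 2 * (σ - 1) * (τ - 1) * m + (τ - 1) ^ 2 * b) := by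
    field_simp
    ring
  linarith

/-- The action on the rays spanned by the two parts of a function of the nodal Nehari set. -/
lemma max_action_rpow_le (h : Admissible N α p) {w : H1 N} (hw : w ∈ nehariNod N α p)
    {σ : ℝ} (hσ : 0 ≤ σ) :
    (max (action α p (nodalFamily p w σ 0)) 0) ^ ((p - 1) / (p - 2)) ≤
        action α p w ^ ((p - 1) / (p - 2)) * (‖w.pos‖ ^ 2 / ‖w‖ ^ 2) ∧
      (max (action α p (nodalFamily p w 0 σ)) 0) ^ ((p - 1) / (p - 2)) ≤
        action α p w ^ ((p - 1) / (p - 2)) * (‖w.neg‖ ^ 2 / ‖w‖ ^ 2) := by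
  obtain ⟨hpos, hneg, h1, h2⟩ := h.mem_nehariNod.1 hw
  have hp := h.pow_pos
  have hE := norm_sq_pos hpos
  have hE' := norm_sq_pos hneg
  have hS : 0 < ‖w‖ ^ 2 := by rw [w.norm_sq_pos_add_neg]; linarith
  rw [h.interaction_eq_pos_add_neg] at h1 h2
  rw [h.interaction_comm w.neg] at h1
  have hsq := h.interaction_sq_le w.pos w.neg
  have hk := h.const_pos
  have hz : (0 : ℝ) ^ (2 / p) = 0 := Real.zero_rpow (by positivity)
  rw [h.action_of_mem_nehari (h.nehariNod_subset hw)]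
  constructor
  · refine max_rpow_le h.two_lt (by positivity) (by positivity) ?_
    rw [h.action_nodalFamily w hσ le_rfl]
    refine le_trans (le_of_eq ?_) (ray_le (a := interaction α p w.pos w.pos) h.two_lt hE hS ?_ hσ)
    · rw [hz]; ring
    -- On the nodal Nehari set E = a + m and S = a + 2m + b, so E² ≤ aS is precisely m² ≤ ab.
    · rw [w.norm_sq_pos_add_neg, ← h1, ← h2]
      nlinarith
  · refine max_rpow_le h.two_lt (by positivity) (by positivity) ?_
    rw [h.action_nodalFamily w le_rfl hσ]
    refine le_trans (le_of_eq ?_) (ray_le (a := interaction α p w.neg w.neg) h.two_lt hE' hS ?_ hσ)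
    · rw [hz]; ring
    · rw [w.norm_sq_pos_add_neg, ← h1, ← h2]
      nlinarith

/-- The ray of each part meets the Nehari manifold, where the action is at least c₀, and the action
on that ray is bounded by `max_action_rpow_le`. -/
lemma c0_rpow_le (h : Admissible N α p) {w : H1 N} (hw : w ∈ nehariNod N α p) :
    c0 N α p ^ ((p - 1) / (p - 2)) ≤
        action α p w ^ ((p - 1) / (p - 2)) * (‖w.pos‖ ^ 2 / ‖w‖ ^ 2) ∧
      c0 N α p ^ ((p - 1) / (p - 2)) ≤
        action α p w ^ ((p - 1) / (p - 2)) * (‖w.neg‖ ^ 2 / ‖w‖ ^ 2) := by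
  obtain ⟨hpos, hneg, -, -⟩ := h.mem_nehariNod.1 hw
  have h2 := h.two_lt
  have hp := h.pow_pos
  have hκ : 0 ≤ (p - 1) / (p - 2) := div_nonneg (by linarith) (by linarith)
  have hz : (0 : ℝ) ^ (1 / p) = 0 := Real.zero_rpow (by positivity)
  have hpow : ∀ t : ℝ, 0 < t → (t ^ p) ^ (1 / p) = t := fun t ht => by
    rw [← Real.rpow_mul ht.le, mul_one_div_cancel hp.ne', Real.rpow_one]
  constructor
  · obtain ⟨t, ht, htm⟩ := h.exists_smul_mem_nehari hpos
    refine le_trans (Real.rpow_le_rpow h.c0_nonneg ((h.c0_le htm).trans ?_) hκ)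
      (h.max_action_rpow_le hw (σ := t ^ p) (by positivity)).1
    rw [nodalFamily, hz, zero_smul, add_zero, hpow t ht]
    exact le_max_left _ _
  · obtain ⟨t, ht, htm⟩ := h.exists_smul_mem_nehari hneg
    refine le_trans (Real.rpow_le_rpow h.c0_nonneg ((h.c0_le htm).trans ?_) hκ)
      (h.max_action_rpow_le hw (σ := t ^ p) (by positivity)).2
    rw [nodalFamily, hz, zero_smul, zero_add, hpow t ht]
    exact le_max_left _ _

/-- Every function of the nodal Nehari set with action close to the infimum gives an admissible
disc. -/
lemma exists_mem_minimaxClass (h : Admissible N α p) {ε : ℝ} {w : H1 N}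
    (hw : w ∈ nehariNod N α p)
    (hε : action α p w ^ ((p - 1) / (p - 2)) ≤ cNod N α p ^ ((p - 1) / (p - 2)) + ε) :
    ∃ γ ∈ minimaxClass N α p ε, ∀ t, action α p (γ t) ≤ action α p w := by
  obtain ⟨hpos, hneg, -, -⟩ := h.mem_nehariNod.1 hw
  obtain ⟨γ, h1, h2, h3⟩ := h.exists_disc hpos hneg
  have hp2 := h.two_lt
  have hκ : 0 < (p - 1) / (p - 2) := div_pos (by linarith) (by linarith)
  refine ⟨γ, ⟨fun t ht h0 => ?_, hasDegree_one (h.continuous_xi.comp γ.continuous) h2,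
    fun t ht => ?_⟩, fun t => ?_⟩
  · have := h2 t ht
    rw [h0, zero_mul] at this
    exact Complex.zero_notMem_slitPlane this
  · have hS : 0 < ‖w‖ ^ 2 := by
      rw [w.norm_sq_pos_add_neg]; linarith [norm_sq_pos hpos, norm_sq_pos hneg]
    have hsum : action α p w ^ ((p - 1) / (p - 2)) * (‖w.pos‖ ^ 2 / ‖w‖ ^ 2) +
        action α p w ^ ((p - 1) / (p - 2)) * (‖w.neg‖ ^ 2 / ‖w‖ ^ 2) =
        action α p w ^ ((p - 1) / (p - 2)) := by
      rw [← mul_add, ← add_div, ← w.norm_sq_pos_add_neg, div_self hS.ne', mul_one]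
    have hc := h.c0_rpow_le hw
    -- Where the action is nonpositive, c₀ ≤ 𝒜(w) suffices. On the ray of one part, its share of
    -- 𝒜(w)^κ, κ = (p-1)/(p-2), is the whole minus the share of the other part, and the latter is at
    -- least c₀^κ.
    rcases h3 t ht with h4 | ⟨σ, hσ, h4 | h4⟩
    · rw [max_eq_right h4, Real.zero_rpow hκ.ne']
      have h5 := Real.rpow_le_rpow h.c0_nonneg
        (h.c0_le (h.nehariNod_subset hw)) hκ.le
      linarith
    · have h5 := (h.max_action_rpow_le hw hσ).1
      rw [h4]
      linarith
    · have h5 := (h.max_action_rpow_le hw hσ).2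
      rw [h4]
      linarith
  · obtain ⟨σ, τ, hσ, hτ, h4⟩ := h1 t
    rw [h4]
    exact h.action_nodalFamily_le hw hσ hτ

theorem cNod_eq_iInf_iSup (h : Admissible N α p) {ε : ℝ} (hε : 0 < ε) :
    (cNod N α p : EReal) =
      ⨅ γ ∈ minimaxClass N α p ε, ⨆ t : Disc, (action α p (γ t) : EReal) := by
  refine le_antisymm (le_iInf₂ fun γ hγ => ?_) (EReal.le_of_forall_lt_iff_le.1 fun z hz => ?_)
  · obtain ⟨t, ht⟩ := h.exists_mem_nehariNod γ hγ.2.1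
    exact le_iSup_of_le t (EReal.coe_le_coe_iff.2 (h.cNod_le ht))
  · have hz' : cNod N α p < z := EReal.coe_lt_coe_iff.1 hz
    have hp2 := h.two_lt
    have hκ : 0 < (p - 1) / (p - 2) := div_pos (by linarith) (by linarith)
    -- Continuity of the power at `cNod` provides a level y above it, below z, with y^κ less than
    -- cNod^κ + ε; any nodal Nehari function with action below y then gives an admissible disc.
    have hcont : ContinuousAt (fun x : ℝ => x ^ ((p - 1) / (p - 2))) (cNod N α p) :=
      (Real.continuous_rpow_const hκ.le).continuousAt
    have hev : ∀ᶠ x in nhdsWithin (cNod N α p) (Set.Ioi (cNod N α p)),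
        x ^ ((p - 1) / (p - 2)) < cNod N α p ^ ((p - 1) / (p - 2)) + ε ∧ x < z :=
      nhdsWithin_le_nhds ((hcont.eventually (gt_mem_nhds (by linarith))).and (gt_mem_nhds hz'))
    obtain ⟨y, ⟨hy1, hy2⟩, hy3⟩ := (hev.and self_mem_nhdsWithin).exists
    obtain ⟨_, ⟨w, hw, rfl⟩, hwy⟩ := exists_lt_of_csInf_lt (h.nehariNod_nonempty.image _) hy3
    have hw0 : 0 ≤ action α p w :=
      h.c0_nonneg.trans (h.c0_le (h.nehariNod_subset hw))
    obtain ⟨γ, hγ, hle⟩ := h.exists_mem_minimaxClass hw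
      ((Real.rpow_le_rpow hw0 hwy.le hκ.le).trans hy1.le)
    exact iInf₂_le_of_le γ hγ (iSup_le fun t =>
      EReal.coe_le_coe_iff.2 ((hle t).trans (hwy.le.trans hy2.le)))

end Admissible

end Minimax

end Choquard

theorem mainTheorem5 (N : ℕ) (hN : 1 ≤ N) (α p : ℝ) (hα : 0 < α) (hαN : α < N)
    (hp : 0 < p) (hp_lower : ((N : ℝ) - 2) / (N + α) ≤ 1 / p) (hp_upper : 1 / p < 1 / 2) :
    -- the action functional is differentiable, its infima are finite, and `ξ` is continuous
    Differentiable ℝ (Choquard.action α p : Choquard.H1 N → ℝ) ∧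
    IsGLB (Choquard.action α p '' Choquard.nehari N α p) (Choquard.c0 N α p) ∧
    IsGLB (Choquard.action α p '' Choquard.nehariNod N α p) (Choquard.cNod N α p) ∧
    Continuous (Choquard.xi α p : Choquard.H1 N → ℂ) ∧
    -- the minimax principle
    ∀ ε : ℝ, 0 < ε →
      ((Choquard.cNod N α p : EReal) =
          ⨅ γ ∈ Choquard.minimaxClass N α p ε, ⨆ t : Choquard.Disc,
            (Choquard.action α p (γ t) : EReal)) ∧
      ∀ γ ∈ Choquard.minimaxClass N α p ε, (Set.range γ ∩ Choquard.nehariNod N α p).Nonempty := by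
  have hN0 : (0 : ℝ) < N := hα.trans hαN
  have h : Choquard.Admissible N α p := by
    refine ⟨hN, hα, hαN, ?_, ?_⟩
    · rwa [one_div_lt_one_div hp two_pos] at hp_upper
    · rw [div_le_div_iff₀ (by positivity) hp] at hp_lower
      linarith
  refine ⟨h.differentiable_action, h.isGLB_c0, h.isGLB_cNod, h.continuous_xi, fun ε hε =>
    ⟨h.cNod_eq_iInf_iSup hε, fun γ hγ => ?_⟩⟩
  obtain ⟨t, ht⟩ := h.exists_mem_nehariNod γ hγ.2.1
  exact ⟨γ t, ⟨t, rfl⟩, ht⟩
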